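/- Let $n \ge 1$, let $A \in \mathbb{C}^{n\times n}$, and let $f : \Omega \to \mathbb{C}$ be analytic on an open set $\Omega \subseteq \mathbb{C}$ that contains the numerical range $W(A) = \{v^*Av : v \in \mathbb{C}^n,\ \|v\|_2 = 1\}$. For matrices $X$ with all eigenvalues in $\Omega$, let $f(X) = \frac{1}{2\pi \mathrm{i}} \oint_{\Gamma} f(z)\,(zI-X)^{-1}\,\mathrm{d}z$ be the usual matrix function, where the contour $\Gamma$ consists of sufficiently small positively oriented circles around the distinct eigenvalues of $X$. Then there is exactly one linear operator $Df\{A\} : \mathbb{C}^{n\times n} \to \mathbb{C}^{n\times n}$ (the Fréchet derivative of the matrix function $f$ at $A$) such that $$ f(A+\Delta) = f(A) + Df\{A\}(\Delta) + O(\|\Delta\|_2^2) \qquad (\Delta \to 0), $$ where $\|\cdot\|_2$ on matrices is the spectral norm. The function $|f'|$ attains a maximum on $W(A)$, and $$ \|Df\{A\}\|_2 \le (1+\sqrt{2})^2 \max_{z \in W(A)} |f'(z)|, $$ where $\|Df\{A\}\|_2 = \max\{\|Df\{A\}(X)\|_F : X \in \mathbb{C}^{n\times n},\ \|X\|_F \le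 1\}$ is the operator norm induced by the Frobenius norm $\|\cdot\|_F$. -/

import Mathlib

open Filter Topology

namespace MatFun

/-- The numerical range `W(A) = {v* A v : ‖v‖₂ = 1}`. -/
def numericalRange {n : ℕ} (A : Matrix (Fin n) (Fin n) ℂ) : Set ℂ :=
  {z | ∃ v : EuclideanSpace ℂ (Fin n), ‖v‖ = 1 ∧ z = star v.ofLp ⬝ᵥ (A.mulVec v.ofLp)}

/-- The spectral norm: the operator norm induced by the Euclidean norm of vectors. -/
noncomputable def spectralNorm {n : ℕ} (A : Matrix (Fin n) (Fin n) ℂ) : ℝ :=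
  ‖Matrix.toEuclideanCLM (𝕜 := ℂ) A‖

/-- The Frobenius norm. -/
noncomputable def frobeniusNorm {n : ℕ} (A : Matrix (Fin n) (Fin n) ℂ) : ℝ :=
  √(∑ i, ∑ j, ‖A i j‖ ^ 2)

/-- The operator norm, induced by the Frobenius norm, of a linear operator on matrices. The set is
bounded, since the space of matrices is finite dimensional. -/
noncomputable def inducedNorm {n : ℕ}
    (L : Matrix (Fin n) (Fin n) ℂ →ₗ[ℂ] Matrix (Fin n) (Fin n) ℂ) : ℝ :=
  sSup {c | ∃ X, frobeniusNorm X ≤ 1 ∧ c = frobeniusNorm (L X)}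

/-- The finite set of eigenvalues of `A` (the distinct roots of its characteristic polynomial). -/
noncomputable def eigs {n : ℕ} (A : Matrix (Fin n) (Fin n) ℂ) : Finset ℂ :=
  A.charpoly.roots.toFinset

/-- The (entrywise) Cauchy integral `(2πi)⁻¹ ∮_Γ f(z) (zI - A)⁻¹ dz`, where the contour `Γ` is made
of the positively oriented circles of radius `r` around the eigenvalues of `A`. -/
noncomputable def cauchySum {n : ℕ} (f : ℂ → ℂ) (A : Matrix (Fin n) (Fin n) ℂ) (r : ℝ) :
    Matrix (Fin n) (Fin n) ℂ :=
  Matrix.of fun i j => (2 * Real.pi * Complex.I)⁻¹ *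
    ∑ μ ∈ eigs A, ∮ z in C(μ, r), f z * (z • (1 : Matrix (Fin n) (Fin n) ℂ) - A)⁻¹ i j

/-- The matrix function `f(A)`, for `f` analytic in a neighbourhood of the eigenvalues of `A`: the
value of the Cauchy integral for all sufficiently small radii `r`. This value does not depend
on `r`, see `matrixFunction_eq_cauchySum`. -/
noncomputable def matrixFunction {n : ℕ} (f : ℂ → ℂ) (A : Matrix (Fin n) (Fin n) ℂ) :
    Matrix (Fin n) (Fin n) ℂ :=
  limUnder (𝓝[>] (0 : ℝ)) (cauchySum f A)

lemma differentiableAt_resolvent {n : ℕ} (A : Matrix (Fin n) (Fin n) ℂ) (i j : Fin n) {z : ℂ}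
    (hz : z ∉ eigs A) :
    DifferentiableAt ℂ (fun z : ℂ => (z • (1 : Matrix (Fin n) (Fin n) ℂ) - A)⁻¹ i j) z := by
  have hdet : ∀ B : ℂ → Matrix (Fin n) (Fin n) ℂ, (∀ a b, Differentiable ℂ fun z => B z a b) →
      Differentiable ℂ fun z => (B z).det := by
    intro B hB
    simp only [Matrix.det_apply]
    fun_prop
  have h0 : ∀ a b, Differentiable ℂ fun z : ℂ => (z • (1 : Matrix (Fin n) (Fin n) ℂ) - A) a b := by
    intro a b
    simp only [Matrix.sub_apply, Matrix.smul_apply]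
    fun_prop
  have hne : (z • (1 : Matrix (Fin n) (Fin n) ℂ) - A).det ≠ 0 := by
    intro h
    apply hz
    rw [eigs, Multiset.mem_toFinset, Polynomial.mem_roots (Matrix.charpoly_monic A).ne_zero,
      Polynomial.IsRoot.def, Matrix.eval_charpoly, ← h, Matrix.scalar_apply, Matrix.smul_one_eq_diagonal]
  simp only [Matrix.inv_def, Ring.inverse_eq_inv', Matrix.smul_apply, Matrix.adjugate_apply,
    smul_eq_mul]
  refine DifferentiableAt.mul ((hdet _ h0 z).inv hne) (hdet _ ?_ z)
  intro a b
  by_cases h : a = j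
  · subst h; simp
  · simp only [Matrix.updateRow_ne h]
    exact h0 a b

/-- The Cauchy integral is the same for all radii for which the discs around the eigenvalues lie
in the domain of analyticity and contain no further eigenvalue. -/
theorem matrixFunction_eq_cauchySum {n : ℕ} {f : ℂ → ℂ} {Ω : Set ℂ} (hf : AnalyticOnNhd ℂ f Ω)
    (A : Matrix (Fin n) (Fin n) ℂ) {r : ℝ} (hr : 0 < r)
    (hΩ : ∀ μ ∈ eigs A, Metric.closedBall μ r ⊆ Ω)
    (hsep : ∀ μ ∈ eigs A, ∀ ν ∈ eigs A, ν ∈ Metric.closedBall μ r → ν = μ) :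
    matrixFunction f A = cauchySum f A r := by
  have key : ∀ s ∈ Set.Ioc 0 r, cauchySum f A r = cauchySum f A s := by
    intro s hs
    ext i j
    simp only [cauchySum, Matrix.of_apply]
    congr 1
    refine Finset.sum_congr rfl fun μ hμ => ?_
    have hd : ∀ z ∈ Metric.closedBall μ r \ Metric.ball μ s, DifferentiableAt ℂ
        (fun z => f z * (z • (1 : Matrix (Fin n) (Fin n) ℂ) - A)⁻¹ i j) z := by
      intro z hz
      refine (hf z (hΩ μ hμ hz.1)).differentiableAt.mul (differentiableAt_resolvent A i j ?_)
      intro hmem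
      have := hsep μ hμ z hmem hz.1
      subst this
      exact hz.2 (Metric.mem_ball_self hs.1)
    refine Complex.circleIntegral_eq_of_differentiable_on_annulus_off_countable hs.1 hs.2
      Set.countable_empty (fun z hz => (hd z hz).continuousAt.continuousWithinAt) ?_
    intro z hz
    exact hd z ⟨Metric.ball_subset_closedBall hz.1.1,
      fun h => hz.1.2 (Metric.ball_subset_closedBall h)⟩
  refine Tendsto.limUnder_eq (tendsto_const_nhds.congr' ?_)
  filter_upwards [Ioc_mem_nhdsGT hr] with s hs using key s hs

/-- `L` is the Fréchet derivative `Df{A}`: a linear operator on matrices with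
`f(A + Δ) = f(A) + L(Δ) + O(‖Δ‖₂²)` as `Δ → 0`. -/
def IsFrechetDerivative {n : ℕ} (f : ℂ → ℂ) (A : Matrix (Fin n) (Fin n) ℂ)
    (L : Matrix (Fin n) (Fin n) ℂ →ₗ[ℂ] Matrix (Fin n) (Fin n) ℂ) : Prop :=
  (fun Δ => spectralNorm (matrixFunction f (A + Δ) - matrixFunction f A - L Δ))
    =O[𝓝 0] fun Δ => spectralNorm Δ ^ 2

end MatFun

/-! ### Convex curves given by support functions, and Cauchy integrals over them. -/

namespace MatFun

/-! The derivative is the contour integral `Df{A}(X) = (2πi)⁻¹ ∮ f(z) R(z) X R(z) dz` with `R(z) =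
(z - A)⁻¹`, taken over one smooth convex curve around W(A). Comparing residues
(`IsResidueSum.prod_inv_mul_eq`) turns the small circles in the definition of f(A) into this curve
(`toEuclideanCLM_matrixFunction`), and the second order expansion of the resolvent then gives the
derivative with a quadratic error (`isFrechetDerivative_of_eq_cint`).

For the bound, matrices are vectorized, so that the Frobenius norm becomes Euclidean. Left and right
multiplication by A become operators A₁ and B₁ that commute with each other and with each other's
adjoints, and a curve that encloses W(A) encloses the numerical ranges of both. The derivative
becomes `∮ f(z) (z - B₁)⁻¹ (z - A₁)⁻¹ dz`, which is the divided difference `f[A₁, B₁]`. It is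
evaluated one variable at a time: `G(x) = f[x, B₁]` is the calculus of B₁ applied to `y ↦ f[x, y]`,
and `f[A₁, B₁]` is the calculus of A₁ applied to the operator valued function G. Each evaluation
costs a factor `1 + √2`, and `|f[x, y]| ≤ sup |f'|` because the region is convex
(`norm_cint_smul_resolvent_mul_resolvent_le`).

The factor `1 + √2` is the theorem of Crouzeix and Palencia for functions F whose values and their
adjoints commute with A (`IsContractive.norm_cint_le`). With T and S the Cauchy integrals of F and
of `F*` against the resolvent, `T + S*` is the integral of F against a positive operator density of
total mass 2, so its norm is at most 2. Moreover `T S T` is the calculus applied to `F g F`, where g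
is the Cauchy transform of the boundary values `F*`, and `‖g‖ ≤ 1`
(`norm_cauchyTransform_star_le_one`). Hence the best constant K satisfies `K³ ≤ 2K² + K`.

Finally W(A) is compact and convex (Toeplitz–Hausdorff), and smooth curves approximate it from
outside (`exists_supportCurve`). The estimate therefore holds with any number above the maximum of
`|f'|`, and uniqueness of the derivative allows passing to the maximum itself. -/

/-- A closed convex curve given by its support function `p` (with derivatives `p'`, `p''`). -/
structure SupportCurve where
  p : ℝ → ℝ
  p' : ℝ → ℝ
  p'' : ℝ → ℝ
  hasDerivAt_p : ∀ t, HasDerivAt p (p' t) t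
  hasDerivAt_p' : ∀ t, HasDerivAt p' (p'' t) t
  continuous_p'' : Continuous p''
  periodic_p : Function.Periodic p (2 * Real.pi)
  periodic_p' : Function.Periodic p' (2 * Real.pi)
  nonneg : ∀ t, 0 ≤ p t + p'' t

/-- The unit vector `e^{it}`. -/
noncomputable def expI (t : ℝ) : ℂ := Complex.exp (t * Complex.I)

lemma expI_ne_zero (t : ℝ) : expI t ≠ 0 := Complex.exp_ne_zero _

lemma norm_expI (t : ℝ) : ‖expI t‖ = 1 := Complex.norm_exp_ofReal_mul_I t

lemma hasDerivAt_expI (t : ℝ) : HasDerivAt expI (Complex.I * expI t) t := by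
  have h : HasDerivAt (fun t : ℝ => (t : ℂ) * Complex.I) (1 * Complex.I) t :=
    (Complex.ofRealCLM.hasDerivAt (x := t)).mul_const _
  refine (h.cexp : HasDerivAt expI _ t).congr_deriv ?_
  simp [expI, mul_comm]

@[fun_prop]
lemma continuous_expI : Continuous expI := by
  unfold expI; fun_prop

lemma expI_periodic : Function.Periodic expI (2 * Real.pi) := by
  intro t
  simp only [expI, Complex.ofReal_add, add_mul, Complex.exp_add]
  simp [Complex.exp_two_pi_mul_I]

lemma expI_neg (t : ℝ) : expI (-t) = (expI t)⁻¹ := by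
  simp [expI, Complex.exp_neg]

lemma expI_add (s t : ℝ) : expI (s + t) = expI s * expI t := by
  simp [expI, add_mul, Complex.exp_add]

lemma expI_eq (t : ℝ) : expI t = Real.cos t + Real.sin t * Complex.I := by
  simp [expI, Complex.exp_mul_I]

lemma expI_im (t : ℝ) : (expI t).im = Real.sin t := Complex.exp_ofReal_mul_I_im t

lemma star_expI (t : ℝ) : star (expI t) = expI (-t) := by
  rw [expI_eq, expI_eq]; simp [Complex.ext_iff]

lemma re_expI_mul_le (t : ℝ) (w : ℂ) : (expI t * w).re ≤ ‖w‖ := by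
  refine (Complex.re_le_norm _).trans ?_
  rw [norm_mul, norm_expI, one_mul]

/-- The set of points lying strictly on the inner side of all the lines given by `p`. -/
def supportRegion (p : ℝ → ℝ) : Set ℂ := {w | ∀ t, (expI (-t) * w).re < p t}

/-- The set of points lying on the inner side of all the lines given by `p`. -/
def closedSupportRegion (p : ℝ → ℝ) : Set ℂ := {w | ∀ t, (expI (-t) * w).re ≤ p t}

/-- The gap to the supporting line is continuous and periodic in the angle, so it attains a positive
minimum. -/
lemma exists_forall_le_of_mem_supportRegion {p : ℝ → ℝ} (hp : Continuous p)
    (hper : Function.Periodic p (2 * Real.pi)) {w : ℂ} (hw : w ∈ supportRegion p) :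
    ∃ η > 0, ∀ t, η ≤ p t - (expI (-t) * w).re := by
  set u := fun t => p t - (expI (-t) * w).re
  have hper : Function.Periodic u (2 * Real.pi) := fun t => by
    have := expI_periodic (-(t + 2 * Real.pi))
    simp only [u, hper t]
    rw [← this]; congr 4; ring
  have hcont : Continuous u := by fun_prop
  obtain ⟨t₀, -, h₀⟩ := (isCompact_Icc (a := (0 : ℝ)) (b := 2 * Real.pi)).exists_isMinOn
    ⟨0, le_rfl, by positivity⟩ hcont.continuousOn
  refine ⟨u t₀, sub_pos.2 (hw t₀), fun t => ?_⟩
  obtain ⟨t', ht', he⟩ := hper.exists_mem_Ico₀ (by positivity) t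
  change _ ≤ u t
  rw [he]
  exact h₀ ⟨ht'.1, ht'.2.le⟩

lemma isOpen_supportRegion {p : ℝ → ℝ} (hp : Continuous p)
    (hper : Function.Periodic p (2 * Real.pi)) : IsOpen (supportRegion p) := by
  rw [Metric.isOpen_iff]
  intro w hw
  obtain ⟨η, hη, h⟩ := exists_forall_le_of_mem_supportRegion hp hper hw
  refine ⟨η, hη, fun z hz t => ?_⟩
  rw [mem_ball_iff_norm] at hz
  have h1 := re_expI_mul_le (-t) (z - w)
  rw [mul_sub, Complex.sub_re] at h1
  linarith [h t]

lemma isClosed_closedSupportRegion (p : ℝ → ℝ) : IsClosed (closedSupportRegion p) := by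
  simp only [closedSupportRegion, Set.ofPred_forall]
  exact isClosed_iInter fun t => isClosed_le (by fun_prop) continuous_const

lemma exists_norm_le_of_mem_closedSupportRegion (p : ℝ → ℝ) :
    ∃ B, ∀ w ∈ closedSupportRegion p, ‖w‖ ≤ B := by
  -- The four axis directions bound the real and imaginary parts from both sides.
  refine ⟨|p 0| + |p Real.pi| + |p (Real.pi / 2)| + |p (-(Real.pi / 2))|, fun w hw => ?_⟩
  have h1 := hw 0
  have h2 := hw Real.pi
  have h3 := hw (Real.pi / 2)
  have h4 := hw (-(Real.pi / 2))
  simp [expI_eq] at h1 h2 h3 h4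
  have := Complex.norm_le_abs_re_add_abs_im w
  have h5 : |w.re| ≤ |p 0| + |p Real.pi| := by
    rw [abs_le]; constructor <;> linarith [le_abs_self (p 0), le_abs_self (p Real.pi),
      abs_nonneg (p 0), abs_nonneg (p Real.pi)]
  have h6 : |w.im| ≤ |p (Real.pi / 2)| + |p (-(Real.pi / 2))| := by
    rw [abs_le]; constructor <;> linarith [le_abs_self (p (Real.pi / 2)),
      le_abs_self (p (-(Real.pi / 2))),
      abs_nonneg (p (Real.pi / 2)), abs_nonneg (p (-(Real.pi / 2)))]
  linarith

lemma isCompact_closedSupportRegion (p : ℝ → ℝ) : IsCompact (closedSupportRegion p) := by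
  obtain ⟨B, hB⟩ := exists_norm_le_of_mem_closedSupportRegion p
  exact (isCompact_closedBall 0 B).of_isClosed_subset (isClosed_closedSupportRegion p)
    fun w hw => mem_closedBall_zero_iff.2 (hB w hw)

lemma convex_closedSupportRegion (p : ℝ → ℝ) : Convex ℝ (closedSupportRegion p) := by
  intro x hx y hy a b ha hb hab t
  have : (expI (-t) * (a • x + b • y)).re = a * (expI (-t) * x).re + b * (expI (-t) * y).re := by
    simp; ring
  calc _ = _ := this
    _ ≤ a * p t + b * p t :=
          add_le_add (mul_le_mul_of_nonneg_left (hx t) ha) (mul_le_mul_of_nonneg_left (hy t) hb)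
    _ = p t := by rw [← add_mul, hab, one_mul]

namespace SupportCurve

variable (c d : SupportCurve)

/-- The parametrization of the curve by the angle of its outer normal. -/
noncomputable def path (t : ℝ) : ℂ := expI t * (c.p t + c.p' t * Complex.I)

/-- The radius of curvature. -/
def speed (t : ℝ) : ℝ := c.p t + c.p'' t

/-- The derivative of the parametrization. -/
noncomputable def vel (t : ℝ) : ℂ := Complex.I * expI t * c.speed t

/-- The open convex region inside the curve. -/
def region : Set ℂ := supportRegion c.p

/-- The normalized contour integral. -/
noncomputable def cint {E : Type*} [NormedAddCommGroup E] [NormedSpace ℂ E] (F : ℂ → E) : E :=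
  (2 * Real.pi * Complex.I)⁻¹ • ∫ t in (0 : ℝ)..(2 * Real.pi), c.vel t • F (c.path t)

lemma continuous_p : Continuous c.p :=
  continuous_iff_continuousAt.2 fun t => (c.hasDerivAt_p t).continuousAt

lemma continuous_p' : Continuous c.p' :=
  continuous_iff_continuousAt.2 fun t => (c.hasDerivAt_p' t).continuousAt

@[fun_prop]
lemma continuous_path : Continuous c.path := by
  have := c.continuous_p
  have := c.continuous_p'
  have := continuous_expI
  unfold path; fun_prop

@[fun_prop]
lemma continuous_speed : Continuous c.speed := c.continuous_p.add c.continuous_p''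

@[fun_prop]
lemma continuous_vel : Continuous c.vel := by
  have := c.continuous_speed
  have := continuous_expI
  unfold vel; fun_prop

lemma path_periodic : Function.Periodic c.path (2 * Real.pi) := by
  intro t
  simp only [path, expI_periodic t, c.periodic_p t, c.periodic_p' t]

lemma hasDerivAt_path (t : ℝ) : HasDerivAt c.path (c.vel t) t := by
  have h := (hasDerivAt_expI t).fun_mul ((c.hasDerivAt_p t).ofReal_comp.fun_add
    ((c.hasDerivAt_p' t).ofReal_comp.mul_const Complex.I))
  refine h.congr_deriv ?_
  simp only [vel, speed]
  push_cast
  linear_combination (expI t * c.p' t) * Complex.I_mul_I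

lemma re_path_self (t : ℝ) : (expI (-t) * c.path t).re = c.p t := by
  rw [path, ← mul_assoc, expI_neg, inv_mul_cancel₀ (expI_ne_zero t)]
  simp

lemma hasDerivAt_re_path (s t : ℝ) :
    HasDerivAt (fun t => (expI (-s) * c.path t).re) (-Real.sin (t - s) * c.speed t) t := by
  have h := (Complex.reCLM.hasFDerivAt.comp_hasDerivAt t
    ((c.hasDerivAt_path t).const_mul (expI (-s))))
  refine h.congr_deriv ?_
  have : expI (-s) * c.vel t = expI (t - s) * Complex.I * c.speed t := by
    rw [vel, sub_eq_add_neg, expI_add]; ring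
  simp [this, expI_im]

/-- In the direction `e^{is}` the height of the path has derivative `-sin(t - s)` times the
nonnegative radius of curvature. It rises on `[s - π, s]` and falls on `[s, s + π]`, so it is
largest at `t = s`, where it equals `p s`. -/
lemma re_path_le (s t : ℝ) : (expI (-s) * c.path t).re ≤ c.p s := by
  set u := fun t => (expI (-s) * c.path t).re with hu
  have hper : Function.Periodic u (2 * Real.pi) := fun t => by simp [hu, c.path_periodic t]
  have hcont : Continuous u := Complex.continuous_re.comp (continuous_const.mul c.continuous_path)
  obtain ⟨t', ht', he⟩ := hper.exists_mem_Ico (by positivity) t (s - Real.pi)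
  have hd : ∀ t, deriv u t = -Real.sin (t - s) * c.speed t := fun t =>
    (c.hasDerivAt_re_path s t).deriv
  have hself : u s = c.p s := c.re_path_self s
  change u t ≤ _
  rw [he, ← hself]
  rcases le_total t' s with h | h
  · refine (monotoneOn_of_deriv_nonneg (convex_Icc (s - Real.pi) s) hcont.continuousOn
      (fun x _ => (c.hasDerivAt_re_path s x).differentiableAt.differentiableWithinAt) ?_)
      ⟨ht'.1, h⟩ ⟨by linarith [Real.pi_pos], le_rfl⟩ h
    intro x hx
    rw [interior_Icc] at hx
    rw [hd, neg_mul, ← mul_neg_one, mul_assoc, mul_neg_one, ← neg_mul_comm]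
    exact mul_nonneg (neg_nonneg.2 (Real.sin_nonpos_of_nonpos_of_neg_pi_le (by linarith [hx.2])
      (by linarith [hx.1]))) (c.nonneg x)
  · refine (antitoneOn_of_deriv_nonpos (convex_Icc s (s + Real.pi)) hcont.continuousOn
      (fun x _ => (c.hasDerivAt_re_path s x).differentiableAt.differentiableWithinAt) ?_)
      ⟨le_rfl, by linarith [Real.pi_pos]⟩ ⟨h, by linarith [ht'.2]⟩ h
    intro x hx
    rw [interior_Icc] at hx
    rw [hd, neg_mul]
    exact neg_nonpos.2 (mul_nonneg (Real.sin_nonneg_of_nonneg_of_le_pi (by linarith [hx.1])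
      (by linarith [hx.2])) (c.nonneg x))

lemma convex_region : Convex ℝ c.region := by
  intro x hx y hy a b ha hb hab t
  have h1 := hx t
  have h2 := hy t
  have : (expI (-t) * (a • x + b • y)).re = a * (expI (-t) * x).re + b * (expI (-t) * y).re := by
    simp; ring
  rw [this]
  rcases ha.lt_or_eq with ha | ha
  · calc a * (expI (-t) * x).re + b * (expI (-t) * y).re < a * c.p t + b * c.p t :=
          add_lt_add_of_lt_of_le (mul_lt_mul_of_pos_left h1 ha) (mul_le_mul_of_nonneg_left h2.le hb)
      _ = c.p t := by rw [← add_mul, hab, one_mul]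
  · obtain rfl : b = 1 := by linarith
    simpa [← ha] using h2

/-- The distances from `w` to the supporting lines are bounded below. -/
lemma exists_forall_le_of_mem_region {w : ℂ} (hw : w ∈ c.region) :
    ∃ η > 0, ∀ t, η ≤ c.p t - (expI (-t) * w).re :=
  exists_forall_le_of_mem_supportRegion c.continuous_p c.periodic_p hw

lemma isOpen_region : IsOpen c.region := isOpen_supportRegion c.continuous_p c.periodic_p

lemma path_mem_closedSupportRegion (t : ℝ) : c.path t ∈ closedSupportRegion c.p :=
  fun s => c.re_path_le s t

variable {c d}

lemma path_mem_region (h : ∀ t, c.p t < d.p t) (t : ℝ) : c.path t ∈ d.region :=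
  fun s => (c.re_path_le s t).trans_lt (h s)

lemma closedSupportRegion_subset_region (h : ∀ t, c.p t < d.p t) :
    closedSupportRegion c.p ⊆ d.region :=
  fun _ hw s => (hw s).trans_lt (h s)

lemma region_subset (h : ∀ t, c.p t ≤ d.p t) : c.region ⊆ d.region :=
  fun _ hw s => (hw s).trans_le (h s)

lemma re_path_sub_pos {w : ℂ} (hw : w ∈ c.region) (t : ℝ) : 0 < (expI (-t) * (c.path t - w)).re := by
  rw [mul_sub, Complex.sub_re, re_path_self]
  exact sub_pos.2 (hw t)

lemma path_sub_ne_zero {w : ℂ} (hw : w ∈ c.region) (t : ℝ) : c.path t - w ≠ 0 := by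
  intro h
  have := re_path_sub_pos hw t
  simp [h] at this

/-- The parallel curve at distance `s`. -/
@[simps]
def shift (c : SupportCurve) (s : ℝ) (hs : 0 ≤ s) : SupportCurve where
  p t := c.p t + s
  p' := c.p'
  p'' := c.p''
  hasDerivAt_p t := (c.hasDerivAt_p t).add_const s
  hasDerivAt_p' := c.hasDerivAt_p'
  continuous_p'' := c.continuous_p''
  periodic_p t := by simp [c.periodic_p t]
  periodic_p' := c.periodic_p'
  nonneg t := by linarith [c.nonneg t]

/-- A continuous branch of `log (c.path t - w)`. -/
noncomputable def logPath (c : SupportCurve) (w : ℂ) (t : ℝ) : ℂ :=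
  t * Complex.I + Complex.log (expI (-t) * (c.path t - w))

/-- Rotating by `e^{-it}` puts `path t - w` into the right half plane, where the principal logarithm
is smooth; the summand `it` undoes the rotation. -/
lemma hasDerivAt_logPath {w : ℂ} (hw : w ∈ c.region) (t : ℝ) :
    HasDerivAt (c.logPath w) (c.vel t • (c.path t - w)⁻¹) t := by
  have h1 : HasDerivAt (fun t : ℝ => (t : ℂ) * Complex.I) (1 * Complex.I) t :=
    (Complex.ofRealCLM.hasDerivAt (x := t)).mul_const _
  have h2 : HasDerivAt (fun t : ℝ => expI (-t)) (-(Complex.I * expI (-t))) t := by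
    have := (hasDerivAt_expI (-t)).scomp t (hasDerivAt_neg t)
    simpa [Function.comp_def] using this
  have h3 := (h2.fun_mul ((c.hasDerivAt_path t).sub_const w)).clog_real
    (Complex.mem_slitPlane_iff.2 (Or.inl (re_path_sub_pos hw t)))
  refine (h1.add h3).congr_deriv ?_
  have h4 := path_sub_ne_zero hw t
  have h5 := expI_ne_zero (-t)
  rw [smul_eq_mul]
  field_simp
  ring_nf

lemma exp_logPath {w : ℂ} (hw : w ∈ c.region) (t : ℝ) :
    Complex.exp (c.logPath w t) = c.path t - w := by
  have h := re_path_sub_pos hw t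
  rw [logPath, Complex.exp_add, Complex.exp_log (by intro h0; rw [h0] at h; simp at h), expI_neg,
    ← mul_assoc, ← expI, mul_inv_cancel₀ (expI_ne_zero t), one_mul]

/-- This is the winding number one of the curve about interior points. -/
lemma logPath_two_pi (c : SupportCurve) (w : ℂ) :
    c.logPath w (2 * Real.pi) = c.logPath w 0 + 2 * Real.pi * Complex.I := by
  have := c.path_periodic 0
  have h2 := expI_periodic (-(2 * Real.pi))
  rw [zero_add] at this
  rw [neg_add_cancel] at h2
  rw [logPath, logPath, this, neg_zero, ← h2]
  push_cast
  ring

section cint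

variable {E E' : Type*} [NormedAddCommGroup E] [NormedSpace ℂ E]
  [NormedAddCommGroup E'] [NormedSpace ℂ E']

lemma intervalIntegrable_cint {F : ℂ → E} (hF : Continuous fun t => F (c.path t)) (a b : ℝ) :
    IntervalIntegrable (fun t => c.vel t • F (c.path t)) MeasureTheory.volume a b :=
  (c.continuous_vel.smul hF).intervalIntegrable _ _

lemma cint_congr {F G : ℂ → E} (h : ∀ t, F (c.path t) = G (c.path t)) : c.cint F = c.cint G := by
  simp only [cint, h]

lemma cint_add {F G : ℂ → E} (hF : Continuous fun t => F (c.path t))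
    (hG : Continuous fun t => G (c.path t)) :
    c.cint (fun z => F z + G z) = c.cint F + c.cint G := by
  simp only [cint, smul_add]
  rw [intervalIntegral.integral_add (intervalIntegrable_cint hF _ _)
    (intervalIntegrable_cint hG _ _), smul_add]

lemma cint_sub {F G : ℂ → E} (hF : Continuous fun t => F (c.path t))
    (hG : Continuous fun t => G (c.path t)) :
    c.cint (fun z => F z - G z) = c.cint F - c.cint G := by
  simp only [cint, smul_sub]
  rw [intervalIntegral.integral_sub (intervalIntegrable_cint hF _ _)
    (intervalIntegrable_cint hG _ _), smul_sub]

lemma cint_smul {F : ℂ → E} (a : ℂ) : c.cint (fun z => a • F z) = a • c.cint F := by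
  simp only [cint, smul_comm _ a]
  rw [intervalIntegral.integral_smul, smul_comm]

lemma clm_cint [CompleteSpace E] [CompleteSpace E'] {F : ℂ → E}
    (hF : Continuous fun t => F (c.path t)) (L : E →L[ℂ] E') :
    L (c.cint F) = c.cint fun z => L (F z) := by
  simp only [cint, map_smul]
  rw [← ContinuousLinearMap.intervalIntegral_comp_comm L (intervalIntegrable_cint hF _ _)]
  simp

lemma norm_cint_le {F : ℂ → E} {B : ℝ} (hB : ∀ t, ‖F (c.path t)‖ ≤ B) {V : ℝ}
    (hV : ∀ t, c.speed t ≤ V) : ‖c.cint F‖ ≤ V * B := by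
  have h0 : 0 ≤ V := (c.nonneg 0).trans (hV 0)
  have h : ‖∫ t in (0 : ℝ)..(2 * Real.pi), c.vel t • F (c.path t)‖ ≤ V * B * |2 * Real.pi - 0| := by
    refine intervalIntegral.norm_integral_le_of_norm_le_const fun t _ => ?_
    rw [norm_smul]
    refine mul_le_mul ?_ (hB t) (norm_nonneg _) h0
    simp only [vel, norm_mul, Complex.norm_I, norm_expI, one_mul, Complex.norm_real,
      Real.norm_eq_abs]
    rw [abs_of_nonneg (show 0 ≤ c.speed t from c.nonneg t)]
    exact hV t
  have hpi := Real.pi_pos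
  rw [cint, norm_smul, norm_inv]
  simp only [norm_mul, Complex.norm_I, Complex.norm_real, Real.norm_eq_abs, mul_one,
    Complex.norm_ofNat, abs_of_pos hpi]
  rw [sub_zero, abs_of_pos (by positivity)] at h
  rw [inv_mul_le_iff₀ (by positivity)]
  linarith

lemma cint_swap {F : ℂ → ℂ → E}
    (hF : Continuous fun x : ℝ × ℝ => F (c.path x.1) (d.path x.2)) :
    c.cint (fun z => d.cint fun w => F z w) = d.cint fun w => c.cint fun z => F z w := by
  simp only [cint]
  simp only [smul_comm _ ((2 * Real.pi * Complex.I)⁻¹), ← intervalIntegral.integral_smul]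
  rw [MeasureTheory.intervalIntegral_intervalIntegral_swap]
  · simp only [smul_comm (c.vel _) (d.vel _)]
  · have : Continuous (Function.uncurry fun s t : ℝ => (2 * Real.pi * Complex.I)⁻¹ •
      (2 * Real.pi * Complex.I)⁻¹ • c.vel s • d.vel t • F (c.path s) (d.path t)) := by
      have h1 := c.continuous_vel.comp (continuous_fst : Continuous (Prod.fst : ℝ × ℝ → ℝ))
      have h2 := d.continuous_vel.comp (continuous_snd : Continuous (Prod.snd : ℝ × ℝ → ℝ))
      exact ((h1.smul (h2.smul hF)).const_smul _).const_smul _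
    refine MeasureTheory.IntegrableOn.mono_set (this.continuousOn.integrableOn_compact
      (isCompact_uIcc.prod isCompact_uIcc)) (Set.prod_mono Set.uIoc_subset_uIcc
        Set.uIoc_subset_uIcc)

variable [CompleteSpace E]

/-- Cauchy's theorem. -/
lemma cint_eq_zero (h : ∀ t, c.p t < d.p t) {F : ℂ → E} (hF : DifferentiableOn ℂ F d.region) :
    c.cint F = 0 := by
  obtain ⟨P, hP⟩ := d.convex_region.exists_forall_hasDerivWithinAt hF
  have hP' : ∀ t, HasDerivAt (fun t => P (c.path t)) (c.vel t • F (c.path t)) t := fun t =>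
    ((hP _ (path_mem_region h t)).hasDerivAt
      (d.isOpen_region.mem_nhds (path_mem_region h t))).scomp t (c.hasDerivAt_path t)
  have hc : Continuous fun t => F (c.path t) :=
    hF.continuousOn.comp_continuous c.continuous_path (path_mem_region h)
  rw [cint, intervalIntegral.integral_eq_sub_of_hasDerivAt (fun t _ => hP' t)
    (intervalIntegrable_cint hc _ _)]
  have := c.path_periodic 0
  rw [zero_add] at this
  simp [this]

lemma cint_inv {w : ℂ} (hw : w ∈ c.region) : c.cint (fun z => (z - w)⁻¹) = 1 := by
  have hd := hasDerivAt_logPath hw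
  have hc : Continuous fun t => (c.path t - w)⁻¹ :=
    (c.continuous_path.sub continuous_const).inv₀ (path_sub_ne_zero hw)
  rw [cint, intervalIntegral.integral_eq_sub_of_hasDerivAt (fun t _ => hd t)
    (intervalIntegrable_cint (F := fun z => (z - w)⁻¹) hc _ _)]
  rw [logPath_two_pi, add_sub_cancel_left, smul_eq_mul]
  exact inv_mul_cancel₀ (by simp [Real.pi_pos.ne'])

omit [CompleteSpace E] in
lemma continuous_inv_smul {F : ℂ → E} (hF : Continuous fun t => F (c.path t)) {w : ℂ}
    (hw : w ∈ c.region) : Continuous fun t => (c.path t - w)⁻¹ • F (c.path t) :=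
  ((c.continuous_path.sub continuous_const).inv₀ (path_sub_ne_zero hw)).smul hF

/-- Cauchy's integral formula. -/
lemma cint_cauchy (h : ∀ t, c.p t < d.p t) {F : ℂ → E} (hF : DifferentiableOn ℂ F d.region)
    {w : ℂ} (hw : w ∈ c.region) : c.cint (fun z => (z - w)⁻¹ • F z) = F w := by
  have hw' : w ∈ d.region := region_subset (fun t => (h t).le) hw
  -- The difference quotient of `F` at `w` has a removable singularity, so its integral vanishes and
  -- only the winding number times `F w` remains.
  have hd := (Complex.differentiableOn_dslope (d.isOpen_region.mem_nhds hw')).2 hF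
  have hc : Continuous fun t => F (c.path t) :=
    hF.continuousOn.comp_continuous c.continuous_path (path_mem_region h)
  have h0 := cint_eq_zero h hd
  have h1 : c.cint (dslope F w) = c.cint fun z => (z - w)⁻¹ • F z - (z - w)⁻¹ • F w := by
    refine cint_congr fun t => ?_
    rw [dslope_of_ne _ (sub_ne_zero.1 (path_sub_ne_zero hw t)), slope_def_module, smul_sub]
  have hc1 := continuous_inv_smul hc hw
  have hc2 := continuous_inv_smul (F := fun _ => F w) continuous_const hw
  rw [h1, cint_sub hc1 hc2, sub_eq_zero] at h0
  rw [h0]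
  have h3 := clm_cint (c := c) (F := fun z => (z - w)⁻¹)
    (by simpa using continuous_inv_smul (F := fun _ => (1 : ℂ)) continuous_const hw)
    ((ContinuousLinearMap.id ℂ ℂ).smulRight (F w))
  simpa [cint_inv hw] using h3.symm

lemma exists_dist_path_le {w : ℂ} (hw : w ∈ c.region) :
    ∃ η > 0, ∀ z, ‖z - w‖ < η → ∀ t, η ≤ ‖c.path t - z‖ := by
  obtain ⟨η, hη, h⟩ := c.exists_forall_le_of_mem_region hw
  refine ⟨η / 2, half_pos hη, fun z hz t => ?_⟩
  have h1 := re_expI_mul_le (-t) (c.path t - w)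
  rw [mul_sub, Complex.sub_re, re_path_self] at h1
  have h2 : ‖c.path t - w‖ ≤ ‖c.path t - z‖ + ‖z - w‖ := norm_sub_le_norm_sub_add_norm_sub ..
  linarith [h t]

omit [CompleteSpace E] in
/-- The Cauchy transform of a continuous function on the curve is analytic inside. -/
lemma differentiableOn_cauchyTransform {F : ℂ → E} (hF : Continuous fun t => F (c.path t)) :
    DifferentiableOn ℂ (fun w => c.cint fun z => (z - w)⁻¹ • F z) c.region := by
  intro w hw
  refine DifferentiableAt.differentiableWithinAt ?_
  obtain ⟨η, hη, hηd⟩ := exists_dist_path_le hw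
  have hmem : ∀ z ∈ Metric.ball w η ∩ c.region, z ∈ c.region := fun z hz => hz.2
  have hs : Metric.ball w η ∩ c.region ∈ 𝓝 w :=
    inter_mem (Metric.ball_mem_nhds w hη) (c.isOpen_region.mem_nhds hw)
  have hcont : ∀ z ∈ c.region, Continuous fun t => c.vel t • (c.path t - z)⁻¹ • F (c.path t) :=
    fun z hz => c.continuous_vel.smul (continuous_inv_smul hF hz)
  have hcont' : Continuous fun t => c.vel t • ((c.path t - w) ^ 2)⁻¹ • F (c.path t) :=
    c.continuous_vel.smul ((((c.continuous_path.sub continuous_const).pow 2).inv₀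
      fun t => pow_ne_zero 2 (path_sub_ne_zero hw t)).smul hF)
  have := (intervalIntegral.hasDerivAt_integral_of_dominated_loc_of_deriv_le
    (μ := MeasureTheory.volume) (a := 0) (b := 2 * Real.pi)
    (F := fun z t => c.vel t • (c.path t - z)⁻¹ • F (c.path t))
    (F' := fun z t => c.vel t • ((c.path t - z) ^ 2)⁻¹ • F (c.path t))
    (bound := fun t => ‖c.vel t‖ * ((η ^ 2)⁻¹ * ‖F (c.path t)‖)) hs ?_
    ((hcont w hw).intervalIntegrable _ _) hcont'.aestronglyMeasurable ?_ ?_ ?_).2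
  · exact this.differentiableAt.const_smul _
  · filter_upwards [hs] with z hz using (hcont z hz.2).aestronglyMeasurable
  · refine Eventually.of_forall fun t _ z hz => ?_
    rw [norm_smul, norm_smul, norm_inv, norm_pow]
    have := hηd z (mem_ball_iff_norm.1 hz.1) t
    gcongr
  · exact (c.continuous_vel.norm.mul (continuous_const.mul hF.norm)).intervalIntegrable _ _
  · refine Eventually.of_forall fun t _ z hz => ?_
    have h1 : HasDerivAt (fun z => (c.path t - z)⁻¹) ((c.path t - z) ^ 2)⁻¹ z := by
      have := ((hasDerivAt_id z).const_sub (c.path t)).inv (path_sub_ne_zero hz.2 t)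
      refine HasDerivAt.congr_deriv (f := fun z => (c.path t - z)⁻¹) this ?_
      simp
    exact (h1.smul_const _).const_smul _

end cint

end SupportCurve

end MatFun

/-! ### The Cauchy transform of adjoint boundary values. -/

namespace MatFun

/-- The piecewise linear function that is `1` on `(-∞, 0]` and `0` on `[1 / a, ∞)`. -/
noncomputable def cutoff (a x : ℝ) : ℝ := max 0 (min 1 (1 - a * x))

lemma continuous_cutoff (a : ℝ) : Continuous (cutoff a) := by
  unfold cutoff; fun_prop

lemma cutoff_nonneg (a x : ℝ) : 0 ≤ cutoff a x := le_max_left _ _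

lemma cutoff_le_one (a x : ℝ) : cutoff a x ≤ 1 := max_le zero_le_one (min_le_left _ _)

lemma cutoff_of_nonpos {a x : ℝ} (ha : 0 ≤ a) (hx : x ≤ 0) : cutoff a x = 1 := by
  have : 0 ≤ -(a * x) := by nlinarith
  rw [cutoff, min_eq_left (by linarith), max_eq_right zero_le_one]

lemma one_sub_cutoff_le {a x : ℝ} (ha : 0 ≤ a) (hx : 0 ≤ x) : 1 - cutoff a x ≤ a * x := by
  have : 0 ≤ a * x := by positivity
  rw [cutoff, min_eq_right (by linarith)]
  linarith [le_max_right 0 (1 - a * x)]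

lemma tendsto_cutoff_add {x : ℝ} (hx : x ≠ 0) :
    Tendsto (fun n : ℕ => cutoff n x + cutoff n (-x)) atTop (𝓝 1) := by
  have key : ∀ y : ℝ, 0 < y → ∀ᶠ n : ℕ in atTop, cutoff n y = 0 ∧ cutoff n (-y) = 1 := by
    intro y hy
    filter_upwards [eventually_ge_atTop ⌈1 / y⌉₊] with n hn
    have h1 : 1 / y ≤ n := (Nat.le_ceil _).trans (by exact_mod_cast hn)
    rw [div_le_iff₀ hy] at h1
    refine ⟨?_, cutoff_of_nonpos n.cast_nonneg (by linarith)⟩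
    rw [cutoff, max_eq_left]
    exact (min_le_right _ _).trans (by linarith)
  refine tendsto_const_nhds.congr' ?_
  rcases lt_or_gt_of_ne hx with h | h
  · filter_upwards [key (-x) (by linarith)] with n hn
    rw [neg_neg] at hn
    rw [hn.1, hn.2, add_zero]
  · filter_upwards [key x h] with n hn
    rw [hn.1, hn.2, zero_add]

/-- The cutoffs approximate the indicator of the half circle `cos t ≤ 0`. In the estimate below that
half stands for the directions pointing away from a nearby supporting line. -/
lemma tendsto_integral_cutoff_cos :
    Tendsto (fun n : ℕ => ∫ t in (0 : ℝ)..(2 * Real.pi), cutoff n (Real.cos t)) atTop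
      (𝓝 Real.pi) := by
  have hc : ∀ n : ℕ, Continuous fun t => cutoff n (Real.cos t) := fun n =>
    (continuous_cutoff n).comp Real.continuous_cos
  have hc' : ∀ n : ℕ, Continuous fun t => cutoff n (-Real.cos t) := fun n =>
    (continuous_cutoff n).comp Real.continuous_cos.neg
  -- Translation by `π` changes the sign of the cosine, so the two complementary halves have equal
  -- integrals and each tends to half of `2π`.
  have hshift : ∀ n : ℕ, ∫ t in (0 : ℝ)..(2 * Real.pi), cutoff n (-Real.cos t) =
      ∫ t in (0 : ℝ)..(2 * Real.pi), cutoff n (Real.cos t) := by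
    intro n
    have hper : Function.Periodic (fun t => cutoff n (Real.cos t)) (2 * Real.pi) := fun t => by
      simp
    have h1 := intervalIntegral.integral_comp_add_right (a := 0) (b := 2 * Real.pi)
      (fun t => cutoff n (Real.cos t)) Real.pi
    simp only [Real.cos_add_pi] at h1
    rw [h1, zero_add, add_comm (2 * Real.pi), hper.intervalIntegral_add_eq Real.pi 0, zero_add]
  have hlim : Tendsto (fun n : ℕ => ∫ t in (0 : ℝ)..(2 * Real.pi),
      (cutoff n (Real.cos t) + cutoff n (-Real.cos t))) atTop
      (𝓝 (∫ _ in (0 : ℝ)..(2 * Real.pi), (1 : ℝ))) := by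
    refine intervalIntegral.tendsto_integral_filter_of_dominated_convergence (fun _ => 2)
      (Eventually.of_forall fun n => ((hc n).add (hc' n)).aestronglyMeasurable)
      (Eventually.of_forall fun n => Eventually.of_forall fun t _ => ?_)
      intervalIntegrable_const ?_
    · rw [Real.norm_eq_abs, abs_of_nonneg (add_nonneg (cutoff_nonneg _ _) (cutoff_nonneg _ _))]
      linarith [cutoff_le_one n (Real.cos t), cutoff_le_one n (-Real.cos t)]
    · have hcount : {t : ℝ | Real.cos t = 0}.Countable := by
        refine (Set.countable_range fun k : ℤ => (2 * k + 1) * Real.pi / 2).mono ?_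
        intro t ht
        obtain ⟨k, hk⟩ := Real.cos_eq_zero_iff.1 ht
        exact ⟨k, hk.symm⟩
      filter_upwards [hcount.ae_notMem MeasureTheory.volume] with t ht _
      exact tendsto_cutoff_add ht
  have heq : ∀ n : ℕ, ∫ t in (0 : ℝ)..(2 * Real.pi),
      (cutoff n (Real.cos t) + cutoff n (-Real.cos t)) =
      2 * ∫ t in (0 : ℝ)..(2 * Real.pi), cutoff n (Real.cos t) := by
    intro n
    rw [intervalIntegral.integral_add ((hc n).intervalIntegrable _ _)
      ((hc' n).intervalIntegrable _ _), hshift]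
    ring
  simp only [heq, intervalIntegral.integral_const, sub_zero, smul_eq_mul, mul_one] at hlim
  simpa using hlim.const_mul (1 / 2 : ℝ)

namespace SupportCurve

variable {c d : SupportCurve}

/-- The density of `π⁻¹ d arg (z - w)` along the curve. -/
noncomputable def kernel (c : SupportCurve) (w : ℂ) (t : ℝ) : ℝ :=
  (c.vel t * (c.path t - w)⁻¹).im / Real.pi

lemma continuous_kernel {w : ℂ} (hw : w ∈ c.region) : Continuous (c.kernel w) :=
  (Complex.continuous_im.comp (c.continuous_vel.mul
    ((c.continuous_path.sub continuous_const).inv₀ (path_sub_ne_zero hw)))).div_const _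

/-- Seen from an interior point, the argument increases along a convex curve: `vel / (path - w)` is
a nonnegative multiple of `i` times the inverse of a number with positive real part. -/
lemma kernel_nonneg {w : ℂ} (hw : w ∈ c.region) (t : ℝ) : 0 ≤ c.kernel w t := by
  refine div_nonneg ?_ Real.pi_pos.le
  have h : c.vel t * (c.path t - w)⁻¹ =
      (c.speed t : ℂ) * (Complex.I * (expI (-t) * (c.path t - w))⁻¹) := by
    rw [vel, expI_neg, mul_inv, inv_inv]; ring
  rw [h, Complex.im_ofReal_mul, Complex.I_mul_im,
    Complex.inv_re]
  exact mul_nonneg (c.nonneg t) (div_nonneg (re_path_sub_pos hw t).le (Complex.normSq_nonneg _))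

lemma hasDerivAt_im_logPath {w : ℂ} (hw : w ∈ c.region) (t : ℝ) :
    HasDerivAt (fun t => (c.logPath w t).im) (Real.pi * c.kernel w t) t := by
  have := Complex.imCLM.hasFDerivAt.comp_hasDerivAt t (hasDerivAt_logPath hw t)
  refine this.congr_deriv ?_
  rw [kernel, mul_div_cancel₀ _ Real.pi_pos.ne']
  simp

/-- The kernel is the derivative of the viewing angle divided by `π`, so substitution turns it into
the uniform measure on angles, of total mass 2, whatever the curve and the point. -/
lemma integral_comp_im_logPath_mul_kernel {w : ℂ} (hw : w ∈ c.region) {φ : ℝ → ℝ}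
    (hφ : Continuous φ) (hper : Function.Periodic φ (2 * Real.pi)) :
    ∫ t in (0 : ℝ)..(2 * Real.pi), c.kernel w t * φ (c.logPath w t).im =
      Real.pi⁻¹ * ∫ s in (0 : ℝ)..(2 * Real.pi), φ s := by
  have h := intervalIntegral.integral_comp_mul_deriv (a := 0) (b := 2 * Real.pi)
    (fun t _ => hasDerivAt_im_logPath hw t)
    (continuous_const.mul (continuous_kernel hw)).continuousOn hφ
  rw [logPath_two_pi, Complex.add_im] at h
  have h2 : (2 * (Real.pi : ℂ) * Complex.I).im = 2 * Real.pi := by simp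
  rw [h2, hper.intervalIntegral_add_eq _ 0, zero_add] at h
  rw [← h, ← intervalIntegral.integral_const_mul]
  congr 1; ext t
  have := Real.pi_pos.ne'
  simp only [Function.comp]
  field_simp

lemma re_path_sub_eq {w : ℂ} (hw : w ∈ c.region) (s t : ℝ) :
    (expI (-s) * (c.path t - w)).re =
      ‖c.path t - w‖ * Real.cos ((c.logPath w t).im - s) := by
  have h := exp_logPath hw t
  rw [← h, Complex.norm_exp, expI, ← Complex.exp_add, Complex.exp_re]
  simp
  ring_nf

section star

variable {E : Type*} [NormedAddCommGroup E] [NormedSpace ℂ E] [StarAddMonoid E]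
  [NormedStarGroup E] [StarModule ℂ E] [CompleteSpace E]

omit [CompleteSpace E] in
lemma star_intervalIntegral {f : ℝ → E} {a b : ℝ} :
    star (∫ t in a..b, f t) = ∫ t in a..b, star (f t) := by
  simp only [intervalIntegral, star_sub]
  congr 1 <;> exact ((starL' ℝ : E ≃L[ℝ] E).integral_comp_comm f).symm

omit [CompleteSpace E] in
lemma star_cint (F : ℂ → E) : star (c.cint F) = -((2 * Real.pi * Complex.I)⁻¹ •
    ∫ t in (0 : ℝ)..(2 * Real.pi), star (c.vel t) • star (F (c.path t))) := by
  rw [cint, star_smul, star_intervalIntegral]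
  simp only [star_smul]
  rw [← neg_smul]
  congr 1
  simp

/-- The Cauchy transform of the adjoint of an analytic function, by a positive kernel. -/
lemma cauchyTransform_star_add (h : ∀ t, c.p t < d.p t) {G : ℂ → E}
    (hG : DifferentiableOn ℂ G d.region) {w : ℂ} (hw : w ∈ c.region) :
    c.cint (fun z => (z - w)⁻¹ • star (G z)) + star (G w) =
      ∫ t in (0 : ℝ)..(2 * Real.pi), c.kernel w t • star (G (c.path t)) := by
  have hc : Continuous fun t => G (c.path t) :=
    hG.continuousOn.comp_continuous c.continuous_path (path_mem_region h)
  have h1 := continuous_inv_smul (F := fun z => star (G z)) hc.star hw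
  have h2 := (continuous_inv_smul hc hw).star
  have h3 : Continuous fun t => c.vel t • (c.path t - w)⁻¹ • star (G (c.path t)) :=
    c.continuous_vel.smul h1
  have h4 : Continuous fun t => star (c.vel t) • star ((c.path t - w)⁻¹ • G (c.path t)) :=
    c.continuous_vel.star.smul h2
  rw [← cint_cauchy h hG hw, star_cint, cint, ← sub_eq_add_neg, ← smul_sub,
    ← intervalIntegral.integral_sub (h3.intervalIntegrable _ _)
      (h4.intervalIntegrable _ _), ← intervalIntegral.integral_smul]
  congr 1; ext t
  rw [star_smul, smul_smul, smul_smul, ← sub_smul, smul_smul, ← Complex.coe_smul]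
  congr 1
  have : star (c.vel t) * star ((c.path t - w)⁻¹) = star (c.vel t * (c.path t - w)⁻¹) := by
    simp
  rw [this, Complex.star_def, Complex.sub_conj, kernel]
  have := Real.pi_pos.ne'
  push_cast
  field_simp

lemma integral_kernel {w : ℂ} (hw : w ∈ c.region) :
    ∫ t in (0 : ℝ)..(2 * Real.pi), c.kernel w t = 2 := by
  have := integral_comp_im_logPath_mul_kernel hw (φ := fun _ => 1) continuous_const
    (fun _ => rfl)
  simp only [mul_one, intervalIntegral.integral_const, smul_eq_mul, sub_zero] at this
  rw [this]
  have := Real.pi_pos.ne'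
  field_simp

/-- Near a supporting line, the Cauchy transform of the adjoint of an analytic function is bounded
almost as well as the function. -/
lemma norm_cauchyTransform_star_le (h : ∀ t, c.p t < d.p t) {G : ℂ → E}
    (hG : DifferentiableOn ℂ G d.region) (hb : ∀ z ∈ d.region, ‖G z‖ ≤ 1) {L : ℝ}
    (hL : ∀ x ∈ closedSupportRegion c.p, ∀ y ∈ closedSupportRegion c.p,
      ‖G x - G y‖ ≤ L * ‖x - y‖) (h_nonneg : 0 ≤ L) {w : ℂ} (hw : w ∈ c.region) {η s : ℝ}
    (hη : c.p s - (expI (-s) * w).re ≤ η) (n : ℕ) :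
    ‖c.cint (fun z => (z - w)⁻¹ • star (G z))‖ ≤ 2 * L * n * η +
      (Real.pi⁻¹ * ∫ t in (0 : ℝ)..(2 * Real.pi), cutoff n (Real.cos t)) +
      |1 - Real.pi⁻¹ * ∫ t in (0 : ℝ)..(2 * Real.pi), cutoff n (Real.cos t)| := by
  set μ := Real.pi⁻¹ * ∫ t in (0 : ℝ)..(2 * Real.pi), cutoff n (Real.cos t) with hμ
  -- `C` selects the part of the curve seen from `w` in directions away from the supporting line
  -- with normal `e^{is}`; its kernel mass `μ` is close to 1.
  set C : ℝ → ℝ := fun t => cutoff n (Real.cos ((c.logPath w t).im - s)) with hC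
  have hk := continuous_kernel hw
  have hk0 := kernel_nonneg hw
  have hlog : Continuous fun t => (c.logPath w t).im :=
    continuous_iff_continuousAt.2 fun t => (hasDerivAt_im_logPath hw t).continuousAt
  have hCc : Continuous C :=
    (continuous_cutoff n).comp (Real.continuous_cos.comp (hlog.sub continuous_const))
  have hc : Continuous fun t => star (G (c.path t)) :=
    (hG.continuousOn.comp_continuous c.continuous_path (path_mem_region h)).star
  have hmass : ∫ t in (0 : ℝ)..(2 * Real.pi), c.kernel w t * C t = μ := by
    have := integral_comp_im_logPath_mul_kernel hw (φ := fun x => cutoff n (Real.cos (x - s)))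
      ((continuous_cutoff n).comp (Real.continuous_cos.comp (continuous_id.sub continuous_const)))
      (fun x => by simp [add_sub_right_comm])
    rw [this, hμ]
    congr 1
    have hper : Function.Periodic (fun t => cutoff n (Real.cos t)) (2 * Real.pi) := fun t => by
      simp
    have h1 := intervalIntegral.integral_comp_sub_right (a := 0) (b := 2 * Real.pi)
      (fun t => cutoff n (Real.cos t)) s
    rw [h1, zero_sub, sub_eq_neg_add, hper.intervalIntegral_add_eq (-s) 0, zero_add]
  have hkC : Continuous fun t => c.kernel w t * C t := hk.mul hCc
  have hη0 : 0 ≤ η := (sub_nonneg.2 (hw s).le).trans hη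
  have hi1 : Continuous fun t => (c.kernel w t * (1 - C t)) • (star (G (c.path t)) - star (G w)) :=
    (hk.mul (continuous_const.sub hCc)).smul (hc.sub continuous_const)
  have hi2 : Continuous fun t => (c.kernel w t * C t) • star (G (c.path t)) := (hk.mul hCc).smul hc
  have hi3 : Continuous fun t => (c.kernel w t - c.kernel w t * C t) • star (G w) :=
    (hk.sub (hk.mul hCc)).smul continuous_const
  -- The Cauchy transform is the kernel average of `G*` minus `G(w)*`. On the part `1 - C` the
  -- average is compared with `G(w)*`, and that part has mass `2 - μ`, so up to `1 - μ` it cancels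
  -- the subtracted term.
  have hdec : c.cint (fun z => (z - w)⁻¹ • star (G z)) =
      (∫ t in (0 : ℝ)..(2 * Real.pi),
        (c.kernel w t * (1 - C t)) • (star (G (c.path t)) - star (G w))) +
      (∫ t in (0 : ℝ)..(2 * Real.pi), (c.kernel w t * C t) • star (G (c.path t))) +
      (1 - μ) • star (G w) := by
    have h4 : ∫ t in (0 : ℝ)..(2 * Real.pi), (c.kernel w t - c.kernel w t * C t) • star (G w) =
        (2 - μ) • star (G w) := by
      rw [intervalIntegral.integral_smul_const, intervalIntegral.integral_sub
        (hk.intervalIntegrable _ _) (hkC.intervalIntegrable _ _), hmass,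
        integral_kernel hw]
    have hi12 : Continuous fun t => (c.kernel w t * (1 - C t)) • (star (G (c.path t)) - star (G w))
        + (c.kernel w t * C t) • star (G (c.path t)) := hi1.add hi2
    rw [eq_sub_of_add_eq (cauchyTransform_star_add h hG hw),
      show (1 - μ) • star (G w) = (2 - μ) • star (G w) - star (G w) by module, ← h4, ← add_sub_assoc,
      ← intervalIntegral.integral_add (hi1.intervalIntegrable _ _) (hi2.intervalIntegrable _ _),
      ← intervalIntegral.integral_add (hi12.intervalIntegrable _ _)
        (hi3.intervalIntegrable _ _)]
    congr 2; ext t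
    module
  have hw' : w ∈ d.region := region_subset (fun t => (h t).le) hw
  have e1 : ‖∫ t in (0 : ℝ)..(2 * Real.pi),
      (c.kernel w t * (1 - C t)) • (star (G (c.path t)) - star (G w))‖ ≤ 2 * L * n * η := by
    have : ∫ t in (0 : ℝ)..(2 * Real.pi), c.kernel w t * (L * n * η) = 2 * L * n * η := by
      rw [intervalIntegral.integral_mul_const, integral_kernel hw]; ring
    rw [← this]
    refine intervalIntegral.norm_integral_le_of_norm_le (by positivity)
      (Eventually.of_forall fun t _ => ?_) ((hk.mul continuous_const).intervalIntegrable _ _)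
    have hC1 : 0 ≤ 1 - C t := sub_nonneg.2 (cutoff_le_one _ _)
    rw [norm_smul, Real.norm_eq_abs, abs_of_nonneg (mul_nonneg (hk0 t) hC1), mul_assoc]
    refine mul_le_mul_of_nonneg_left ?_ (hk0 t)
    rw [← star_sub, norm_star]
    -- The curve cannot cross the supporting line, which is at distance at most `η` from `w`. So
    -- curve points seen in directions well towards the line are near `w`, and the Lipschitz bound
    -- applies to them.
    have hre : ‖c.path t - w‖ * Real.cos ((c.logPath w t).im - s) ≤ η := by
      rw [← re_path_sub_eq hw, mul_sub, Complex.sub_re]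
      linarith [c.re_path_le s t]
    rcases le_total (Real.cos ((c.logPath w t).im - s)) 0 with hn | hn
    · rw [hC]
      simp only
      rw [cutoff_of_nonpos n.cast_nonneg hn]
      simp; positivity
    · calc (1 - C t) * ‖G (c.path t) - G w‖
          ≤ (n * Real.cos ((c.logPath w t).im - s)) * (L * ‖c.path t - w‖) :=
            mul_le_mul (one_sub_cutoff_le n.cast_nonneg hn)
              (hL _ (c.path_mem_closedSupportRegion t) _ fun s => (hw s).le)
              (norm_nonneg _) (by positivity)
        _ = L * n * (‖c.path t - w‖ * Real.cos ((c.logPath w t).im - s)) := by ring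
        _ ≤ _ := by gcongr
  have e2 : ‖∫ t in (0 : ℝ)..(2 * Real.pi), (c.kernel w t * C t) • star (G (c.path t))‖ ≤ μ := by
    rw [← hmass]
    refine intervalIntegral.norm_integral_le_of_norm_le (by positivity)
      (Eventually.of_forall fun t _ => ?_) (hkC.intervalIntegrable _ _)
    have := mul_nonneg (hk0 t) (cutoff_nonneg n (Real.cos ((c.logPath w t).im - s)))
    rw [norm_smul, Real.norm_eq_abs, abs_of_nonneg this, norm_star]
    exact mul_le_of_le_one_right this (hb _ (path_mem_region h t))
  have e3 : ‖(1 - μ) • star (G w)‖ ≤ |1 - μ| := by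
    rw [norm_smul, norm_star]
    exact mul_le_of_le_one_right (abs_nonneg _) (hb _ hw')
  rw [hdec]
  exact (norm_add₃_le).trans (by linarith)

omit [StarAddMonoid E] [NormedStarGroup E] [StarModule ℂ E] in
lemma exists_lipschitz (h : ∀ t, c.p t < d.p t) {G : ℂ → E}
    (hG : DifferentiableOn ℂ G d.region) : ∃ L, 0 ≤ L ∧ ∀ x ∈ closedSupportRegion c.p,
      ∀ y ∈ closedSupportRegion c.p, ‖G x - G y‖ ≤ L * ‖x - y‖ := by
  have hsub := closedSupportRegion_subset_region h
  have hcont : ContinuousOn (deriv G) (closedSupportRegion c.p) :=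
    (hG.deriv d.isOpen_region).continuousOn.mono hsub
  obtain ⟨L, hL⟩ := (isCompact_closedSupportRegion c.p).exists_bound_of_continuousOn hcont
  refine ⟨|L|, abs_nonneg L, fun x hx y hy => ?_⟩
  exact (convex_closedSupportRegion c.p).norm_image_sub_le_of_norm_deriv_le
    (fun z hz => hG.differentiableAt (d.isOpen_region.mem_nhds (hsub hz)))
    (fun z hz => (hL z hz).trans (le_abs_self L)) hy hx

/-- The Cauchy transform of the adjoint of an analytic function is bounded by the same bound. -/
theorem norm_cauchyTransform_star_le_one (h : ∀ t, c.p t < d.p t) {G : ℂ → E}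
    (hG : DifferentiableOn ℂ G d.region) (hb : ∀ z ∈ d.region, ‖G z‖ ≤ 1) {w : ℂ}
    (hw : w ∈ c.region) : ‖c.cint (fun z => (z - w)⁻¹ • star (G z))‖ ≤ 1 := by
  obtain ⟨L, hL0, hL⟩ := exists_lipschitz h hG
  have hc : Continuous fun t => star (G (c.path t)) :=
    (hG.continuousOn.comp_continuous c.continuous_path (path_mem_region h)).star
  refine le_of_forall_pos_le_add fun ε hε => ?_
  have hlim : Tendsto (fun n : ℕ =>
      (Real.pi⁻¹ * ∫ t in (0 : ℝ)..(2 * Real.pi), cutoff n (Real.cos t)) +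
      |1 - Real.pi⁻¹ * ∫ t in (0 : ℝ)..(2 * Real.pi), cutoff n (Real.cos t)|) atTop (𝓝 1) := by
    have h1 := tendsto_integral_cutoff_cos.const_mul Real.pi⁻¹
    rw [inv_mul_cancel₀ Real.pi_pos.ne'] at h1
    simpa using h1.add (h1.const_sub 1).abs
  -- The sharpness `n` is fixed before the distance `η`, because the error `2 L n η` grows with `n`.
  obtain ⟨n, hn⟩ := (hlim.eventually (gt_mem_nhds (show (1 : ℝ) < 1 + ε / 2 by linarith))).exists
  obtain ⟨η₀, hη₀, hη₀w⟩ := c.exists_forall_le_of_mem_region hw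
  obtain ⟨η, hη, hηη₀, hηε⟩ : ∃ η > 0, η < η₀ ∧ 2 * L * n * η ≤ ε / 2 := by
    have hpos : 0 < 2 * L * n + 1 := by positivity
    refine ⟨min (η₀ / 2) (ε / 2 / (2 * L * n + 1)), by positivity,
      (min_le_left _ _).trans_lt (by linarith), ?_⟩
    calc 2 * L * n * min (η₀ / 2) (ε / 2 / (2 * L * n + 1))
        ≤ (2 * L * n + 1) * (ε / 2 / (2 * L * n + 1)) := by
          refine mul_le_mul (by linarith) (min_le_right _ _) (by positivity) hpos.le
      _ = ε / 2 := by field_simp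
  have hp : Continuous fun t => c.p t - η := c.continuous_p.sub continuous_const
  have hper : Function.Periodic (fun t => c.p t - η) (2 * Real.pi) := fun t => by
    simp [c.periodic_p t]
  have hcl : closure (supportRegion fun t => c.p t - η) ⊆ closedSupportRegion fun t => c.p t - η :=
    closure_minimal (fun z hz t => (hz t).le) (isClosed_closedSupportRegion _)
  have hcl' : closure (supportRegion fun t => c.p t - η) ⊆ c.region :=
    fun z hz t => (hcl hz t).trans_lt (by linarith)
  -- By the maximum principle it suffices to look at the frontier of the inner parallel region,
  -- whose points lie within `η` of some supporting line.
  refine Complex.norm_le_of_forall_mem_frontier_norm_le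
    (U := supportRegion fun t => c.p t - η)
    ((isCompact_closedSupportRegion (fun t => c.p t - η)).isBounded.subset
      fun z hz t => (hz t).le)
    ((differentiableOn_cauchyTransform hc).mono hcl').diffContOnCl ?_
    (subset_closure fun t => by linarith [hη₀w t])
  intro z hz
  rw [(isOpen_supportRegion hp hper).frontier_eq] at hz
  obtain ⟨s, hs⟩ : ∃ s, c.p s - η ≤ (expI (-s) * z).re := by
    by_contra! hcon
    exact hz.2 hcon
  have := norm_cauchyTransform_star_le h hG hb hL hL0 (hcl' hz.1) (η := η) (s := s)
    (by linarith) n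
  linarith

end star

end SupportCurve

end MatFun

/-! ### Cauchy integrals of resolvents in a Banach algebra. -/

namespace MatFun

namespace SupportCurve

variable {c d : SupportCurve} {B : Type*} [NormedRing B] [NormedAlgebra ℂ B] [CompleteSpace B]

lemma mul_cint {F : ℂ → B} (hF : Continuous fun t => F (c.path t)) (x : B) :
    x * c.cint F = c.cint fun z => x * F z :=
  clm_cint hF (ContinuousLinearMap.mul ℂ B x)

lemma cint_mul {F : ℂ → B} (hF : Continuous fun t => F (c.path t)) (x : B) :
    c.cint F * x = c.cint fun z => F z * x :=
  clm_cint hF ((ContinuousLinearMap.mul ℂ B).flip x)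

lemma continuous_resolvent {a : B} (ha : ∀ t, c.path t ∈ resolventSet ℂ a) :
    Continuous fun t => resolvent a (c.path t) := by
  refine continuous_iff_continuousAt.2 fun t => ?_
  have h := (spectrum.hasDerivAt_resolvent_const_left (ha t)).continuousAt
  exact ContinuousAt.comp (g := resolvent a) h c.continuous_path.continuousAt

omit [CompleteSpace B] in
lemma sub_mul_resolvent {a : B} {z : ℂ} (hz : z ∈ resolventSet ℂ a) :
    (algebraMap ℂ B z - a) * resolvent a z = 1 :=
  Ring.mul_inverse_cancel _ hz

omit [CompleteSpace B] in
lemma resolvent_mul_sub {a : B} {z : ℂ} (hz : z ∈ resolventSet ℂ a) :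
    resolvent a z * (algebraMap ℂ B z - a) = 1 :=
  Ring.inverse_mul_cancel _ hz

omit [CompleteSpace B] in
lemma commute_resolvent {a x : B} (h : Commute x a) {z : ℂ} (hz : z ∈ resolventSet ℂ a) :
    Commute x (resolvent a z) := by
  have h1 : Commute x (algebraMap ℂ B z - a) := (Algebra.commute_algebraMap_right z x).sub_right h
  calc x * resolvent a z
      = resolvent a z * (algebraMap ℂ B z - a) * x * resolvent a z := by
        rw [resolvent_mul_sub hz, one_mul]
    _ = resolvent a z * (x * (algebraMap ℂ B z - a)) * resolvent a z := by
        rw [h1.eq]; simp only [mul_assoc]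
    _ = resolvent a z * x := by rw [mul_assoc, mul_assoc, sub_mul_resolvent hz, mul_one]

/-- Since `z - a = (z - w) + (w - a)`, multiplying the right side by `z - a` gives the integral of
`F(w) (w - a)⁻¹` plus that of `F(w) / (z - w)`. The latter is analytic inside because `z` is
outside, so it contributes nothing. -/
lemma resolvent_mul_cint (h : ∀ t, c.p t < d.p t) {a : B}
    (hc : ∀ t, c.path t ∈ resolventSet ℂ a) {F : ℂ → B} (hF : DifferentiableOn ℂ F d.region)
    (hFa : ∀ z ∈ d.region, Commute (F z) a) {z : ℂ} (hz : z ∉ d.region)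
    (hza : z ∈ resolventSet ℂ a) :
    resolvent a z * c.cint (fun w => F w * resolvent a w) =
      c.cint (fun w => (z - w)⁻¹ • (F w * resolvent a w)) := by
  have hne : ∀ w ∈ d.region, z - w ≠ 0 := fun w hw h0 => hz (sub_eq_zero.1 h0 ▸ hw)
  have hR := continuous_resolvent hc
  have hFc : Continuous fun t => F (c.path t) :=
    hF.continuousOn.comp_continuous c.continuous_path (path_mem_region h)
  have hinv : Continuous fun t => (z - c.path t)⁻¹ :=
    (continuous_const.sub c.continuous_path).inv₀ fun t => hne _ (path_mem_region h t)
  have h1 : c.cint (fun w => F w * resolvent a w) =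
      (algebraMap ℂ B z - a) * c.cint (fun w => (z - w)⁻¹ • (F w * resolvent a w)) := by
    rw [mul_cint (hinv.smul (hFc.mul hR))]
    have h0 : c.cint (fun w => (z - w)⁻¹ • F w) = 0 := by
      refine cint_eq_zero h (DifferentiableOn.smul (DifferentiableOn.inv ?_ hne) hF)
      fun_prop
    rw [← add_zero (c.cint fun w => F w * resolvent a w), ← h0,
      ← cint_add (hFc.mul hR) (hinv.smul hFc)]
    refine cint_congr fun t => ?_
    set w := c.path t with hw
    have hw' := path_mem_region h t
    have e1 : (algebraMap ℂ B z - a) * (F w * resolvent a w) =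
        (z - w) • (F w * resolvent a w) + F w := by
      have e2 : algebraMap ℂ B z - a = (z - w) • (1 : B) + (algebraMap ℂ B w - a) := by
        rw [sub_smul, Algebra.algebraMap_eq_smul_one, Algebra.algebraMap_eq_smul_one]; abel
      have e3 : Commute (F w) (algebraMap ℂ B w - a) :=
        (Algebra.commute_algebraMap_right w (F w)).sub_right (hFa w hw')
      rw [e2, add_mul, smul_mul_assoc, one_mul, ← mul_assoc _ (F w), ← e3.eq, mul_assoc (F w),
        sub_mul_resolvent (hc t), mul_one]
    rw [mul_smul_comm, e1, smul_add, inv_smul_smul₀ (hne w hw')]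
  rw [h1, ← mul_assoc, resolvent_mul_sub hza, one_mul]

/-- Multiplicativity of the Cauchy integrals over two nested curves. -/
lemma cint_mul_cint (h : ∀ t, c.p t < d.p t) {a : B}
    (hc : ∀ t, c.path t ∈ resolventSet ℂ a) (hd : ∀ t, d.path t ∈ resolventSet ℂ a)
    {φ : ℂ → B} (hφ : Continuous fun t => φ (d.path t))
    {F : ℂ → B} (hF : DifferentiableOn ℂ F d.region)
    (hFa : ∀ z ∈ d.region, Commute (F z) a) :
    d.cint (fun z => φ z * resolvent a z) * c.cint (fun w => F w * resolvent a w) =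
      c.cint (fun w => d.cint (fun z => (z - w)⁻¹ • φ z) * F w * resolvent a w) := by
  have hout : ∀ t, d.path t ∉ d.region := fun t ht => (ht t).ne (d.re_path_self t)
  have hRc := continuous_resolvent hc
  have hRd := continuous_resolvent hd
  have hFc : Continuous fun t => F (c.path t) :=
    hF.continuousOn.comp_continuous c.continuous_path (path_mem_region h)
  have hinv : Continuous fun x : ℝ × ℝ => (d.path x.1 - c.path x.2)⁻¹ :=
    ((Continuous.comp (g := d.path) d.continuous_path continuous_fst).sub
      (Continuous.comp (g := c.path) c.continuous_path continuous_snd)).inv₀ fun x => path_sub_ne_zero (path_mem_region h x.2) x.1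
  have hinv' : ∀ s, Continuous fun t => (d.path s - c.path t)⁻¹ := fun s =>
    (continuous_const.sub c.continuous_path).inv₀ fun t => path_sub_ne_zero (path_mem_region h t) s
  have h1 : ∀ t, φ (d.path t) * resolvent a (d.path t) * c.cint (fun w => F w * resolvent a w) =
      c.cint fun w => (d.path t - w)⁻¹ • (φ (d.path t) * (F w * resolvent a w)) := by
    intro t
    rw [mul_assoc, resolvent_mul_cint h hc hF hFa (hout t) (hd t),
      mul_cint ((hinv' t).smul (hFc.mul hRc))]
    simp only [mul_smul_comm]
  have h2 : Continuous fun x : ℝ × ℝ => (d.path x.1 - c.path x.2)⁻¹ •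
      (φ (d.path x.1) * (F (c.path x.2) * resolvent a (c.path x.2))) :=
    hinv.smul ((Continuous.comp (g := fun t => φ (d.path t)) hφ continuous_fst).mul
      (Continuous.comp (g := fun t => F (c.path t) * resolvent a (c.path t)) (hFc.mul hRc)
        continuous_snd))
  have h3 : ∀ t, d.cint (fun z => (z - c.path t)⁻¹ •
      (φ z * (F (c.path t) * resolvent a (c.path t)))) =
      d.cint (fun z => (z - c.path t)⁻¹ • φ z) * F (c.path t) * resolvent a (c.path t) := by
    intro t
    rw [mul_assoc, cint_mul (continuous_inv_smul hφ (path_mem_region h t))]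
    simp only [smul_mul_assoc]
  calc d.cint (fun z => φ z * resolvent a z) * c.cint (fun w => F w * resolvent a w)
      = d.cint (fun z => φ z * resolvent a z * c.cint (fun w => F w * resolvent a w)) :=
        cint_mul (hφ.mul hRd) _
    _ = d.cint (fun z => c.cint fun w => (z - w)⁻¹ • (φ z * (F w * resolvent a w))) :=
        cint_congr h1
    _ = c.cint (fun w => d.cint fun z => (z - w)⁻¹ • (φ z * (F w * resolvent a w))) :=
        cint_swap h2
    _ = _ := cint_congr h3

/-- The Cauchy integral of the square of the resolvent vanishes. -/
lemma cint_resolvent_sq {a : B} (ha : ∀ t, c.path t ∈ resolventSet ℂ a) :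
    c.cint (fun z => resolvent a z ^ 2) = 0 := by
  have hP : ∀ t, HasDerivAt (fun t => resolvent a (c.path t))
      (c.vel t • -resolvent a (c.path t) ^ 2) t := fun t =>
    HasDerivAt.scomp (g₁ := resolvent a) t (spectrum.hasDerivAt_resolvent_const_left (ha t))
      (c.hasDerivAt_path t)
  have hc : Continuous fun t => -resolvent a (c.path t) ^ 2 := ((continuous_resolvent ha).pow 2).neg
  have h1 : c.cint (fun z => -resolvent a z ^ 2) = 0 := by
    rw [cint, intervalIntegral.integral_eq_sub_of_hasDerivAt (fun t _ => hP t)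
      (intervalIntegrable_cint (F := fun z => -resolvent a z ^ 2) hc _ _)]
    have := c.path_periodic 0
    rw [zero_add] at this
    simp [this]
  have h2 : c.cint (fun z => resolvent a z ^ 2) = (-1 : ℂ) • c.cint (fun z => -resolvent a z ^ 2) := by
    rw [← cint_smul]
    simp
  rw [h2, h1, smul_zero]

/-- The factor `x` moves out of the integral, leaving the square of the resolvent, which is minus
the derivative of the resolvent. -/
lemma cint_resolvent_mul_mul_of_commute {a x : B} (ha : ∀ t, c.path t ∈ resolventSet ℂ a)
    (hx : Commute x a) : c.cint (fun z => resolvent a z * x * resolvent a z) = 0 := by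
  have h2 : ∀ t, resolvent a (c.path t) * x * resolvent a (c.path t) =
      x * resolvent a (c.path t) ^ 2 := fun t => by
    rw [(commute_resolvent hx (ha t)).symm.eq, mul_assoc, sq]
  rw [cint_congr (G := fun z => x * resolvent a z ^ 2) h2,
    ← mul_cint ((continuous_resolvent ha).pow 2), cint_resolvent_sq ha, mul_zero]

omit [CompleteSpace B] in
/-- The second order expansion of the resolvent. -/
lemma resolvent_sub_sub {a b : B} {z : ℂ} (ha : z ∈ resolventSet ℂ a)
    (hb : z ∈ resolventSet ℂ b) :
    resolvent b z - resolvent a z - resolvent a z * (b - a) * resolvent a z =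
      resolvent b z * (b - a) * resolvent a z * (b - a) * resolvent a z := by
  have h1 : resolvent b z - resolvent a z = resolvent b z * (b - a) * resolvent a z := by
    have : b - a = (algebraMap ℂ B z - a) - (algebraMap ℂ B z - b) := by abel
    rw [this, mul_sub, sub_mul, resolvent_mul_sub hb, mul_assoc, sub_mul_resolvent ha]
    simp
  rw [h1, ← sub_mul, ← sub_mul, h1]

/-- The second order expansion of Cauchy integrals of the resolvent. -/
lemma norm_cint_resolvent_sub_sub_le {a b : B} (ha : ∀ t, c.path t ∈ resolventSet ℂ a)
    (hb : ∀ t, c.path t ∈ resolventSet ℂ b) {f : ℂ → ℂ} (hf : Continuous fun t => f (c.path t))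
    {M N V : ℝ} (hM : ∀ t, ‖f (c.path t)‖ ≤ M) (hNa : ∀ t, ‖resolvent a (c.path t)‖ ≤ N)
    (hNb : ∀ t, ‖resolvent b (c.path t)‖ ≤ N) (hV : ∀ t, c.speed t ≤ V) :
    ‖c.cint (fun z => f z • resolvent b z) - c.cint (fun z => f z • resolvent a z) -
      c.cint (fun z => f z • (resolvent a z * (b - a) * resolvent a z))‖ ≤
      V * (M * (N ^ 3 * ‖b - a‖ ^ 2)) := by
  have hRa := continuous_resolvent ha
  have hRb := continuous_resolvent hb
  have hM0 : 0 ≤ M := (norm_nonneg _).trans (hM 0)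
  have hN0 : 0 ≤ N := (norm_nonneg _).trans (hNa 0)
  have c1 : Continuous fun t => f (c.path t) • resolvent b (c.path t) := hf.smul hRb
  have c2 : Continuous fun t => f (c.path t) • resolvent a (c.path t) := hf.smul hRa
  have c3 : Continuous fun t => f (c.path t) •
      (resolvent a (c.path t) * (b - a) * resolvent a (c.path t)) :=
    hf.smul ((hRa.mul continuous_const).mul hRa)
  rw [← cint_sub c1 c2, ← cint_sub (c1.sub c2) c3]
  refine norm_cint_le (fun t => ?_) hV
  rw [← smul_sub, ← smul_sub, resolvent_sub_sub (ha t) (hb t), norm_smul]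
  refine mul_le_mul (hM t) ?_ (norm_nonneg _) hM0
  calc _ ≤ ‖resolvent b (c.path t)‖ * ‖b - a‖ * ‖resolvent a (c.path t)‖ * ‖b - a‖ *
        ‖resolvent a (c.path t)‖ := by
        refine (norm_mul_le _ _).trans ?_
        gcongr
        refine (norm_mul_le _ _).trans ?_
        gcongr
        refine (norm_mul_le _ _).trans ?_
        gcongr
        exact norm_mul_le _ _
    _ ≤ N * ‖b - a‖ * N * ‖b - a‖ * N := by
        gcongr <;> first | exact hNa t | exact hNb t
    _ = _ := by ring

lemma exists_speed_le (c : SupportCurve) : ∃ V, ∀ t, c.speed t ≤ V := by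
  have hper : Function.Periodic c.speed (2 * Real.pi) := by
    intro t
    have h1 : c.p'' (t + 2 * Real.pi) = c.p'' t := by
      have h2 : HasDerivAt (fun s => c.p' (s + 2 * Real.pi)) (c.p'' (t + 2 * Real.pi)) t :=
        (c.hasDerivAt_p' (t + 2 * Real.pi)).comp_add_const t (2 * Real.pi)
      have h3 : (fun s => c.p' (s + 2 * Real.pi)) = c.p' := funext c.periodic_p'
      rw [h3] at h2
      exact h2.unique (c.hasDerivAt_p' t)
    simp only [speed, h1, c.periodic_p t]
  obtain ⟨V, hV⟩ := (isCompact_Icc (a := (0 : ℝ)) (b := 2 * Real.pi)).exists_bound_of_continuousOn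
    c.continuous_speed.continuousOn
  refine ⟨V, fun t => ?_⟩
  obtain ⟨t', ht', he⟩ := hper.exists_mem_Ico₀ (by positivity) t
  rw [he]
  exact (le_abs_self _).trans (hV t' ⟨ht'.1, ht'.2.le⟩)

end SupportCurve

/-! ### Hilbert space operators whose numerical range lies inside a curve. -/

section Hilbert

open scoped InnerProductSpace
open SupportCurve

variable {H : Type*} [NormedAddCommGroup H] [InnerProductSpace ℂ H] [CompleteSpace H]
  {c d : SupportCurve} {A : H →L[ℂ] H} {ε : ℝ}

/-- The numerical range of `A` lies inside the curve, at distance at least `ε` from it. -/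
def Encloses (c : SupportCurve) (A : H →L[ℂ] H) (ε : ℝ) : Prop :=
  ∀ t x, (expI (-t) * ⟪x, A x⟫_ℂ).re ≤ (c.p t - ε) * ‖x‖ ^ 2

omit [CompleteSpace H] in
lemma Encloses.mono (h : Encloses c A ε) (hcd : ∀ t, c.p t ≤ d.p t) : Encloses d A ε :=
  fun t x => (h t x).trans (by gcongr; exact hcd t)

-- A violated supporting inequality for `z` makes the rotated real part of `z - A` at least `ε`.
-- Invertibility, the resolvent bound `ε⁻¹` and the positivity of the Poisson kernel all come from
-- this.
omit [CompleteSpace H] in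
lemma Encloses.le_re_inner (h : Encloses c A ε) {z : ℂ} {t : ℝ}
    (ht : c.p t ≤ (expI (-t) * z).re) (x : H) :
    ε * ‖x‖ ^ 2 ≤ (expI (-t) * ⟪x, (algebraMap ℂ (H →L[ℂ] H) z - A) x⟫_ℂ).re := by
  have h1 := h t x
  have h2 : expI (-t) * ⟪x, (algebraMap ℂ (H →L[ℂ] H) z - A) x⟫_ℂ =
      (expI (-t) * z) * ((‖x‖ ^ 2 : ℝ) : ℂ) - expI (-t) * ⟪x, A x⟫_ℂ := by
    rw [sub_apply, inner_sub_right, mul_sub,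
      Algebra.algebraMap_eq_smul_one, smul_apply,
      one_apply_eq_self, inner_smul_right, inner_self_eq_norm_sq_to_K]
    push_cast
    simp [mul_assoc]
  rw [h2, Complex.sub_re, Complex.re_mul_ofReal]
  have := mul_le_mul_of_nonneg_right ht (sq_nonneg ‖x‖)
  linarith

lemma Encloses.mem_resolventSet (h : Encloses c A ε) (hε : 0 < ε) {z : ℂ} (hz : z ∉ c.region) :
    z ∈ resolventSet ℂ A := by
  obtain ⟨t, ht⟩ : ∃ t, c.p t ≤ (expI (-t) * z).re := by
    by_contra! hcon; exact hz hcon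
  refine ContinuousLinearMap.isUnit_of_forall_le_norm_inner_map _ (c := ⟨ε, hε.le⟩) hε fun x => ?_
  have h1 := (h.le_re_inner ht x).trans (re_expI_mul_le _ _)
  rw [← inner_conj_symm, RCLike.norm_conj, mul_comm]
  exact h1

lemma Encloses.norm_resolvent_le (h : Encloses c A ε) (hε : 0 < ε) {z : ℂ} (hz : z ∉ c.region) :
    ‖resolvent A z‖ ≤ ε⁻¹ := by
  obtain ⟨t, ht⟩ : ∃ t, c.p t ≤ (expI (-t) * z).re := by
    by_contra! hcon; exact hz hcon
  refine ContinuousLinearMap.opNorm_le_bound _ (by positivity) fun y => ?_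
  set x := resolvent A z y with hx
  have hy : (algebraMap ℂ (H →L[ℂ] H) z - A) x = y := by
    have := congrArg (fun T : H →L[ℂ] H => T y) (sub_mul_resolvent (h.mem_resolventSet hε hz))
    simpa using this
  have h1 := (h.le_re_inner ht x).trans ((re_expI_mul_le _ _).trans (norm_inner_le_norm _ _))
  rw [hy] at h1
  rcases (norm_nonneg x).eq_or_lt with h0 | h0
  · rw [← h0]; positivity
  · rw [inv_mul_eq_div, le_div_iff₀ hε]
    nlinarith

lemma path_notMem_region (hcd : ∀ t, c.p t ≤ d.p t) (t : ℝ) : d.path t ∉ c.region :=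
  fun ht => absurd (ht t) (not_lt.2 ((hcd t).trans_eq (d.re_path_self t).symm))

lemma Encloses.path_mem_resolventSet (h : Encloses c A ε) (hε : 0 < ε) (t : ℝ) :
    c.path t ∈ resolventSet ℂ A :=
  h.mem_resolventSet hε (path_notMem_region (fun _ => le_rfl) t)

lemma Encloses.norm_resolvent_path_le (h : Encloses c A ε) (hε : 0 < ε) (t : ℝ) :
    ‖resolvent A (c.path t)‖ ≤ ε⁻¹ :=
  h.norm_resolvent_le hε (path_notMem_region (fun _ => le_rfl) t)

/-- The Cauchy integral of the resolvent is the identity. -/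
theorem Encloses.cint_resolvent (h : Encloses c A ε) (hε : 0 < ε) {w : ℂ} (hw : w ∈ c.region) :
    c.cint (fun z => resolvent A z) = 1 := by
  obtain ⟨η, hη, hηw⟩ := c.exists_forall_le_of_mem_region hw
  set D : H →L[ℂ] H := A - algebraMap ℂ _ w
  -- The segment joins the scalar operator `w`, for which the claim is the winding number, to `A`.
  -- By convexity every operator on it is enclosed with margin `min ε η`.
  set a : ℝ → H →L[ℂ] H := fun s => algebraMap ℂ _ w + (s : ℂ) • D with ha
  have hδ : 0 < min ε η := lt_min hε hη
  have henc : ∀ s ∈ Set.Icc (0 : ℝ) 1, Encloses c (a s) (min ε η) := by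
    intro s hs t x
    have e1 : expI (-t) * ⟪x, a s x⟫_ℂ = ((1 - s : ℝ) : ℂ) * ((expI (-t) * w) *
        ((‖x‖ ^ 2 : ℝ) : ℂ)) + (s : ℂ) * (expI (-t) * ⟪x, A x⟫_ℂ) := by
      simp only [ha, D, Algebra.algebraMap_eq_smul_one, add_apply,
        smul_apply, one_apply_eq_self, inner_add_right,
        inner_smul_right, sub_apply, inner_sub_right,
        inner_self_eq_norm_sq_to_K]
      push_cast
      simp
      ring
    rw [e1, Complex.add_re, Complex.re_ofReal_mul, Complex.re_ofReal_mul, Complex.re_mul_ofReal]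
    have e2 : (expI (-t) * w).re * ‖x‖ ^ 2 ≤ (c.p t - min ε η) * ‖x‖ ^ 2 := by
      gcongr; linarith [hηw t, min_le_right ε η]
    have e3 : (expI (-t) * ⟪x, A x⟫_ℂ).re ≤ (c.p t - min ε η) * ‖x‖ ^ 2 :=
      (h t x).trans (by gcongr; exact min_le_left _ _)
    have := mul_le_mul_of_nonneg_left e2 (sub_nonneg.2 hs.2)
    have := mul_le_mul_of_nonneg_left e3 hs.1
    linarith
  set J : ℝ → H →L[ℂ] H := fun s => c.cint fun z => resolvent (a s) z with hJ
  obtain ⟨V, hV⟩ := c.exists_speed_le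
  -- Increments along the segment are multiples of `D`, which commutes with `a s`. So the first
  -- order term vanishes, and the quadratic bound forces the integral to be constant in `s`.
  have hbound : ∀ s ∈ Set.Icc (0 : ℝ) 1, ∀ s' ∈ Set.Icc (0 : ℝ) 1,
      ‖J s' - J s‖ ≤ V * ((min ε η)⁻¹ ^ 3 * ‖D‖ ^ 2) * |s' - s| ^ 2 := by
    intro s hs s' hs'
    have hres := (henc s hs).path_mem_resolventSet hδ
    have h1 := norm_cint_resolvent_sub_sub_le (f := fun _ => 1) hres
      ((henc s' hs').path_mem_resolventSet hδ) continuous_const (M := 1) (by simp)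
      ((henc s hs).norm_resolvent_path_le hδ) ((henc s' hs').norm_resolvent_path_le hδ) hV
    have hdiff : a s' - a s = ((s' - s : ℝ) : ℂ) • D := by
      simp only [ha]; push_cast; module
    have hcomm : Commute (a s' - a s) (a s) := by
      rw [hdiff]
      exact Commute.smul_left ((Algebra.commute_algebraMap_right w D).add_right
        ((Commute.refl D).smul_right _)) _
    have hzero := cint_resolvent_mul_mul_of_commute hres hcomm
    simp only [one_smul] at h1
    rw [hzero, sub_zero, hdiff, norm_smul, Complex.norm_real, Real.norm_eq_abs, mul_pow] at h1
    refine h1.trans_eq (by ring)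
  have hderiv : ∀ s ∈ Set.Icc (0 : ℝ) 1, HasDerivWithinAt J 0 (Set.Icc 0 1) s := by
    intro s hs
    rw [hasDerivWithinAt_iff_isLittleO]
    simp only [smul_zero, sub_zero]
    refine Asymptotics.IsBigO.trans_isLittleO (g := fun s' => |s' - s| ^ 2) ?_ ?_
    · refine Asymptotics.IsBigO.of_bound (V * ((min ε η)⁻¹ ^ 3 * ‖D‖ ^ 2)) ?_
      filter_upwards [self_mem_nhdsWithin] with s' hs'
      rw [norm_pow, Real.norm_eq_abs, abs_abs]
      exact hbound s hs s' hs'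
    · have h1 : (fun s' : ℝ => |s' - s| ^ 2) =o[𝓝 s] fun s' => s' - s := by
        have := (Asymptotics.isLittleO_pow_sub_sub s (show 1 < 2 by norm_num))
        simpa using this
      exact h1.mono nhdsWithin_le_nhds
  have hconst := (convex_Icc (0 : ℝ) 1).norm_image_sub_le_of_norm_hasDerivWithin_le (C := 0)
    hderiv (by simp) (Set.left_mem_Icc.2 zero_le_one) (Set.right_mem_Icc.2 zero_le_one)
  rw [zero_mul, norm_le_zero_iff, sub_eq_zero] at hconst
  have h1 : a 1 = A := by simp [ha, D]
  have h0 : a 0 = algebraMap ℂ _ w := by simp [ha]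
  have h2 : J 1 = c.cint (fun z => resolvent A z) := by simp only [hJ, h1]
  rw [← h2, hconst]
  have h3 : ∀ t, resolvent (a 0) (c.path t) = (c.path t - w)⁻¹ • (1 : H →L[ℂ] H) := by
    intro t
    have h5 := sub_mul_resolvent ((henc 0 ⟨le_rfl, zero_le_one⟩).path_mem_resolventSet hδ t)
    rw [h0, ← map_sub, Algebra.algebraMap_eq_smul_one, smul_mul_assoc, one_mul] at h5
    rw [← h5, h0, inv_smul_smul₀ (path_sub_ne_zero hw t)]
  have h4 := clm_cint (c := c) (F := fun z => (z - w)⁻¹)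
    ((c.continuous_path.sub continuous_const).inv₀ (path_sub_ne_zero hw))
    ((ContinuousLinearMap.id ℂ ℂ).smulRight (1 : H →L[ℂ] H))
  rw [cint_inv hw] at h4
  simp only [hJ]
  rw [cint_congr (G := fun z => (z - w)⁻¹ • (1 : H →L[ℂ] H)) h3]
  simpa using h4.symm

end Hilbert

end MatFun

/-! ### The theorem of Crouzeix and Palencia for operator valued functions. -/

namespace MatFun

open scoped InnerProductSpace
open SupportCurve

variable {H : Type*} [NormedAddCommGroup H] [InnerProductSpace ℂ H] [CompleteSpace H]
  {c d : SupportCurve} {A : H →L[ℂ] H} {ε : ℝ}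

/-- The positive operator valued density on the curve. -/
noncomputable def poissonKernel (c : SupportCurve) (A : H →L[ℂ] H) (t : ℝ) : H →L[ℂ] H :=
  (c.speed t / (2 * Real.pi)) •
    (expI t • resolvent A (c.path t) + star (expI t • resolvent A (c.path t)))

lemma continuous_poissonKernel (h : Encloses c A ε) (hε : 0 < ε) :
    Continuous (poissonKernel c A) := by
  have hR := continuous_expI.smul (continuous_resolvent (h.path_mem_resolventSet hε))
  exact (c.continuous_speed.div_const _).smul (hR.add hR.star)

/-- With `y = R x`, the quadratic form of `e^{it} R` at `x` has the real part of `e^{-it} ⟪y, (z -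
A) y⟫`, which the supporting line at `z = path t` bounds below by `ε ‖y‖²`. -/
lemma Encloses.poissonKernel_nonneg (h : Encloses c A ε) (hε : 0 < ε) (t : ℝ) :
    0 ≤ poissonKernel c A t := by
  refine smul_nonneg (div_nonneg (c.nonneg t) (by positivity)) ?_
  rw [ContinuousLinearMap.nonneg_iff_isPositive, ContinuousLinearMap.isPositive_def']
  refine ⟨IsSelfAdjoint.add_star_self _, fun x => ?_⟩
  set T := expI t • resolvent A (c.path t) with hT
  have h1 : ContinuousLinearMap.reApplyInnerSelf (T + star T) x = 2 * (⟪T x, x⟫_ℂ).re := by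
    rw [ContinuousLinearMap.reApplyInnerSelf, add_apply, inner_add_left,
      ContinuousLinearMap.star_eq_adjoint, ContinuousLinearMap.adjoint_inner_left,
      two_mul]
    simp only [map_add, RCLike.re_eq_complex_re, add_right_inj]
    exact inner_re_symm (𝕜 := ℂ) x (T x)
  rw [h1]
  set y := resolvent A (c.path t) x with hy
  have hx : (algebraMap ℂ (H →L[ℂ] H) (c.path t) - A) y = x := by
    have := congrArg (fun T : H →L[ℂ] H => T x) (sub_mul_resolvent (h.path_mem_resolventSet hε t))
    simpa using this
  have h2 := h.le_re_inner (c.re_path_self t).ge y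
  rw [hx] at h2
  have h3 : ⟪T x, x⟫_ℂ = expI (-t) * ⟪y, x⟫_ℂ := by
    rw [hT, smul_apply, inner_smul_left, ← star_expI]
    rfl
  rw [h3]
  have : 0 ≤ ε * ‖y‖ ^ 2 := by positivity
  linarith

/-- `T + S*`, where `S` is the Cauchy transform of the adjoint, is the integral of a positive
kernel. -/
lemma cint_add_star_cint (h : Encloses c A ε) (hε : 0 < ε) {F : ℂ → H →L[ℂ] H}
    (hF : Continuous fun t => F (c.path t))
    (hFA : ∀ t, Commute (F (c.path t)) A) (hFA' : ∀ t, Commute (star (F (c.path t))) A) :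
    c.cint (fun z => F z * resolvent A z) + star (c.cint (fun z => star (F z) * resolvent A z)) =
      ∫ t in (0 : ℝ)..(2 * Real.pi), poissonKernel c A t * F (c.path t) := by
  have hR := continuous_resolvent (h.path_mem_resolventSet hε)
  have h1 : Continuous fun t => c.vel t • (F (c.path t) * resolvent A (c.path t)) :=
    c.continuous_vel.smul (hF.mul hR)
  have h2 : Continuous fun t => star (c.vel t) •
      star (star (F (c.path t)) * resolvent A (c.path t)) :=
    c.continuous_vel.star.smul (hF.star.mul hR).star
  rw [star_cint, cint, ← sub_eq_add_neg, ← smul_sub, ← intervalIntegral.integral_sub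
    (h1.intervalIntegrable _ _) (h2.intervalIntegrable _ _), ← intervalIntegral.integral_smul]
  congr 1; ext1 t
  have e1 := commute_resolvent (hFA t) (h.path_mem_resolventSet hε t)
  have e2 := commute_resolvent (hFA' t) (h.path_mem_resolventSet hε t)
  rw [star_mul, star_star, e1.eq, poissonKernel, smul_mul_assoc, add_mul, star_smul,
    smul_mul_assoc, smul_mul_assoc, vel, star_mul', star_mul', smul_add, smul_sub,
    sub_eq_add_neg, ← smul_neg]
  have hI : Complex.I ≠ 0 := Complex.I_ne_zero
  have hpi : (Real.pi : ℂ) ≠ 0 := by exact_mod_cast Real.pi_pos.ne'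
  congr 1
  · rw [← Complex.coe_smul, smul_smul, smul_smul]
    congr 1
    push_cast
    field_simp
  · rw [← Complex.coe_smul, smul_smul, smul_neg, smul_smul, ← neg_smul]
    congr 1
    simp
    field_simp
    rw [Complex.I_sq]
    ring

/-- The square root `Q` of `M` also commutes with `G`, so the form is `⟪G Q x, Q y⟫`, and
Cauchy–Schwarz with the arithmetic-geometric mean inequality finishes. Being linear in `M`, the
bound can be integrated against the operator density. -/
lemma norm_inner_mul_le {M G : H →L[ℂ] H} (hM : 0 ≤ M) (hG : ‖G‖ ≤ 1) (hc : Commute M G)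
    (x y : H) :
    ‖⟪(M * G) x, y⟫_ℂ‖ ≤ 2⁻¹ * ((⟪M x, x⟫_ℂ).re + (⟪M y, y⟫_ℂ).re) := by
  set Q := CFC.sqrt M with hQ
  have hQQ : Q * Q = M := CFC.sqrt_mul_sqrt_self M hM
  have hQG : Commute Q G := by
    rw [hQ, CFC.sqrt_eq_cfc]
    exact hc.cfc_nnreal _
  have hQ0 : IsSelfAdjoint Q := IsSelfAdjoint.of_nonneg (CFC.sqrt_nonneg M)
  have hadj : ∀ u v, ⟪Q u, v⟫_ℂ = ⟪u, Q v⟫_ℂ := fun u v => by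
    rw [← ContinuousLinearMap.adjoint_inner_left, ← ContinuousLinearMap.star_eq_adjoint,
      hQ0.star_eq]
  have h1 : ⟪(M * G) x, y⟫_ℂ = ⟪G (Q x), Q y⟫_ℂ := by
    rw [← hadj]
    congr 1
    rw [← hQQ, mul_assoc, hQG.eq]
    rfl
  have h2 : ∀ x, (⟪M x, x⟫_ℂ).re = ‖Q x‖ ^ 2 := fun x => by
    rw [← hQQ]
    change (⟪Q (Q x), x⟫_ℂ).re = _
    rw [hadj, inner_self_eq_norm_sq_to_K]
    norm_cast
  rw [h1, h2, h2]
  have h3 : ‖G (Q x)‖ ≤ ‖Q x‖ := (G.le_opNorm _).trans (mul_le_of_le_one_left (norm_nonneg _) hG)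
  calc _ ≤ ‖G (Q x)‖ * ‖Q y‖ := norm_inner_le_norm _ _
    _ ≤ ‖Q x‖ * ‖Q y‖ := by gcongr
    _ ≤ _ := by nlinarith [sq_nonneg (‖Q x‖ - ‖Q y‖)]

omit [CompleteSpace H] in
lemma opNorm_le_two_of_norm_inner_le {Q : H →L[ℂ] H}
    (h : ∀ x y, ‖⟪Q x, y⟫_ℂ‖ ≤ ‖x‖ ^ 2 + ‖y‖ ^ 2) : ‖Q‖ ≤ 2 := by
  refine Q.opNorm_le_bound zero_le_two fun x => ?_
  rcases eq_or_ne (Q x) 0 with h0 | h0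
  · rw [h0, norm_zero]; positivity
  rcases eq_or_ne x 0 with hx | hx
  · simp [hx]
  have h1 : 0 < ‖Q x‖ := norm_pos_iff.2 h0
  have h2 : 0 < ‖x‖ := norm_pos_iff.2 hx
  -- The test vector is aligned with `Q x` and rescaled to the length of `x`, which balances the two
  -- squares.
  have h3 := h x (((‖x‖ / ‖Q x‖ : ℝ) : ℂ) • Q x)
  rw [inner_smul_right, inner_self_eq_norm_sq_to_K, norm_mul, norm_smul, Complex.norm_real,
    Real.norm_eq_abs, abs_of_pos (by positivity)] at h3
  simp only [Complex.coe_algebraMap, norm_pow, Complex.norm_real, norm_norm] at h3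
  rw [div_mul_cancel₀ _ h1.ne'] at h3
  have h4 : ‖x‖ / ‖Q x‖ * ‖Q x‖ ^ 2 = ‖x‖ * ‖Q x‖ := by field_simp
  rw [h4] at h3
  nlinarith

/-- The main estimate of Crouzeix and Palencia. -/
theorem norm_cint_add_star_cint_le (h : Encloses c A ε) (hε : 0 < ε) {w : ℂ} (hw : w ∈ c.region)
    {F : ℂ → H →L[ℂ] H} (hF : Continuous fun t => F (c.path t))
    (hb : ∀ t, ‖F (c.path t)‖ ≤ 1)
    (hFA : ∀ t, Commute (F (c.path t)) A) (hFA' : ∀ t, Commute (star (F (c.path t))) A) :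
    ‖c.cint (fun z => F z * resolvent A z) +
      star (c.cint (fun z => star (F z) * resolvent A z))‖ ≤ 2 := by
  have hK := continuous_poissonKernel h hε
  -- For `F = 1` both `T` and `S` are the identity, so the density has total mass 2.
  have hone : ∫ t in (0 : ℝ)..(2 * Real.pi), poissonKernel c A t = (2 : ℂ) • 1 := by
    have := cint_add_star_cint h hε (F := fun _ => 1) continuous_const
      (fun _ => Commute.one_left _) (fun _ => by simp)
    simp only [mul_one, star_one, one_mul, h.cint_resolvent hε hw] at this
    rw [← this, two_smul]
  rw [cint_add_star_cint h hε hF hFA hFA']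
  have happ : ∀ {f : ℝ → H →L[ℂ] H} (_ : Continuous f) (x y : H),
      ⟪(∫ t in (0 : ℝ)..(2 * Real.pi), f t) x, y⟫_ℂ =
        ∫ t in (0 : ℝ)..(2 * Real.pi), ⟪f t x, y⟫_ℂ := by
    intro f hf x y
    rw [ContinuousLinearMap.intervalIntegral_apply (hf.intervalIntegrable _ _), ← inner_conj_symm,
      ← innerSL_apply_apply ℂ, ← ContinuousLinearMap.intervalIntegral_comp_comm _
        ((hf.clm_apply continuous_const).intervalIntegrable _ _),
      ← Complex.star_def, star_intervalIntegral]
    congr 1; ext1 t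
    rw [innerSL_apply_apply, Complex.star_def, inner_conj_symm]
  have hre : ∀ x, ∫ t in (0 : ℝ)..(2 * Real.pi), (⟪poissonKernel c A t x, x⟫_ℂ).re =
      2 * ‖x‖ ^ 2 := by
    intro x
    have h1 : Continuous fun t => ⟪poissonKernel c A t x, x⟫_ℂ :=
      (hK.clm_apply continuous_const).inner continuous_const
    have h2 := Complex.reCLM.intervalIntegral_comp_comm (μ := MeasureTheory.volume) (h1.intervalIntegrable 0 (2 * Real.pi))
    simp only [Complex.reCLM_apply] at h2
    rw [h2, ← happ hK, hone, smul_apply, one_apply_eq_self, inner_smul_left,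
      inner_self_eq_norm_sq_to_K]
    have h3 : (‖x‖ : ℂ) ^ 2 = ((‖x‖ ^ 2 : ℝ) : ℂ) := by push_cast; rfl
    simp [h3, -Complex.ofReal_pow]
  refine opNorm_le_two_of_norm_inner_le fun x y => ?_
  have hcx : ∀ x, Continuous fun t => (⟪poissonKernel c A t x, x⟫_ℂ).re := fun x =>
    Complex.continuous_re.comp ((hK.clm_apply continuous_const).inner continuous_const)
  have hKF : Continuous fun t => poissonKernel c A t * F (c.path t) := hK.mul hF
  rw [happ hKF]
  have hsum : ‖x‖ ^ 2 + ‖y‖ ^ 2 = ∫ t in (0 : ℝ)..(2 * Real.pi),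
      2⁻¹ * ((⟪poissonKernel c A t x, x⟫_ℂ).re + (⟪poissonKernel c A t y, y⟫_ℂ).re) := by
    rw [intervalIntegral.integral_const_mul, intervalIntegral.integral_add
      ((hcx x).intervalIntegrable _ _) ((hcx y).intervalIntegrable _ _), hre, hre]
    ring
  rw [hsum]
  refine intervalIntegral.norm_integral_le_of_norm_le (by positivity)
    (Eventually.of_forall fun t _ => ?_)
    ((continuous_const.mul ((hcx x).add (hcx y))).intervalIntegrable _ _)
  refine norm_inner_mul_le (h.poissonKernel_nonneg hε t) (hb t) ?_ x y
  have e1 := commute_resolvent (hFA t) (h.path_mem_resolventSet hε t)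
  have e2 := commute_resolvent (hFA' t) (h.path_mem_resolventSet hε t)
  have e3 : Commute (F (c.path t)) (star (resolvent A (c.path t))) := by
    simpa using e2.star_star
  refine (Commute.smul_left (Commute.add_left (e1.symm.smul_left _) ?_) _)
  rw [star_smul]
  exact e3.symm.smul_left _

/-- Independence of the Cauchy integral of the curve. -/
lemma cint_eq_cint (h : Encloses c A ε) (hε : 0 < ε) {e : SupportCurve} {w : ℂ} (hw : w ∈ c.region)
    (hcd : ∀ t, c.p t < d.p t) (hde : ∀ t, d.p t < e.p t) {F : ℂ → H →L[ℂ] H}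
    (hF : DifferentiableOn ℂ F e.region) :
    d.cint (fun z => F z * resolvent A z) = c.cint (fun z => F z * resolvent A z) := by
  have hd := h.mono fun t => (hcd t).le
  have hFc : Continuous fun t => F (d.path t) :=
    hF.continuousOn.comp_continuous d.continuous_path (path_mem_region hde)
  -- The inner factor is the constant 1, whose Cauchy integral is the identity; the Cauchy transform
  -- of `F` over the outer curve is `F` itself.
  have := cint_mul_cint hcd (h.path_mem_resolventSet hε) (hd.path_mem_resolventSet hε) hFc
    (F := fun _ => 1) (differentiableOn_const _) (fun _ _ => Commute.one_left _)
  simp only [one_mul, h.cint_resolvent hε hw, mul_one] at this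
  rw [this]
  exact cint_congr fun t => by rw [cint_cauchy hde hF (path_mem_region hcd t)]

/-- The functions admitted in the theorem of Crouzeix and Palencia. -/
structure IsContractive (d : SupportCurve) (A : H →L[ℂ] H) (F : ℂ → H →L[ℂ] H) : Prop where
  differentiableOn : DifferentiableOn ℂ F d.region
  norm_le : ∀ z ∈ d.region, ‖F z‖ ≤ 1
  commute : ∀ z ∈ d.region, Commute (F z) A
  commute_star : ∀ z ∈ d.region, Commute (star (F z)) A

lemma commute_cint {F : ℂ → H →L[ℂ] H} (hF : Continuous fun t => F (c.path t)) {x : H →L[ℂ] H}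
    (h : ∀ t, Commute (F (c.path t)) x) : Commute (c.cint F) x := by
  rw [Commute, SemiconjBy, cint_mul hF, mul_cint hF]
  exact cint_congr fun t => (h t).eq

/-- The trick of Crouzeix and Palencia: `T (T + S*)* T = T T* T + T S T`, and `T S T` is the value
of the functional calculus at an admissible function. -/
lemma IsContractive.exists_le {e b : SupportCurve} (h : Encloses b A ε) (hε : 0 < ε)
    {w : ℂ} (hw : w ∈ b.region) (hbc : ∀ t, b.p t < c.p t) (hcd : ∀ t, c.p t < d.p t)
    (hde : ∀ t, d.p t < e.p t) {F : ℂ → H →L[ℂ] H} (hF : IsContractive e A F) :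
    ∃ G, IsContractive d A G ∧ ‖d.cint (fun z => F z * resolvent A z)‖ ^ 3 ≤
      2 * ‖d.cint (fun z => F z * resolvent A z)‖ ^ 2 +
        ‖c.cint (fun z => G z * resolvent A z)‖ := by
  have hde' := region_subset fun t => (hde t).le
  have hc := h.mono fun t => (hbc t).le
  have hd := hc.mono fun t => (hcd t).le
  have hwc : w ∈ c.region := region_subset (fun t => (hbc t).le) hw
  have hwd : w ∈ d.region := region_subset (fun t => (hcd t).le) hwc
  have hdpath := path_mem_region hde
  have hFc : Continuous fun t => F (d.path t) :=
    hF.differentiableOn.continuousOn.comp_continuous d.continuous_path hdpath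
  set g : ℂ → H →L[ℂ] H := fun w => d.cint fun z => (z - w)⁻¹ • star (F z) with hg
  have hgd : DifferentiableOn ℂ g d.region :=
    differentiableOn_cauchyTransform (F := fun z => star (F z)) hFc.star
  have hg1 : ∀ z ∈ d.region, ‖g z‖ ≤ 1 := fun z hz =>
    norm_cauchyTransform_star_le_one hde hF.differentiableOn hF.norm_le hz
  have hgA : ∀ z ∈ d.region, Commute (g z) A := fun z hz =>
    commute_cint (F := fun x => (x - z)⁻¹ • star (F x))
      (continuous_inv_smul (F := fun z => star (F z)) hFc.star hz)
      fun t => (hF.commute_star _ (hdpath t)).smul_left _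
  have hgA' : ∀ z ∈ d.region, Commute (star (g z)) A := fun z hz => by
    have h1 : Commute (g z) (star A) :=
      commute_cint (F := fun x => (x - z)⁻¹ • star (F x))
        (continuous_inv_smul (F := fun z => star (F z)) hFc.star hz)
        fun t => ((hF.commute _ (hdpath t)).star_star).smul_left _
    simpa using h1.star_star
  have hFd : DifferentiableOn ℂ F d.region := hF.differentiableOn.mono hde'
  have hgF : DifferentiableOn ℂ (fun z => g z * F z) d.region := hgd.mul hFd
  have hFgF : DifferentiableOn ℂ (fun z => F z * (g z * F z)) d.region := hFd.mul hgF
  refine ⟨fun z => F z * (g z * F z), ⟨hFgF, fun z hz => ?_, fun z hz => ?_, fun z hz => ?_⟩, ?_⟩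
  · calc ‖F z * (g z * F z)‖ ≤ ‖F z‖ * (‖g z‖ * ‖F z‖) :=
          (norm_mul_le _ _).trans (by gcongr; exact norm_mul_le _ _)
      _ ≤ 1 * (1 * 1) := by
          gcongr
          exacts [hF.norm_le z (hde' hz), hg1 z hz, hF.norm_le z (hde' hz)]
      _ = 1 := by norm_num
  · exact (hF.commute z (hde' hz)).mul_left ((hgA z hz).mul_left (hF.commute z (hde' hz)))
  · rw [star_mul, star_mul]
    exact ((hF.commute_star z (hde' hz)).mul_left (hgA' z hz)).mul_left
      (hF.commute_star z (hde' hz))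
  set T := d.cint (fun z => F z * resolvent A z) with hT
  set S := d.cint (fun z => star (F z) * resolvent A z) with hS
  -- Moving `T` to the inner curve lets it stand to the right of integrals over `d` in
  -- `cint_mul_cint`, where the outer integrand, here `star (F z)`, need only be continuous.
  have hTc : T = c.cint (fun z => F z * resolvent A z) :=
    cint_eq_cint hc hε hwc hcd hde hF.differentiableOn
  have e1 : S * T = c.cint (fun z => g z * F z * resolvent A z) := by
    rw [hTc, hS]
    exact cint_mul_cint hcd (hc.path_mem_resolventSet hε) (hd.path_mem_resolventSet hε)
      (φ := fun z => star (F z)) hFc.star hFd fun z hz => hF.commute z (hde' hz)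
  have e2 : T * (S * T) = c.cint (fun z => F z * (g z * F z) * resolvent A z) := by
    rw [e1, hT]
    refine (cint_mul_cint hcd (hc.path_mem_resolventSet hε) (hd.path_mem_resolventSet hε)
      hFc hgF fun z hz => (hgA z hz).mul_left (hF.commute z (hde' hz))).trans
      (cint_congr fun t => ?_)
    rw [cint_cauchy hde hF.differentiableOn (path_mem_region hcd t)]
  rw [← e2]
  have e3 : ‖T + star S‖ ≤ 2 := norm_cint_add_star_cint_le hd hε hwd hFc
    (fun t => hF.norm_le _ (hdpath t)) (fun t => hF.commute _ (hdpath t))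
    (fun t => hF.commute_star _ (hdpath t))
  have e4 : T * star T * T = T * star (T + star S) * T - T * (S * T) := by
    rw [star_add, star_star]; noncomm_ring
  have e5 : ‖T * star T * T‖ ≤ 2 * ‖T‖ ^ 2 + ‖T * (S * T)‖ := by
    rw [e4]
    refine (norm_sub_le _ _).trans (add_le_add_left ?_ _)
    calc _ ≤ ‖T‖ * ‖star (T + star S)‖ * ‖T‖ :=
          (norm_mul_le _ _).trans (by gcongr; exact norm_mul_le _ _)
      _ ≤ ‖T‖ * 2 * ‖T‖ := by gcongr; rwa [norm_star]
      _ = _ := by ring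
  refine le_trans ?_ e5
  rcases eq_or_ne T 0 with h0 | h0
  · simp [h0]
  have h1 : 0 < ‖T‖ := norm_pos_iff.2 h0
  -- Two uses of the C*-identity give `‖T‖³ ≤ ‖T T* T‖` after division by `‖T‖`.
  have e6 : ‖T‖ ^ 4 ≤ ‖T‖ * ‖T * star T * T‖ := by
    calc ‖T‖ ^ 4 = (‖T‖ * ‖T‖) * (‖T‖ * ‖T‖) := by ring
      _ = ‖star (star T * T) * (star T * T)‖ := by
        rw [CStarRing.norm_star_mul_self, CStarRing.norm_star_mul_self]
      _ = ‖star T * (T * star T * T)‖ := by rw [star_mul, star_star]; simp only [mul_assoc]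
      _ ≤ _ := (norm_mul_le _ _).trans_eq (by rw [norm_star])
  nlinarith

/-- The theorem of Crouzeix and Palencia, for operator valued functions. -/
theorem IsContractive.norm_cint_le (h : Encloses c A ε) (hε : 0 < ε) {w : ℂ} (hw : w ∈ c.region)
    {s : ℝ} (hs : 0 < s) {F : ℂ → H →L[ℂ] H} (hF : IsContractive (c.shift s hs.le) A F) :
    ‖(c.shift (s / 2) (half_pos hs).le).cint (fun z => F z * resolvent A z)‖ ≤ 1 + √2 := by
  obtain ⟨V, hV⟩ := c.exists_speed_le
  -- The trick passes from the domain at distance `r` to the one at `r / 2`, so the supremum runs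
  -- over all `r ≤ s` in order to be stable under it.
  set X : Set ℝ := {x | ∃ (r : ℝ) (hr : 0 < r) (_ : r ≤ s) (G : ℂ → H →L[ℂ] H),
    IsContractive (c.shift r hr.le) A G ∧
      x = ‖(c.shift (r / 2) (half_pos hr).le).cint (fun z => G z * resolvent A z)‖} with hX
  have hmem : ‖(c.shift (s / 2) (half_pos hs).le).cint (fun z => F z * resolvent A z)‖ ∈ X :=
    ⟨s, hs, le_rfl, F, hF, rfl⟩
  -- Only finiteness matters here: the resolvent bound `ε⁻¹` and a bound on the speed give it, and
  -- the cubic inequality then supplies the sharp constant.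
  have hbdd : BddAbove X := by
    refine ⟨(V + s) * ε⁻¹, ?_⟩
    rintro _ ⟨r, hr, hrs, G, hG, rfl⟩
    have hlt : ∀ t, (c.shift (r / 2) (half_pos hr).le).p t < (c.shift r hr.le).p t := fun t => by
      simp only [shift_p]; linarith
    have henc : Encloses (c.shift (r / 2) (half_pos hr).le) A ε := h.mono fun t => by
      simp only [shift_p]; linarith
    refine SupportCurve.norm_cint_le (fun t => ?_) (fun t => ?_)
    · refine (norm_mul_le _ _).trans ?_
      exact (mul_le_of_le_one_left (norm_nonneg _) (hG.norm_le _ (path_mem_region hlt t))).trans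
        (henc.norm_resolvent_path_le hε t)
    · have := hV t
      simp only [speed, shift_p, shift_p''] at this ⊢
      linarith
  have hle : ∀ x ∈ X, x ^ 3 ≤ 2 * x ^ 2 + sSup X := by
    rintro _ ⟨r, hr, hrs, G, hG, rfl⟩
    obtain ⟨G', hG', hle⟩ := hG.exists_le (b := c) (c := c.shift (r / 2 / 2) (by positivity))
      (d := c.shift (r / 2) (half_pos hr).le) h hε hw
      (fun t => by simp only [shift_p]; linarith) (fun t => by simp only [shift_p]; linarith)
      (fun t => by simp only [shift_p]; linarith)
    refine hle.trans (add_le_add_right (le_csSup hbdd ?_) _)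
    exact ⟨r / 2, half_pos hr, by linarith, G', hG', rfl⟩
  obtain ⟨u, -, hu, huX⟩ := exists_seq_tendsto_sSup ⟨_, hmem⟩ hbdd
  have hK : sSup X ^ 3 ≤ 2 * sSup X ^ 2 + sSup X :=
    le_of_tendsto_of_tendsto' (hu.pow 3) (((hu.pow 2).const_mul 2).add_const _)
      fun n => hle _ (huX n)
  refine (le_csSup hbdd hmem).trans ?_
  by_contra! hcon
  have h2 : √2 ^ 2 = 2 := Real.sq_sqrt zero_le_two
  have h3 : 0 ≤ √2 := Real.sqrt_nonneg 2
  have hpos : 0 < sSup X := by linarith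
  have h4 : 0 < sSup X ^ 2 - 2 * sSup X - 1 := by nlinarith
  nlinarith [mul_pos hpos h4]

end MatFun

/-! ### Residues: small circles versus one curve. -/

namespace MatFun

open SupportCurve

/-- The properties of a sum of contour integrals around the points of `S` in the domain `U`. -/
structure IsResidueSum (Λ : (ℂ → ℂ) → ℂ) (S : Finset ℂ) (U : Set ℂ) : Prop where
  congr : ∀ {F G : ℂ → ℂ}, Set.EqOn F G (U \ S) → Λ F = Λ G
  add : ∀ {F G : ℂ → ℂ}, ContinuousOn F (U \ S) → ContinuousOn G (U \ S) →
    Λ (fun z => F z + G z) = Λ F + Λ G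
  smul : ∀ (a : ℂ) {F : ℂ → ℂ}, Λ (fun z => a * F z) = a * Λ F
  eq_zero : ∀ {F : ℂ → ℂ}, DifferentiableOn ℂ F U → Λ F = 0
  inv : ∀ a ∈ S, Λ (fun z => (z - a)⁻¹) = 1
  inv_pow : ∀ a ∈ S, ∀ k : ℕ, Λ (fun z => ((z - a) ^ (k + 2))⁻¹) = 0

namespace IsResidueSum

variable {Λ Λ' : (ℂ → ℂ) → ℂ} {S : Finset ℂ} {U : Set ℂ}

lemma prod_sub_ne_zero {m : Multiset ℂ} (hm : ∀ a ∈ m, a ∈ S) {z : ℂ} (hz : z ∈ U \ S) :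
    (m.map fun a => z - a).prod ≠ 0 := by
  rw [Ne, Multiset.prod_eq_zero_iff, Multiset.mem_map]
  rintro ⟨a, ha, h⟩
  exact hz.2 (sub_eq_zero.1 h ▸ hm a ha)

lemma continuousOn_inv_prod {m : Multiset ℂ} (hm : ∀ a ∈ m, a ∈ S) :
    ContinuousOn (fun z => (m.map fun a => z - a).prod⁻¹) (U \ S) := by
  refine ContinuousOn.inv₀ (Continuous.continuousOn ?_) fun z hz => prod_sub_ne_zero hm hz
  exact continuous_multiset_prod m fun a _ => continuous_id.sub continuous_const

/-- Partial fractions: two distinct poles `a` and `b` can be separated with coefficients `±(a -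
b)⁻¹`, which lowers the number of factors. What remains is a single pole, whose integral is
prescribed. -/
lemma prod_inv_eq (h : IsResidueSum Λ S U) (h' : IsResidueSum Λ' S U) :
    ∀ (k : ℕ) (m : Multiset ℂ), m.card = k → (∀ a ∈ m, a ∈ S) →
      Λ (fun z => (m.map fun a => z - a).prod⁻¹) = Λ' (fun z => (m.map fun a => z - a).prod⁻¹) := by
  intro k
  induction k with
  | zero =>
    intro m hm _
    obtain rfl := Multiset.card_eq_zero.1 hm
    simp only [Multiset.map_zero, Multiset.prod_zero, inv_one]
    rw [h.eq_zero (differentiableOn_const _), h'.eq_zero (differentiableOn_const _)]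
  | succ k ih =>
    intro m hm hmS
    obtain ⟨a, ha⟩ := Multiset.card_pos_iff_exists_mem.1 (by omega : 0 < m.card)
    by_cases hall : ∀ b ∈ m, b = a
    · have hrep : m = Multiset.replicate (k + 1) a := Multiset.eq_replicate.2 ⟨hm, hall⟩
      rw [hrep]
      simp only [Multiset.map_replicate, Multiset.prod_replicate]
      rcases k with _ | k
      · simp only [zero_add, pow_one]
        rw [h.inv a (hmS a ha), h'.inv a (hmS a ha)]
      · rw [h.inv_pow a (hmS a ha), h'.inv_pow a (hmS a ha)]
    · push Not at hall
      obtain ⟨b, hb, hba⟩ := hall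
      obtain ⟨m₁, rfl⟩ := Multiset.exists_cons_of_mem ha
      have hb' : b ∈ m₁ := (Multiset.mem_cons.1 hb).resolve_left hba
      obtain ⟨m₂, rfl⟩ := Multiset.exists_cons_of_mem hb'
      have hab : a - b ≠ 0 := sub_ne_zero.2 hba.symm
      have hS₁ : ∀ x ∈ a ::ₘ m₂, x ∈ S := fun x hx => hmS x (by
        rcases Multiset.mem_cons.1 hx with h | h
        · exact h ▸ ha
        · exact Multiset.mem_cons_of_mem (Multiset.mem_cons_of_mem h))
      have hS₂ : ∀ x ∈ b ::ₘ m₂, x ∈ S := fun x hx => hmS x (Multiset.mem_cons_of_mem hx)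
      have hsplit : Set.EqOn (fun z => ((a ::ₘ b ::ₘ m₂).map fun a => z - a).prod⁻¹)
          (fun z => (a - b)⁻¹ * ((a ::ₘ m₂).map fun a => z - a).prod⁻¹ +
            (-(a - b)⁻¹) * ((b ::ₘ m₂).map fun a => z - a).prod⁻¹) (U \ S) := by
        intro z hz
        have h1 := prod_sub_ne_zero hmS hz
        simp only [Multiset.map_cons, Multiset.prod_cons] at h1 ⊢
        obtain ⟨h2, h3, h4⟩ : z - a ≠ 0 ∧ z - b ≠ 0 ∧ (m₂.map fun a => z - a).prod ≠ 0 :=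
          ⟨left_ne_zero_of_mul h1, left_ne_zero_of_mul (right_ne_zero_of_mul h1),
            right_ne_zero_of_mul (right_ne_zero_of_mul h1)⟩
        field_simp
        ring
      have hc₁ : ContinuousOn (fun z => (a - b)⁻¹ * ((a ::ₘ m₂).map fun a => z - a).prod⁻¹) (U \ S) :=
        continuousOn_const.mul (continuousOn_inv_prod hS₁)
      have hc₂ : ContinuousOn (fun z => -(a - b)⁻¹ * ((b ::ₘ m₂).map fun a => z - a).prod⁻¹) (U \ S) :=
        continuousOn_const.mul (continuousOn_inv_prod hS₂)
      have hk₁ : (a ::ₘ m₂).card = k := by simpa using hm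
      have hk₂ : (b ::ₘ m₂).card = k := by simpa using hm
      rw [h.congr hsplit, h'.congr hsplit, h.add hc₁ hc₂, h'.add hc₁ hc₂, h.smul, h.smul, h'.smul,
        h'.smul, ih _ hk₁ hS₁, ih _ hk₂ hS₂]

/-- Sums of contour integrals around the same points agree on meromorphic functions. -/
lemma prod_inv_mul_eq (h : IsResidueSum Λ S U) (h' : IsResidueSum Λ' S U) (hU : IsOpen U)
    (hSU : ∀ a ∈ S, a ∈ U) (m : Multiset ℂ) (hm : ∀ a ∈ m, a ∈ S) {G : ℂ → ℂ}
    (hG : DifferentiableOn ℂ G U) :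
    Λ (fun z => (m.map fun a => z - a).prod⁻¹ * G z) =
      Λ' (fun z => (m.map fun a => z - a).prod⁻¹ * G z) := by
  induction m using Multiset.induction_on generalizing G with
  | empty =>
    simp only [Multiset.map_zero, Multiset.prod_zero, inv_one, one_mul]
    rw [h.eq_zero hG, h'.eq_zero hG]
  | cons a m ih =>
    have haS : a ∈ S := hm a (Multiset.mem_cons_self a m)
    have haU := hSU a haS
    have hd := (Complex.differentiableOn_dslope (hU.mem_nhds haU)).2 hG
    have hm' : ∀ x ∈ m, x ∈ S := fun x hx => hm x (Multiset.mem_cons_of_mem hx)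
    -- Writing `G z = G a + (z - a) * dslope G a z` peels off one pole: a pure product of inverses
    -- plus a term with one factor fewer and an analytic numerator.
    have hsplit : Set.EqOn (fun z => ((a ::ₘ m).map fun a => z - a).prod⁻¹ * G z)
        (fun z => G a * ((a ::ₘ m).map fun a => z - a).prod⁻¹ +
          (m.map fun a => z - a).prod⁻¹ * dslope G a z) (U \ S) := by
      intro z hz
      have h1 := prod_sub_ne_zero hm hz
      simp only [Multiset.map_cons, Multiset.prod_cons] at h1 ⊢
      obtain ⟨h2, h3⟩ : z - a ≠ 0 ∧ (m.map fun a => z - a).prod ≠ 0 :=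
        ⟨left_ne_zero_of_mul h1, right_ne_zero_of_mul h1⟩
      have h4 : G z = G a + (z - a) * dslope G a z := by
        have := sub_smul_dslope G a z
        rw [smul_eq_mul] at this
        rw [this]; ring
      rw [h4]
      field_simp
    have hc₁ : ContinuousOn (fun z => G a * ((a ::ₘ m).map fun a => z - a).prod⁻¹) (U \ S) :=
      continuousOn_const.mul (continuousOn_inv_prod hm)
    have hc₂ : ContinuousOn (fun z => (m.map fun a => z - a).prod⁻¹ * dslope G a z) (U \ S) :=
      (continuousOn_inv_prod hm').mul (hd.continuousOn.mono Set.sdiff_subset)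
    rw [h.congr hsplit, h'.congr hsplit, h.add hc₁ hc₂, h'.add hc₁ hc₂, h.smul, h'.smul,
      prod_inv_eq h h' _ _ rfl hm, ih hm' hd]

end IsResidueSum

lemma isResidueSum_cint {c d : SupportCurve} (h : ∀ t, c.p t < d.p t) {S : Finset ℂ}
    (hS : ∀ a ∈ S, a ∈ c.region) : IsResidueSum (fun F => c.cint F) S d.region := by
  have hmem : ∀ t, c.path t ∈ d.region \ S := fun t =>
    ⟨path_mem_region h t, fun hm => path_notMem_region (fun _ => le_rfl) t (hS _ hm)⟩
  refine ⟨fun hFG => cint_congr fun t => hFG (hmem t), fun hF hG => cint_add ?_ ?_,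
    fun a F => cint_smul a, fun hF => cint_eq_zero h hF, fun a ha => cint_inv (hS a ha),
    fun a ha k => ?_⟩
  · exact hF.comp_continuous c.continuous_path hmem
  · exact hG.comp_continuous c.continuous_path hmem
  · have hne := path_sub_ne_zero (hS a ha)
    have hd : ∀ t, HasDerivAt (fun t => -((k : ℂ) + 1)⁻¹ * ((c.path t - a) ^ (k + 1))⁻¹)
        (c.vel t • ((c.path t - a) ^ (k + 2))⁻¹) t := by
      intro t
      have h1 := ((((c.hasDerivAt_path t).sub_const a).fun_pow (k + 1)).fun_inv
        (pow_ne_zero _ (hne t))).const_mul (-((k : ℂ) + 1)⁻¹)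
      refine h1.congr_deriv ?_
      have := hne t
      have hk : (k : ℂ) + 1 ≠ 0 := Nat.cast_add_one_ne_zero k
      rw [smul_eq_mul]
      push_cast
      field_simp
      ring_nf
    have hc : Continuous fun t => ((c.path t - a) ^ (k + 2))⁻¹ :=
      ((c.continuous_path.sub continuous_const).pow _).inv₀ fun t => pow_ne_zero _ (hne t)
    rw [cint, intervalIntegral.integral_eq_sub_of_hasDerivAt (fun t _ => hd t)
      (intervalIntegrable_cint (F := fun z => ((z - a) ^ (k + 2))⁻¹) hc _ _)]
    have := c.path_periodic 0
    rw [zero_add] at this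
    simp [this]

lemma isResidueSum_circles {U : Set ℂ} {S : Finset ℂ} {r : ℝ} (hr : 0 < r)
    (hU : ∀ μ ∈ S, Metric.closedBall μ r ⊆ U)
    (hsep : ∀ μ ∈ S, ∀ ν ∈ S, ν ∈ Metric.closedBall μ r → ν = μ) :
    IsResidueSum (fun F => (2 * Real.pi * Complex.I)⁻¹ * ∑ μ ∈ S, ∮ z in C(μ, r), F z) S U := by
  have hpi : 2 * (Real.pi : ℂ) * Complex.I ≠ 0 := by simp [Real.pi_pos.ne']
  have hmem : ∀ μ ∈ S, Metric.sphere μ r ⊆ U \ S := fun μ hμ z hz =>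
    ⟨hU μ hμ (Metric.sphere_subset_closedBall hz), fun hzS => by
      have := hsep μ hμ z hzS (Metric.sphere_subset_closedBall hz)
      rw [this, Metric.mem_sphere, dist_self] at hz
      exact hr.ne hz⟩
  refine ⟨fun hFG => ?_, fun hF hG => ?_, fun a F => ?_, fun hF => ?_, fun a ha => ?_,
    fun a ha k => ?_⟩
  · congr 1
    exact Finset.sum_congr rfl fun μ hμ =>
      circleIntegral.integral_congr hr.le fun z hz => hFG (hmem μ hμ hz)
  · rw [← mul_add, ← Finset.sum_add_distrib]
    congr 1
    exact Finset.sum_congr rfl fun μ hμ => circleIntegral.integral_add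
      ((hF.mono (hmem μ hμ)).circleIntegrable hr.le) ((hG.mono (hmem μ hμ)).circleIntegrable hr.le)
  · simp only [← smul_eq_mul (a := a), circleIntegral.integral_smul]
    simp only [smul_eq_mul, ← Finset.mul_sum]
    ring
  · rw [Finset.sum_eq_zero, mul_zero]
    intro μ hμ
    exact Complex.circleIntegral_eq_zero_of_differentiable_on_off_countable hr.le
      Set.countable_empty (hF.continuousOn.mono (hU μ hμ)) fun z hz => hF.differentiableAt
        (mem_of_superset (Metric.isOpen_ball.mem_nhds hz.1)
          (Metric.ball_subset_closedBall.trans (hU μ hμ)))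
  · rw [Finset.sum_eq_single a, circleIntegral.integral_sub_center_inv a hr.ne',
      inv_mul_cancel₀ hpi]
    · intro μ hμ hμa
      have hne : ∀ z ∈ Metric.closedBall μ r, z - a ≠ 0 := fun z hz h0 =>
        hμa (hsep μ hμ a ha (sub_eq_zero.1 h0 ▸ hz)).symm
      have hd : ∀ z ∈ Metric.closedBall μ r, DifferentiableAt ℂ (fun z => (z - a)⁻¹) z :=
        fun z hz => (differentiableAt_id.sub_const a).inv (hne z hz)
      exact Complex.circleIntegral_eq_zero_of_differentiable_on_off_countable hr.le
        Set.countable_empty (fun z hz => (hd z hz).continuousAt.continuousWithinAt)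
        fun z hz => hd z (Metric.ball_subset_closedBall hz.1)
    · exact fun h => absurd ha h
  · rw [Finset.sum_eq_zero, mul_zero]
    intro μ hμ
    have := circleIntegral.integral_sub_zpow_of_ne (n := -((k + 2 : ℕ) : ℤ)) (by omega) μ a r
    simpa only [zpow_neg, zpow_natCast] using this

/-! ### The matrix function as an integral over one curve. -/

section matrix

open Matrix

variable {n : ℕ}

/-- The `(i, j)` entry, as a functional on operators. -/
noncomputable def entryCLM (i j : Fin n) :
    (EuclideanSpace ℂ (Fin n) →L[ℂ] EuclideanSpace ℂ (Fin n)) →L[ℂ] ℂ :=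
  LinearMap.toContinuousLinearMap
    { toFun := fun T => (toEuclideanCLM (𝕜 := ℂ) (n := Fin n)).symm T i j
      map_add' := fun S T => by simp
      map_smul' := fun a T => by simp }

lemma entryCLM_toEuclideanCLM (i j : Fin n) (A : Matrix (Fin n) (Fin n) ℂ) :
    entryCLM i j (toEuclideanCLM (𝕜 := ℂ) A) = A i j :=
  congrArg (fun B : Matrix (Fin n) (Fin n) ℂ => B i j)
    (StarAlgEquiv.symm_apply_apply (toEuclideanCLM (𝕜 := ℂ) (n := Fin n)) A)

lemma mem_resolventSet_toEuclideanCLM {ι : Type*} [Fintype ι] [DecidableEq ι] {A : Matrix ι ι ℂ}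
    {z : ℂ} :
    z ∈ resolventSet ℂ (toEuclideanCLM (𝕜 := ℂ) A) ↔ IsUnit (z • (1 : Matrix ι ι ℂ) - A) := by
  rw [spectrum.mem_resolventSet_iff, ← MulEquiv.isUnit_map
    (toEuclideanCLM (𝕜 := ℂ) (n := ι)).toMulEquiv]
  congr! 1
  rw [Algebra.algebraMap_eq_smul_one]
  change _ = toEuclideanCLM (𝕜 := ℂ) (z • (1 : Matrix ι ι ℂ) - A)
  rw [map_sub, map_smul, map_one]

lemma resolvent_toEuclideanCLM {ι : Type*} [Fintype ι] [DecidableEq ι] {A : Matrix ι ι ℂ} {z : ℂ}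
    (hz : z ∈ resolventSet ℂ (toEuclideanCLM (𝕜 := ℂ) A)) :
    resolvent (toEuclideanCLM (𝕜 := ℂ) A) z =
      toEuclideanCLM (𝕜 := ℂ) (z • (1 : Matrix ι ι ℂ) - A)⁻¹ := by
  have h1 := mem_resolventSet_toEuclideanCLM.1 hz
  have h2 := sub_mul_resolvent hz
  have h3 : toEuclideanCLM (𝕜 := ℂ) (z • (1 : Matrix ι ι ℂ) - A)⁻¹ *
      (algebraMap ℂ _ z - toEuclideanCLM (𝕜 := ℂ) A) = 1 := by
    rw [Algebra.algebraMap_eq_smul_one, ← map_one (toEuclideanCLM (𝕜 := ℂ) (n := ι)), ← map_smul,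
      ← map_sub, ← map_mul, nonsing_inv_mul _ ((isUnit_iff_isUnit_det _).1 h1), map_one]
  calc _ = toEuclideanCLM (𝕜 := ℂ) (z • (1 : Matrix ι ι ℂ) - A)⁻¹ *
        (algebraMap ℂ _ z - toEuclideanCLM (𝕜 := ℂ) A) * resolvent (toEuclideanCLM (𝕜 := ℂ) A) z := by
        rw [h3, one_mul]
    _ = _ := by rw [mul_assoc, h2, mul_one]

lemma det_smul_one_sub (A : Matrix (Fin n) (Fin n) ℂ) (z : ℂ) :
    (z • (1 : Matrix (Fin n) (Fin n) ℂ) - A).det = (A.charpoly.roots.map fun a => z - a).prod := by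
  have h1 := (IsAlgClosed.splits A.charpoly).eq_prod_roots_of_monic (charpoly_monic A)
  have h2 := Matrix.eval_charpoly A z
  rw [scalar_apply, ← smul_one_eq_diagonal] at h2
  rw [← h2]
  conv_lhs => rw [h1]
  rw [Polynomial.eval_multiset_prod, Multiset.map_map]
  simp

lemma mem_eigs_of_notMem_resolventSet {A : Matrix (Fin n) (Fin n) ℂ} {z : ℂ} :
    z ∈ eigs A ↔ z ∉ resolventSet ℂ (toEuclideanCLM (𝕜 := ℂ) A) := by
  rw [mem_resolventSet_toEuclideanCLM, isUnit_iff_isUnit_det, det_smul_one_sub, isUnit_iff_ne_zero,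
    not_not, Multiset.prod_eq_zero_iff, Multiset.mem_map, eigs, Multiset.mem_toFinset]
  constructor
  · exact fun h => ⟨z, h, sub_self z⟩
  · rintro ⟨a, ha, h⟩
    rwa [sub_eq_zero.1 h]

lemma differentiable_adjugate (A : Matrix (Fin n) (Fin n) ℂ) (i j : Fin n) :
    Differentiable ℂ fun z : ℂ => (z • (1 : Matrix (Fin n) (Fin n) ℂ) - A).adjugate i j := by
  have hdet : ∀ B : ℂ → Matrix (Fin n) (Fin n) ℂ, (∀ a b, Differentiable ℂ fun z => B z a b) →
      Differentiable ℂ fun z => (B z).det := by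
    intro B hB
    simp only [Matrix.det_apply]
    fun_prop
  simp only [Matrix.adjugate_apply]
  refine hdet _ fun a b => ?_
  by_cases h : a = j
  · subst h; simp
  · simp only [Matrix.updateRow_ne h, Matrix.sub_apply, Matrix.smul_apply]
    fun_prop

/-- The matrix function is given by the Cauchy integral over a curve around the numerical range. -/
theorem toEuclideanCLM_matrixFunction {c d : SupportCurve} (h : ∀ t, c.p t < d.p t) {f : ℂ → ℂ}
    (hf : AnalyticOnNhd ℂ f d.region) {A : Matrix (Fin n) (Fin n) ℂ} {ε : ℝ}
    (hA : Encloses c (toEuclideanCLM (𝕜 := ℂ) A) ε) (hε : 0 < ε) :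
    toEuclideanCLM (𝕜 := ℂ) (matrixFunction f A) =
      c.cint fun z => f z • resolvent (toEuclideanCLM (𝕜 := ℂ) A) z := by
  have hc := hA.path_mem_resolventSet hε
  have hS : ∀ a ∈ eigs A, a ∈ c.region := fun a ha => by
    by_contra hcon
    exact mem_eigs_of_notMem_resolventSet.1 ha (hA.mem_resolventSet hε hcon)
  have hSd : ∀ a ∈ eigs A, a ∈ d.region := fun a ha => region_subset (fun t => (h t).le) (hS a ha)
  -- The radius is small enough for the closed discs to stay in the domain and to miss all other
  -- eigenvalues.
  obtain ⟨r, hr, hrad⟩ : ∃ r : ℝ, 0 < r ∧ ∀ μ ∈ eigs A, Metric.closedBall μ r ⊆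
      d.region \ ((eigs A).erase μ) := by
    have h1 : ∀ᶠ r in 𝓝 (0 : ℝ), ∀ μ ∈ eigs A, Metric.closedBall μ r ⊆
        d.region \ ((eigs A).erase μ) := by
      rw [Filter.eventually_all_finset]
      intro μ hμ
      refine eventually_closedBall_subset (IsOpen.mem_nhds ?_ ⟨hSd μ hμ, by simp⟩)
      exact d.isOpen_region.sdiff (Finset.finite_toSet _).isClosed
    obtain ⟨r, hr, h2⟩ := ((h1.filter_mono nhdsWithin_le_nhds).and
      (self_mem_nhdsWithin (s := Set.Ioi (0 : ℝ)))).exists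
    exact ⟨r, h2, hr⟩
  have hball : ∀ μ ∈ eigs A, Metric.closedBall μ r ⊆ d.region := fun μ hμ =>
    (hrad μ hμ).trans Set.sdiff_subset
  have hsep : ∀ μ ∈ eigs A, ∀ ν ∈ eigs A, ν ∈ Metric.closedBall μ r → ν = μ := by
    intro μ hμ ν hν hb
    by_contra hne
    exact (hrad μ hμ hb).2 (by simp [hne, hν])
  have hfc : Continuous fun t => f (c.path t) :=
    hf.continuousOn.comp_continuous c.continuous_path (path_mem_region h)
  rw [matrixFunction_eq_cauchySum hf A hr hball hsep]
  suffices hmain : cauchySum f A r = (toEuclideanCLM (𝕜 := ℂ) (n := Fin n)).symm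
      (c.cint fun z => f z • resolvent (toEuclideanCLM (𝕜 := ℂ) A) z) by
    rw [hmain, StarAlgEquiv.apply_symm_apply]
  ext i j
  have h1 := clm_cint (c := c) (F := fun z => f z • resolvent (toEuclideanCLM (𝕜 := ℂ) A) z)
    (hfc.smul (continuous_resolvent hc)) (entryCLM i j)
  change _ = entryCLM i j _
  rw [h1]
  -- Cramer's rule exhibits the entry as an analytic numerator over the characteristic polynomial,
  -- the form required by `prod_inv_mul_eq`.
  have h2 : ∀ z, f z * (z • (1 : Matrix (Fin n) (Fin n) ℂ) - A)⁻¹ i j =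
      (A.charpoly.roots.map fun a => z - a).prod⁻¹ *
        (f z * (z • (1 : Matrix (Fin n) (Fin n) ℂ) - A).adjugate i j) := by
    intro z
    rw [Matrix.inv_def, Ring.inverse_eq_inv', Matrix.smul_apply, smul_eq_mul, det_smul_one_sub]
    ring
  have h3 : ∀ t, entryCLM i j (f (c.path t) • resolvent (toEuclideanCLM (𝕜 := ℂ) A) (c.path t)) =
      (A.charpoly.roots.map fun a => c.path t - a).prod⁻¹ * (f (c.path t) *
        (c.path t • (1 : Matrix (Fin n) (Fin n) ℂ) - A).adjugate i j) := by
    intro t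
    rw [← h2, map_smul, resolvent_toEuclideanCLM (hc t), smul_eq_mul, entryCLM_toEuclideanCLM]
  rw [cint_congr (G := fun z => (A.charpoly.roots.map fun a => z - a).prod⁻¹ *
    (f z * (z • (1 : Matrix (Fin n) (Fin n) ℂ) - A).adjugate i j)) h3]
  simp only [cauchySum, Matrix.of_apply, h2]
  exact (isResidueSum_circles hr hball hsep).prod_inv_mul_eq (isResidueSum_cint h hS)
    d.isOpen_region hSd _ (fun a ha => Multiset.mem_toFinset.2 ha)
    (hf.differentiableOn.mul (differentiable_adjugate A i j).differentiableOn)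

end matrix

end MatFun

/-! ### Divided differences of two commuting operators. -/

namespace MatFun

open scoped InnerProductSpace
open SupportCurve

section Hilbert

variable {H : Type*} [NormedAddCommGroup H] [InnerProductSpace ℂ H] [CompleteSpace H]
  {c d : SupportCurve} {A B : H →L[ℂ] H} {ε : ℝ}

omit [CompleteSpace H] in
lemma Encloses.add_of_norm_le (h : Encloses c A ε) {D : H →L[ℂ] H} {δ : ℝ} (hD : ‖D‖ ≤ δ) :
    Encloses c (A + D) (ε - δ) := by
  intro t x
  rw [add_apply, inner_add_right, mul_add, Complex.add_re]
  have h1 := h t x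
  have h2 : (expI (-t) * ⟪x, D x⟫_ℂ).re ≤ δ * ‖x‖ ^ 2 := by
    refine (re_expI_mul_le _ _).trans ((norm_inner_le_norm _ _).trans ?_)
    calc ‖x‖ * ‖D x‖ ≤ ‖x‖ * (δ * ‖x‖) := by
          gcongr; exact (D.le_opNorm x).trans (by gcongr)
      _ = _ := by ring
  linarith

/-- The derivative of the constant function vanishes. -/
lemma Encloses.cint_resolvent_mul_mul (h : Encloses c A ε) (hε : 0 < ε) {w : ℂ}
    (hw : w ∈ c.region) (X : H →L[ℂ] H) :
    c.cint (fun z => resolvent A z * X * resolvent A z) = 0 := by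
  obtain ⟨V, hV⟩ := c.exists_speed_le
  have hres := h.path_mem_resolventSet hε
  have hR := continuous_resolvent hres
  set Y := c.cint (fun z => resolvent A z * X * resolvent A z) with hY
  set C := V * ((ε / 2)⁻¹ ^ 3 * ‖X‖ ^ 2) with hC
  -- For `t ‖X‖ < ε / 2` the operator `A + t X` is still enclosed with margin `ε / 2`, and both
  -- resolvent integrals are the identity. The expansion therefore reads `t Y = O(t²)`.
  have key : ∀ᶠ t in 𝓝[>] (0 : ℝ), ‖Y‖ ≤ C * t := by
    have hlim : Tendsto (fun t : ℝ => t * ‖X‖) (𝓝[>] 0) (𝓝 0) := by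
      have : Tendsto (fun t : ℝ => t * ‖X‖) (𝓝 0) (𝓝 (0 * ‖X‖)) :=
        (continuous_id.mul continuous_const).tendsto 0
      rw [zero_mul] at this
      exact this.mono_left nhdsWithin_le_nhds
    filter_upwards [hlim.eventually (gt_mem_nhds (half_pos hε)), self_mem_nhdsWithin] with t ht ht0
    have ht0 : 0 < t := ht0
    have hn : ‖(t : ℂ) • X‖ = t * ‖X‖ := by
      rw [norm_smul, Complex.norm_real, Real.norm_eq_abs, abs_of_pos ht0]
    have h' := h.add_of_norm_le (hn.trans_le ht.le)
    rw [sub_half] at h'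
    have h1 := norm_cint_resolvent_sub_sub_le (f := fun _ => 1) hres
      (h'.path_mem_resolventSet (half_pos hε)) continuous_const (M := 1) (by simp)
      (fun t => (h.norm_resolvent_path_le hε t).trans
        (inv_anti₀ (half_pos hε) (half_le_self hε.le)))
      (h'.norm_resolvent_path_le (half_pos hε)) hV
    simp only [one_smul, add_sub_cancel_left] at h1
    rw [h.cint_resolvent hε hw, h'.cint_resolvent (half_pos hε) hw, hn] at h1
    have h2 : c.cint (fun z => resolvent A z * ((t : ℂ) • X) * resolvent A z) = (t : ℂ) • Y := by
      rw [hY, ← cint_smul]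
      simp
    rw [h2, sub_self, zero_sub, norm_neg, norm_smul, Complex.norm_real, Real.norm_eq_abs,
      abs_of_pos ht0] at h1
    refine le_of_mul_le_mul_left (h1.trans_eq ?_) ht0
    rw [hC]; ring
  have hlim : Tendsto (fun t : ℝ => C * t) (𝓝[>] 0) (𝓝 0) := by
    have : Tendsto (fun t : ℝ => C * t) (𝓝 0) (𝓝 (C * 0)) :=
      (continuous_const.mul continuous_id).tendsto 0
    rw [mul_zero] at this
    exact this.mono_left nhdsWithin_le_nhds
  exact norm_le_zero_iff.1 (ge_of_tendsto hlim key)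

lemma Encloses.norm_cint_le_mul (h : Encloses c A ε) (hε : 0 < ε) {w : ℂ} (hw : w ∈ c.region)
    {s : ℝ} (hs : 0 < s) {F : ℂ → H →L[ℂ] H} {m : ℝ} (hm : 0 < m)
    (hd : DifferentiableOn ℂ F (c.shift s hs.le).region)
    (hb : ∀ z ∈ (c.shift s hs.le).region, ‖F z‖ ≤ m)
    (hc : ∀ z ∈ (c.shift s hs.le).region, Commute (F z) A)
    (hc' : ∀ z ∈ (c.shift s hs.le).region, Commute (star (F z)) A) :
    ‖(c.shift (s / 2) (half_pos hs).le).cint (fun z => F z * resolvent A z)‖ ≤ (1 + √2) * m := by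
  have hF : IsContractive (c.shift s hs.le) A fun z => ((m⁻¹ : ℝ) : ℂ) • F z := by
    refine ⟨hd.fun_const_smul _, fun z hz => ?_, fun z hz => (hc z hz).smul_left _, fun z hz => ?_⟩
    · rw [norm_smul, Complex.norm_real, Real.norm_eq_abs, abs_of_pos (inv_pos.2 hm),
        inv_mul_le_iff₀ hm, mul_one]
      exact hb z hz
    · rw [star_smul]
      exact (hc' z hz).smul_left _
  have := hF.norm_cint_le h hε hw hs
  simp only [smul_mul_assoc, cint_smul] at this
  rw [norm_smul, Complex.norm_real, Real.norm_eq_abs, abs_of_pos (inv_pos.2 hm),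
    inv_mul_le_iff₀ hm] at this
  linarith

/-- The bivariate extension of the theorem of Crouzeix and Palencia, for the divided differences of
an analytic function. -/
theorem norm_cint_smul_resolvent_mul_resolvent_le (hA : Encloses c A ε) (hB : Encloses c B ε)
    (hε : 0 < ε) (hAB : Commute A B) (hAB' : Commute (star A) B) {w : ℂ} (hw : w ∈ c.region)
    {s : ℝ} (hs : 0 < s) {f : ℂ → ℂ} (hf : DifferentiableOn ℂ f (c.shift s hs.le).region)
    {m : ℝ} (hm : 0 < m) (hb : ∀ z ∈ (c.shift s hs.le).region, ‖deriv f z‖ ≤ m)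
    (h0 : (c.shift (s / 2 / 2) (half_pos (half_pos hs)).le).cint
      (fun z => resolvent B z * resolvent A z) = 0) :
    ‖(c.shift (s / 2 / 2) (half_pos (half_pos hs)).le).cint
      (fun z => f z • (resolvent B z * resolvent A z))‖ ≤ (1 + √2) ^ 2 * m := by
  set U := (c.shift s hs.le).region with hU
  set c₁ := c.shift (s / 2) (half_pos hs).le with hc₁
  set c₂ := c.shift (s / 2 / 2) (half_pos (half_pos hs)).le with hc₂
  have h1U : ∀ t, c₁.p t < (c.shift s hs.le).p t := fun t => by
    simp only [hc₁, shift_p]; linarith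
  have h21 : ∀ t, c₂.p t < c₁.p t := fun t => by
    simp only [hc₁, hc₂, shift_p]; linarith
  have hB₁ : Encloses c₁ B ε := hB.mono fun t => by simp only [hc₁, shift_p]; linarith
  have hB₂ : Encloses c₂ B ε := hB.mono fun t => by simp only [hc₂, shift_p]; linarith
  have hA₂ : Encloses c₂ A ε := hA.mono fun t => by simp only [hc₂, shift_p]; linarith
  have hw₁ : w ∈ c₁.region := region_subset (fun t => by simp only [hc₁, shift_p]; linarith) hw
  have hc₁U : c₁.region ⊆ U := region_subset fun t => (h1U t).le
  have hres₁ := hB₁.path_mem_resolventSet hε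
  have hRB₁ := continuous_resolvent hres₁
  have hRB₂ := continuous_resolvent (hB₂.path_mem_resolventSet hε)
  have hRA₂ := continuous_resolvent (hA₂.path_mem_resolventSet hε)
  have hfc₁ : Continuous fun t => f (c₁.path t) :=
    hf.continuousOn.comp_continuous c₁.continuous_path (path_mem_region h1U)
  have hfc₂ : Continuous fun t => f (c₂.path t) :=
    hf.continuousOn.comp_continuous c₂.continuous_path
      fun t => hc₁U (path_mem_region h21 t)
  have hds : ∀ x ∈ U, DifferentiableOn ℂ (dslope f x) U := fun x hx =>
    (Complex.differentiableOn_dslope ((isOpen_region _).mem_nhds hx)).2 hf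
  -- Convexity of the region enters here, through the mean value inequality.
  have hdsb : ∀ x ∈ U, ∀ y ∈ U, ‖dslope f x y‖ ≤ m := by
    intro x hx y hy
    rcases eq_or_ne y x with rfl | hne
    · rw [dslope_same]; exact hb y hy
    · rw [dslope_of_ne _ hne, slope_def_module, norm_smul, norm_inv,
        inv_mul_le_iff₀ (norm_pos_iff.2 (sub_ne_zero.2 hne)), mul_comm]
      exact (convex_region _).norm_image_sub_le_of_norm_deriv_le
        (fun z hz => hf.differentiableAt ((isOpen_region _).mem_nhds hz)) hb hx hy
  -- `G x` is `f[x, B]`. It inherits commutation with `A` and `star A` from `B`, as the operator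
  -- valued theorem demands.
  set G : ℂ → H →L[ℂ] H := fun x => c₁.cint fun y => (dslope f x y • 1) * resolvent B y with hG
  have hdsc : ∀ x ∈ U, Continuous fun t => dslope f x (c₁.path t) := fun x hx =>
    (hds x hx).continuousOn.comp_continuous c₁.continuous_path (path_mem_region h1U)
  have hGc : ∀ x ∈ U, Continuous fun t =>
      (dslope f x (c₁.path t) • (1 : H →L[ℂ] H)) * resolvent B (c₁.path t) := fun x hx =>
    ((hdsc x hx).smul continuous_const).mul hRB₁
  have hGb : ∀ x ∈ c₁.region, ‖G x‖ ≤ (1 + √2) * m := by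
    intro x hx
    have hx := hc₁U hx
    refine hB.norm_cint_le_mul hε hw hs hm ((hds x hx).smul_const _) (fun y hy => ?_)
      (fun y hy => (Commute.one_left _).smul_left _) (fun y hy => ?_)
    · rw [norm_smul]
      refine (mul_le_of_le_one_right (norm_nonneg _) ?_).trans (hdsb x hx y hy)
      exact ContinuousLinearMap.norm_id_le
    · rw [star_smul, star_one]
      exact (Commute.one_left _).smul_left _
  have hGA : ∀ x ∈ c₁.region, Commute (G x) A := fun x hx =>
    commute_cint (F := fun y => (dslope f x y • (1 : H →L[ℂ] H)) * resolvent B y)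
      (hGc x (hc₁U hx)) fun t => ((Commute.one_left _).smul_left _).mul_left
        (commute_resolvent hAB (hres₁ t)).symm
  have hGA' : ∀ x ∈ c₁.region, Commute (star (G x)) A := fun x hx => by
    have h1 : Commute (G x) (star A) :=
      commute_cint (F := fun y => (dslope f x y • (1 : H →L[ℂ] H)) * resolvent B y)
        (hGc x (hc₁U hx)) fun t => ((Commute.one_left _).smul_left _).mul_left
          (commute_resolvent hAB' (hres₁ t)).symm
    simpa using h1.star_star
  -- For `x` inside the curve the quotient is genuine at every curve point, so `G` is the Cauchy
  -- transform of `f • resolvent B` minus `f` times that of `resolvent B`.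
  have hGd : DifferentiableOn ℂ G c₁.region := by
    have h1 := differentiableOn_cauchyTransform (c := c₁) (F := fun y => f y • resolvent B y)
      (hfc₁.smul hRB₁)
    have h2 := (hf.mono hc₁U).smul
      (differentiableOn_cauchyTransform (c := c₁) (F := fun y => resolvent B y) hRB₁)
    refine (h1.sub h2).congr fun x hx => ?_
    have e1 := continuous_inv_smul (c := c₁) (F := fun y => f y • resolvent B y) (hfc₁.smul hRB₁) hx
    have e2 := continuous_inv_smul (c := c₁) (F := fun y => resolvent B y) hRB₁ hx
    have e3 : Continuous fun t => f x • (c₁.path t - x)⁻¹ • resolvent B (c₁.path t) :=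
      e2.const_smul (f x)
    simp only [Pi.sub_apply, Pi.smul_apply']
    rw [← cint_smul, ← cint_sub (F := fun y => (y - x)⁻¹ • f y • resolvent B y)
      (G := fun y => f x • (y - x)⁻¹ • resolvent B y) e1 e3]
    refine cint_congr fun t => ?_
    rw [dslope_of_ne _ (sub_ne_zero.1 (path_sub_ne_zero hx t)), slope_def_module, smul_mul_assoc,
      one_mul, smul_eq_mul, smul_smul, smul_smul, ← sub_smul]
    congr 1
    ring
  -- The second application starts from distance `s / 2`, where `G` is defined and bounded, and
  -- hence integrates over distance `s / 4`.
  have hfinal : ‖c₂.cint fun z => G z * resolvent A z‖ ≤ (1 + √2) * ((1 + √2) * m) :=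
    hA.norm_cint_le_mul hε hw (half_pos hs) (by positivity) hGd hGb hGA hGA'
  set fB := c₁.cint fun y => f y • resolvent B y with hfB
  -- This is `(x - B) f[x, B] = f(x) - f(B)`, from `x - B = (x - y) + (y - B)`. The second summand
  -- cancels the resolvent and leaves the integral of an analytic function of `y`, which is zero.
  have hGx : ∀ x ∈ c₁.region, (algebraMap ℂ _ x - B) * G x = f x • 1 - fB := by
    intro x hx
    have hz : c₁.cint (fun y => dslope f x y • (1 : H →L[ℂ] H)) = 0 :=
      cint_eq_zero h1U ((hds x (hc₁U hx)).smul_const _)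
    have e1 : Continuous fun t => f x • resolvent B (c₁.path t) := hRB₁.const_smul (f x)
    have e2 : Continuous fun t => f (c₁.path t) • resolvent B (c₁.path t) := hfc₁.smul hRB₁
    have e3 : Continuous fun t => dslope f x (c₁.path t) • (1 : H →L[ℂ] H) :=
      (hdsc x (hc₁U hx)).smul continuous_const
    have e4 : c₁.cint (fun y => f x • resolvent B y) = f x • 1 := by
      rw [cint_smul, hB₁.cint_resolvent hε hw₁]
    rw [hG]
    simp only
    rw [mul_cint (hGc x (hc₁U hx)), ← e4, hfB, ← cint_sub e1 e2,
      ← add_zero (c₁.cint fun y => f x • resolvent B y - f y • resolvent B y), ← hz,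
      ← cint_add (e1.sub e2) e3]
    refine cint_congr fun t => ?_
    set y := c₁.path t
    have e5 : algebraMap ℂ (H →L[ℂ] H) x - B = (x - y) • 1 + (algebraMap ℂ (H →L[ℂ] H) y - B) := by
      rw [sub_smul, Algebra.algebraMap_eq_smul_one, Algebra.algebraMap_eq_smul_one]; abel
    have e6 := sub_smul_dslope f x y
    rw [smul_eq_mul] at e6
    rw [smul_mul_assoc, one_mul, mul_smul_comm, e5, add_mul, sub_mul_resolvent (hres₁ t),
      smul_mul_assoc, one_mul, smul_add, smul_smul, ← sub_smul]
    congr 2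
    linear_combination -e6
  have hfBc : ∀ t, Commute fB (resolvent B (c₂.path t)) := fun t =>
    commute_resolvent (commute_cint (F := fun y => f y • resolvent B y) (hfc₁.smul hRB₁)
      fun s => (commute_resolvent (Commute.refl B) (hres₁ s)).symm.smul_left _)
      (hB₂.path_mem_resolventSet hε t)
  have hGx' : ∀ t, G (c₂.path t) * resolvent A (c₂.path t) =
      f (c₂.path t) • (resolvent B (c₂.path t) * resolvent A (c₂.path t)) -
        fB * (resolvent B (c₂.path t) * resolvent A (c₂.path t)) := by
    intro t
    have h1 := congrArg (fun T => resolvent B (c₂.path t) * T)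
      (hGx _ (path_mem_region h21 t))
    simp only [← mul_assoc, resolvent_mul_sub (hB₂.path_mem_resolventSet hε t), one_mul,
      mul_sub, mul_smul_comm, mul_one] at h1
    rw [h1, ← (hfBc t).eq, sub_mul, smul_mul_assoc, mul_assoc]
  have hRR : Continuous fun t => resolvent B (c₂.path t) * resolvent A (c₂.path t) := hRB₂.mul hRA₂
  have hfRR : Continuous fun t => f (c₂.path t) • (resolvent B (c₂.path t) * resolvent A (c₂.path t)) :=
    hfc₂.smul hRR
  have hBRR : Continuous fun t => fB * (resolvent B (c₂.path t) * resolvent A (c₂.path t)) :=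
    continuous_const.mul hRR
  -- The constant factor `f(B)` leaves the integral, and `h0` kills what remains.
  rw [cint_congr (G := fun z => f z • (resolvent B z * resolvent A z) -
    fB * (resolvent B z * resolvent A z)) hGx',
    cint_sub (F := fun z => f z • (resolvent B z * resolvent A z)) hfRR hBRR,
    ← mul_cint hRR, h0, mul_zero, sub_zero] at hfinal
  exact hfinal.trans_eq (by ring)

end Hilbert

/-! ### The derivative as a contour integral, and its uniqueness. -/

section frechet

open Matrix

variable {n : ℕ} {c d : SupportCurve} {ε : ℝ} {f : ℂ → ℂ} {A : Matrix (Fin n) (Fin n) ℂ}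

lemma exists_frechet (hA : Encloses c (toEuclideanCLM (𝕜 := ℂ) A) ε) (hε : 0 < ε)
    (hf : Continuous fun t => f (c.path t)) :
    ∃ L : Matrix (Fin n) (Fin n) ℂ →ₗ[ℂ] Matrix (Fin n) (Fin n) ℂ,
      ∀ X, toEuclideanCLM (𝕜 := ℂ) (L X) = c.cint fun z =>
        f z • (resolvent (toEuclideanCLM (𝕜 := ℂ) A) z * toEuclideanCLM (𝕜 := ℂ) X *
          resolvent (toEuclideanCLM (𝕜 := ℂ) A) z) := by
  have hR := continuous_resolvent (hA.path_mem_resolventSet hε)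
  have hc : ∀ X : Matrix (Fin n) (Fin n) ℂ, Continuous fun t => f (c.path t) •
      (resolvent (toEuclideanCLM (𝕜 := ℂ) A) (c.path t) * toEuclideanCLM (𝕜 := ℂ) X *
          resolvent (toEuclideanCLM (𝕜 := ℂ) A) (c.path t)) := fun X =>
    hf.smul ((hR.mul continuous_const).mul hR)
  refine ⟨⟨⟨fun X => (toEuclideanCLM (𝕜 := ℂ) (n := Fin n)).symm (c.cint fun z =>
        f z • (resolvent (toEuclideanCLM (𝕜 := ℂ) A) z * toEuclideanCLM (𝕜 := ℂ) X *
          resolvent (toEuclideanCLM (𝕜 := ℂ) A) z)), fun X Y => ?_⟩, fun a X => ?_⟩, fun X => ?_⟩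
  · rw [← map_add, ← cint_add (hc X) (hc Y)]
    simp only [map_add, mul_add, add_mul, smul_add]
  · simp only [RingHom.id_apply]
    rw [← map_smul, ← cint_smul]
    simp only [map_smul, mul_smul_comm, smul_mul_assoc, smul_comm a]
  · exact StarAlgEquiv.apply_symm_apply _ _

lemma eventually_spectralNorm_lt {δ : ℝ} (hδ : 0 < δ) :
    ∀ᶠ X : Matrix (Fin n) (Fin n) ℂ in 𝓝 0, ‖toEuclideanCLM (𝕜 := ℂ) X‖ < δ := by
  have h1 : Continuous fun X : Matrix (Fin n) (Fin n) ℂ => toEuclideanCLM (𝕜 := ℂ) X :=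
    LinearMap.continuous_of_finiteDimensional
      (toEuclideanCLM (𝕜 := ℂ) (n := Fin n)).toAlgEquiv.toLinearMap
  have h2 := h1.norm.tendsto 0
  simp only [map_zero, norm_zero] at h2
  exact h2.eventually (gt_mem_nhds hδ)

lemma isFrechetDerivative_of_eq_cint (h : ∀ t, c.p t < d.p t) (hf : AnalyticOnNhd ℂ f d.region)
    (hA : Encloses c (toEuclideanCLM (𝕜 := ℂ) A) ε) (hε : 0 < ε)
    {L : Matrix (Fin n) (Fin n) ℂ →ₗ[ℂ] Matrix (Fin n) (Fin n) ℂ}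
    (hL : ∀ X, toEuclideanCLM (𝕜 := ℂ) (L X) = c.cint fun z =>
        f z • (resolvent (toEuclideanCLM (𝕜 := ℂ) A) z * toEuclideanCLM (𝕜 := ℂ) X *
          resolvent (toEuclideanCLM (𝕜 := ℂ) A) z)) : IsFrechetDerivative f A L := by
  obtain ⟨V, hV⟩ := c.exists_speed_le
  obtain ⟨M, hM⟩ := (isCompact_closedSupportRegion c.p).exists_bound_of_continuousOn
    (hf.continuousOn.mono (closedSupportRegion_subset_region h))
  have hfc : Continuous fun t => f (c.path t) :=
    hf.continuousOn.comp_continuous c.continuous_path (path_mem_region h)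
  refine Asymptotics.IsBigO.of_bound (V * (M * (ε / 2)⁻¹ ^ 3)) ?_
  filter_upwards [eventually_spectralNorm_lt (half_pos hε)] with X hX
  have h' := hA.add_of_norm_le hX.le
  rw [sub_half, ← map_add] at h'
  have h1 := norm_cint_resolvent_sub_sub_le (hA.path_mem_resolventSet hε)
      (h'.path_mem_resolventSet (half_pos hε)) hfc
      (fun t => hM _ (c.path_mem_closedSupportRegion t))
      (fun t => (hA.norm_resolvent_path_le hε t).trans
        (inv_anti₀ (half_pos hε) (half_le_self hε.le)))
      (h'.norm_resolvent_path_le (half_pos hε)) hV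
  have h2 : toEuclideanCLM (𝕜 := ℂ) (A + X) - toEuclideanCLM (𝕜 := ℂ) A =
      toEuclideanCLM (𝕜 := ℂ) X := by rw [map_add, add_sub_cancel_left]
  rw [h2, ← hL, ← toEuclideanCLM_matrixFunction h hf hA hε,
    ← toEuclideanCLM_matrixFunction h hf h' (half_pos hε), ← map_sub, ← map_sub] at h1
  rw [Real.norm_eq_abs, Real.norm_eq_abs, spectralNorm, spectralNorm, abs_of_nonneg (norm_nonneg _),
    abs_of_nonneg (by positivity)]
  refine h1.trans_eq (by ring)

/-- On the ray `t X` both derivatives approximate the same increment up to `O(t²)`, while their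
difference is homogeneous of degree one in `t`. -/
lemma IsFrechetDerivative.eq {L L' : Matrix (Fin n) (Fin n) ℂ →ₗ[ℂ] Matrix (Fin n) (Fin n) ℂ}
    (h : IsFrechetDerivative f A L) (h' : IsFrechetDerivative f A L') : L = L' := by
  obtain ⟨C, hC⟩ := Asymptotics.IsBigO.bound h
  obtain ⟨C', hC'⟩ := Asymptotics.IsBigO.bound h'
  refine LinearMap.ext fun X => ?_
  set Φ := toEuclideanCLM (𝕜 := ℂ) (n := Fin n)
  have hlim : Tendsto (fun t : ℝ => (t : ℂ) • X) (𝓝[>] 0) (𝓝 0) := by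
    have : Continuous fun t : ℝ => (t : ℂ) • X := by fun_prop
    have h1 := this.tendsto 0
    simp only [Complex.ofReal_zero, zero_smul] at h1
    exact h1.mono_left nhdsWithin_le_nhds
  have key : ∀ᶠ t in 𝓝[>] (0 : ℝ), ‖Φ (L X - L' X)‖ ≤ (C + C') * ‖Φ X‖ ^ 2 * t := by
    filter_upwards [hlim.eventually hC, hlim.eventually hC', self_mem_nhdsWithin] with t h1 h2 ht
    have ht : 0 < t := ht
    simp only [spectralNorm, Real.norm_eq_abs, abs_norm, abs_pow] at h1 h2
    have e1 : ‖Φ ((t : ℂ) • X)‖ = t * ‖Φ X‖ := by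
      rw [map_smul, norm_smul, Complex.norm_real, Real.norm_eq_abs, abs_of_pos ht]
    have e2 : (t : ℂ) • Φ (L X - L' X) =
        Φ (matrixFunction f (A + (t : ℂ) • X) - matrixFunction f A - L' ((t : ℂ) • X)) -
        Φ (matrixFunction f (A + (t : ℂ) • X) - matrixFunction f A - L ((t : ℂ) • X)) := by
      rw [← map_sub, ← map_smul]
      congr 1
      rw [map_smul, map_smul, smul_sub]
      abel
    have e3 : t * ‖Φ (L X - L' X)‖ ≤ C' * (t * ‖Φ X‖) ^ 2 + C * (t * ‖Φ X‖) ^ 2 := by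
      rw [← e1]
      calc t * ‖Φ (L X - L' X)‖ = ‖(t : ℂ) • Φ (L X - L' X)‖ := by
            rw [norm_smul, Complex.norm_real, Real.norm_eq_abs, abs_of_pos ht]
        _ ≤ _ := by rw [e2]; exact (norm_sub_le _ _).trans (add_le_add h2 h1)
    refine le_of_mul_le_mul_left (e3.trans_eq ?_) ht
    ring
  have hlim' : Tendsto (fun t : ℝ => (C + C') * ‖Φ X‖ ^ 2 * t) (𝓝[>] 0) (𝓝 0) := by
    have : Tendsto (fun t : ℝ => (C + C') * ‖Φ X‖ ^ 2 * t) (𝓝 0) (𝓝 ((C + C') * ‖Φ X‖ ^ 2 * 0)) :=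
      (continuous_const.mul continuous_id).tendsto 0
    rw [mul_zero] at this
    exact this.mono_left nhdsWithin_le_nhds
  have h0 := norm_le_zero_iff.1 (ge_of_tendsto hlim' key)
  exact sub_eq_zero.1 (Φ.injective (h0.trans (map_zero Φ).symm))

end frechet

end MatFun

/-! ### Vectorization: left and right multiplication as commuting operators. -/

namespace MatFun

open scoped InnerProductSpace Kronecker
open SupportCurve Matrix

variable {n : ℕ} {c : SupportCurve} {ε : ℝ} {f : ℂ → ℂ} {A X : Matrix (Fin n) (Fin n) ℂ}

/-- The multiplication by `A` from the left, on vectorized matrices. -/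
noncomputable def leftMul (A : Matrix (Fin n) (Fin n) ℂ) :
    EuclideanSpace ℂ (Fin n × Fin n) →L[ℂ] EuclideanSpace ℂ (Fin n × Fin n) :=
  toEuclideanCLM (𝕜 := ℂ) ((1 : Matrix (Fin n) (Fin n) ℂ) ⊗ₖ A)

/-- The multiplication by `A` from the right, on vectorized matrices. -/
noncomputable def rightMul (A : Matrix (Fin n) (Fin n) ℂ) :
    EuclideanSpace ℂ (Fin n × Fin n) →L[ℂ] EuclideanSpace ℂ (Fin n × Fin n) :=
  toEuclideanCLM (𝕜 := ℂ) (Aᵀ ⊗ₖ (1 : Matrix (Fin n) (Fin n) ℂ))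

/-- The vectorization of a matrix, as a vector of the Euclidean space. -/
noncomputable def vecE (X : Matrix (Fin n) (Fin n) ℂ) : EuclideanSpace ℂ (Fin n × Fin n) :=
  WithLp.toLp 2 (vec X)

lemma exists_vecE_eq (x : EuclideanSpace ℂ (Fin n × Fin n)) : ∃ X, vecE X = x := by
  obtain ⟨X, hX⟩ := vec_bijective.2 x.ofLp
  exact ⟨X, by rw [vecE, hX]⟩

lemma leftMul_vecE : leftMul A (vecE X) = vecE (A * X) := by
  rw [leftMul, vecE, toEuclideanCLM_toLp, kronecker_mulVec_vec, transpose_one, mul_one, vecE]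

lemma rightMul_vecE : rightMul A (vecE X) = vecE (X * A) := by
  rw [rightMul, vecE, toEuclideanCLM_toLp, kronecker_mulVec_vec, transpose_transpose, one_mul, vecE]

lemma norm_vecE (X : Matrix (Fin n) (Fin n) ℂ) : ‖vecE X‖ = frobeniusNorm X := by
  rw [vecE, EuclideanSpace.norm_eq, frobeniusNorm, Fintype.sum_prod_type, Finset.sum_comm]
  rfl

lemma Encloses.re_dotProduct_le (hA : Encloses c (toEuclideanCLM (𝕜 := ℂ) A) ε) (t : ℝ)
    (v : Fin n → ℂ) :
    (expI (-t) * (star v ⬝ᵥ A *ᵥ v)).re ≤ (c.p t - ε) * ∑ i, ‖v i‖ ^ 2 := by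
  have := hA t (WithLp.toLp 2 v)
  rw [EuclideanSpace.norm_sq_eq, toEuclideanCLM_toLp, EuclideanSpace.inner_toLp_toLp,
    dotProduct_comm] at this
  exact this

/-- The Frobenius inner product of `X` with `A X` is the sum of the quadratic forms of `A` at the
columns of `X`. -/
lemma Encloses.leftMul (hA : Encloses c (toEuclideanCLM (𝕜 := ℂ) A) ε) :
    Encloses c (leftMul A) ε := by
  intro t x
  obtain ⟨X, rfl⟩ := exists_vecE_eq x
  have h1 : ⟪vecE X, MatFun.leftMul A (vecE X)⟫_ℂ =
      ∑ j, star (fun i => X i j) ⬝ᵥ A *ᵥ fun i => X i j := by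
    rw [leftMul_vecE, vecE, vecE, EuclideanSpace.inner_toLp_toLp, dotProduct_comm,
      star_vec_dotProduct_vec]
    simp [trace, mul_apply, dotProduct, mulVec]
  have h2 : ‖vecE X‖ ^ 2 = ∑ j, ∑ i, ‖X i j‖ ^ 2 := by
    rw [norm_vecE, frobeniusNorm, Real.sq_sqrt (by positivity), Finset.sum_comm]
  rw [h1, h2, Finset.mul_sum, Finset.mul_sum, Complex.re_sum]
  exact Finset.sum_le_sum fun j _ => hA.re_dotProduct_le t _

/-- Here the vectors are the conjugated rows of `X`; the conjugation makes the form that of `A` and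
not that of its transpose. -/
lemma Encloses.rightMul (hA : Encloses c (toEuclideanCLM (𝕜 := ℂ) A) ε) :
    Encloses c (rightMul A) ε := by
  intro t x
  obtain ⟨X, rfl⟩ := exists_vecE_eq x
  have h1 : ⟪vecE X, MatFun.rightMul A (vecE X)⟫_ℂ =
      ∑ i, star (fun j => star (X i j)) ⬝ᵥ A *ᵥ fun j => star (X i j) := by
    rw [rightMul_vecE, vecE, vecE, EuclideanSpace.inner_toLp_toLp, dotProduct_comm,
      star_vec_dotProduct_vec, trace_mul_comm]
    simp only [trace, diag_apply, mul_apply, conjTranspose_apply, dotProduct, mulVec,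
      Finset.sum_mul, Finset.mul_sum, Pi.star_apply, star_star]
    refine Finset.sum_congr rfl fun i _ => ?_
    rw [Finset.sum_comm]
    exact Finset.sum_congr rfl fun j _ => Finset.sum_congr rfl fun k _ => by ring
  have h2 : ‖vecE X‖ ^ 2 = ∑ i, ∑ j, ‖star (X i j)‖ ^ 2 := by
    rw [norm_vecE, frobeniusNorm, Real.sq_sqrt (by positivity)]
    simp
  rw [h1, h2, Finset.mul_sum, Finset.mul_sum, Complex.re_sum]
  exact Finset.sum_le_sum fun j _ => hA.re_dotProduct_le t _

lemma commute_leftMul_rightMul (A B : Matrix (Fin n) (Fin n) ℂ) :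
    Commute (leftMul A) (rightMul B) := by
  rw [Commute, SemiconjBy, leftMul, rightMul, ← map_mul, ← map_mul, ← mul_kronecker_mul,
    ← mul_kronecker_mul]
  simp

/-- The adjoint is again a left multiplication, so it commutes with every right multiplication. -/
lemma star_leftMul (A : Matrix (Fin n) (Fin n) ℂ) : star (leftMul A) = leftMul Aᴴ := by
  rw [leftMul, leftMul, ← map_star, star_eq_conjTranspose, conjTranspose_kronecker,
    conjTranspose_one]

lemma resolvent_leftMul {z : ℂ} (h : z ∈ resolventSet ℂ (leftMul A)) :
    resolvent (leftMul A) z = leftMul (z • (1 : Matrix (Fin n) (Fin n) ℂ) - A)⁻¹ := by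
  rw [leftMul, resolvent_toEuclideanCLM h, leftMul]
  congr 1
  conv_rhs => rw [← inv_one, ← inv_kronecker]
  congr 1
  ext ⟨a, b⟩ ⟨a', b'⟩
  simp [one_apply, kroneckerMap_apply]
  by_cases h1 : a = a' <;> by_cases h2 : b = b' <;> simp [h1, h2]

lemma resolvent_rightMul {z : ℂ} (h : z ∈ resolventSet ℂ (rightMul A)) :
    resolvent (rightMul A) z = rightMul (z • (1 : Matrix (Fin n) (Fin n) ℂ) - A)⁻¹ := by
  rw [rightMul, resolvent_toEuclideanCLM h, rightMul, transpose_nonsing_inv]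
  congr 1
  conv_rhs => rw [← inv_one, ← inv_kronecker]
  congr 1
  ext ⟨a, b⟩ ⟨a', b'⟩
  simp [one_apply, kroneckerMap_apply]
  by_cases h1 : a = a' <;> by_cases h2 : b = b' <;> simp [h1, h2]

/-- The vectorization, as a linear map on operators. -/
noncomputable def vecCLM (n : ℕ) :
    (EuclideanSpace ℂ (Fin n) →L[ℂ] EuclideanSpace ℂ (Fin n)) →L[ℂ]
      EuclideanSpace ℂ (Fin n × Fin n) :=
  LinearMap.toContinuousLinearMap
    { toFun := fun T => vecE ((toEuclideanCLM (𝕜 := ℂ) (n := Fin n)).symm T)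
      map_add' := fun S T => by rw [map_add, vecE, vec_add]; rfl
      map_smul' := fun a T => by rw [map_smul, vecE, vec_smul]; rfl }

lemma vecCLM_toEuclideanCLM (X : Matrix (Fin n) (Fin n) ℂ) :
    vecCLM n (toEuclideanCLM (𝕜 := ℂ) X) = vecE X :=
  congrArg vecE (StarAlgEquiv.symm_apply_apply (toEuclideanCLM (𝕜 := ℂ) (n := Fin n)) X)

-- The map `X ↦ R X R` becomes a product of one left and one right resolvent. It is used twice: with
-- `f` for the derivative, and with the constant 1 for the vanishing hypothesis of the bivariate
-- estimate.
set_option maxHeartbeats 1000000 in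
lemma vecCLM_cint (hA : Encloses c (toEuclideanCLM (𝕜 := ℂ) A) ε) (hε : 0 < ε)
    (hf : Continuous fun t => f (c.path t)) (X : Matrix (Fin n) (Fin n) ℂ) :
    vecCLM n (c.cint fun z => f z • (resolvent (toEuclideanCLM (𝕜 := ℂ) A) z *
      toEuclideanCLM (𝕜 := ℂ) X * resolvent (toEuclideanCLM (𝕜 := ℂ) A) z)) =
    (c.cint fun z => f z • (resolvent (rightMul A) z * resolvent (leftMul A) z)) (vecE X) := by
  have hres := hA.path_mem_resolventSet hε
  have hl := hA.leftMul.path_mem_resolventSet hε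
  have hr := hA.rightMul.path_mem_resolventSet hε
  have hR := continuous_resolvent hres
  have c1 : Continuous fun t => f (c.path t) • (resolvent (toEuclideanCLM (𝕜 := ℂ) A) (c.path t) *
      toEuclideanCLM (𝕜 := ℂ) X * resolvent (toEuclideanCLM (𝕜 := ℂ) A) (c.path t)) :=
    hf.smul ((hR.mul continuous_const).mul hR)
  have c2 : Continuous fun t => f (c.path t) •
      (resolvent (rightMul A) (c.path t) * resolvent (leftMul A) (c.path t)) :=
    hf.smul ((continuous_resolvent hr).mul (continuous_resolvent hl))
  have h2 := clm_cint (c := c) (F := fun z => f z • (resolvent (rightMul A) z *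
    resolvent (leftMul A) z)) c2 (ContinuousLinearMap.apply ℂ _ (vecE X))
  rw [ContinuousLinearMap.apply_apply] at h2
  rw [clm_cint (F := fun z => f z • (resolvent (toEuclideanCLM (𝕜 := ℂ) A) z *
      toEuclideanCLM (𝕜 := ℂ) X * resolvent (toEuclideanCLM (𝕜 := ℂ) A) z)) c1, h2]
  refine cint_congr fun t => ?_
  rw [ContinuousLinearMap.apply_apply, map_smul, _root_.smul_apply, resolvent_toEuclideanCLM (hres t),
    ← map_mul, ← map_mul, vecCLM_toEuclideanCLM, resolvent_leftMul (hl t),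
    resolvent_rightMul (hr t)]
  rw [mul_apply_eq_comp, leftMul_vecE, rightMul_vecE]

/-- The bound for the Fréchet derivative, for a curve around the numerical range. -/
theorem frobeniusNorm_frechet_le (hA : Encloses c (toEuclideanCLM (𝕜 := ℂ) A) ε) (hε : 0 < ε)
    {w : ℂ} (hw : w ∈ c.region) {s : ℝ} (hs : 0 < s)
    (hf : DifferentiableOn ℂ f (c.shift s hs.le).region) {m : ℝ} (hm : 0 < m)
    (hb : ∀ z ∈ (c.shift s hs.le).region, ‖deriv f z‖ ≤ m)
    {L : Matrix (Fin n) (Fin n) ℂ →ₗ[ℂ] Matrix (Fin n) (Fin n) ℂ}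
    (hL : ∀ X, toEuclideanCLM (𝕜 := ℂ) (L X) =
      (c.shift (s / 2 / 2) (half_pos (half_pos hs)).le).cint fun z =>
        f z • (resolvent (toEuclideanCLM (𝕜 := ℂ) A) z * toEuclideanCLM (𝕜 := ℂ) X *
          resolvent (toEuclideanCLM (𝕜 := ℂ) A) z)) (X : Matrix (Fin n) (Fin n) ℂ) :
    frobeniusNorm (L X) ≤ (1 + √2) ^ 2 * m * frobeniusNorm X := by
  set c₂ := c.shift (s / 2 / 2) (half_pos (half_pos hs)).le with hc₂
  have hA₂ : Encloses c₂ (toEuclideanCLM (𝕜 := ℂ) A) ε :=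
    hA.mono fun t => by simp only [hc₂, shift_p]; linarith
  have hw₂ : w ∈ c₂.region := region_subset (fun t => by simp only [hc₂, shift_p]; linarith) hw
  have hfc : Continuous fun t => f (c₂.path t) :=
    hf.continuousOn.comp_continuous c₂.continuous_path
      (path_mem_region fun t => by simp only [hc₂, shift_p]; linarith)
  have h0 : c₂.cint (fun z => resolvent (rightMul A) z * resolvent (leftMul A) z) = 0 := by
    refine ContinuousLinearMap.ext fun x => ?_
    obtain ⟨Y, rfl⟩ := exists_vecE_eq x
    have h1 := vecCLM_cint (f := fun _ => 1) hA₂ hε continuous_const Y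
    simp only [one_smul] at h1
    rw [← h1, hA₂.cint_resolvent_mul_mul hε hw₂, map_zero, _root_.zero_apply]
  have hmain := norm_cint_smul_resolvent_mul_resolvent_le hA.leftMul hA.rightMul hε
    (commute_leftMul_rightMul A A) (by rw [star_leftMul]; exact commute_leftMul_rightMul _ _)
    hw hs hf hm hb h0
  have h1 := vecCLM_cint hA₂ hε hfc X
  rw [← hL, vecCLM_toEuclideanCLM] at h1
  rw [← norm_vecE, ← norm_vecE, h1]
  exact (ContinuousLinearMap.le_opNorm _ _).trans
    (mul_le_mul_of_nonneg_right hmain (norm_nonneg _))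

end MatFun

/-! ### The numerical range is compact and convex. -/

namespace MatFun

open scoped InnerProductSpace
open SupportCurve Matrix

section numericalRange

variable {H : Type*} [NormedAddCommGroup H] [InnerProductSpace ℂ H]

/-- After a change of the phase of `x` the cross terms have a real sum. The Rayleigh quotient is
then real and continuous along the segment from `x'` to `y`, and the intermediate value theorem
applies. -/
lemma exists_inner_eq_of_inner_eq_zero_one (S : H →L[ℂ] H) {x y : H} (hx : ‖x‖ = 1)
    (hy : ‖y‖ = 1) (hx0 : ⟪x, S x⟫_ℂ = 0) (hy1 : ⟪y, S y⟫_ℂ = 1) {s : ℝ} (hs : s ∈ Set.Icc (0 : ℝ) 1) :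
    ∃ z : H, ‖z‖ = 1 ∧ ⟪z, S z⟫_ℂ = s := by
  -- The imaginary part of the sum of cross terms is that of `l` times this number, and `l` is the
  -- unit factor that makes the product real.
  obtain ⟨l, hl, hl'⟩ := RCLike.exists_norm_eq_mul_self (⟪y, S x⟫_ℂ - star ⟪x, S y⟫_ℂ)
  set x' := l • x with hx'
  have hx'0 : ⟪x', S x'⟫_ℂ = 0 := by
    rw [hx', map_smul, inner_smul_left, inner_smul_right, hx0, mul_zero, mul_zero]
  have hx'1 : x' ≠ 0 := by
    rw [← norm_ne_zero_iff, hx', norm_smul, hl, hx]; simp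
  have him : (⟪x', S y⟫_ℂ + ⟪y, S x'⟫_ℂ).im = 0 := by
    rw [hx', map_smul, inner_smul_left, inner_smul_right]
    have h := congrArg Complex.im hl'
    generalize ⟪x, S y⟫_ℂ = β at h ⊢
    generalize ⟪y, S x⟫_ℂ = γ at h ⊢
    simp at h ⊢
    linarith
  set z : ℝ → H := fun t => ((1 - t : ℝ) : ℂ) • x' + (t : ℂ) • y with hz
  have hzS : ∀ t, ⟪z t, S (z t)⟫_ℂ =
      ((t ^ 2 + t * (1 - t) * (⟪x', S y⟫_ℂ + ⟪y, S x'⟫_ℂ).re : ℝ) : ℂ) := by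
    intro t
    have h1 : ((⟪x', S y⟫_ℂ + ⟪y, S x'⟫_ℂ).re : ℂ) = ⟪x', S y⟫_ℂ + ⟪y, S x'⟫_ℂ :=
      Complex.ext (by simp) (by rw [him]; simp)
    rw [Complex.ofReal_add, Complex.ofReal_mul (t * (1 - t)), h1]
    simp only [hz, map_add, map_smul, inner_add_left, inner_add_right, inner_smul_left,
      inner_smul_right, hx'0, hy1, Complex.conj_ofReal]
    push_cast
    ring
  -- If the vector vanished, the forms at `(1 - t) x'` and at `t y`, namely 0 and `t²`, would agree,
  -- so `t = 0` and then `x' = 0`.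
  have hz0 : ∀ t, z t ≠ 0 := by
    intro t h
    have h1 : ((1 - t : ℝ) : ℂ) • x' = -((t : ℂ) • y) := eq_neg_of_add_eq_zero_left h
    have h2 : ⟪((1 - t : ℝ) : ℂ) • x', S (((1 - t : ℝ) : ℂ) • x')⟫_ℂ = 0 := by
      rw [map_smul, inner_smul_left, inner_smul_right, hx'0, mul_zero, mul_zero]
    rw [h1, map_neg, inner_neg_neg, map_smul, inner_smul_left, inner_smul_right, hy1] at h2
    have h3 : t = 0 := by simpa using h2
    rw [h3] at h1
    exact hx'1 (by simpa using h1)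
  have hzc : Continuous z := by fun_prop
  set g : ℝ → ℝ := fun t =>
    (t ^ 2 + t * (1 - t) * (⟪x', S y⟫_ℂ + ⟪y, S x'⟫_ℂ).re) / ‖z t‖ ^ 2 with hg
  have hgc : Continuous g := by
    refine Continuous.div (by fun_prop) (by fun_prop) fun t => ?_
    exact pow_ne_zero 2 (norm_ne_zero_iff.2 (hz0 t))
  have hz1 : z 1 = y := by simp [hz]
  have hsub : Set.Icc (0 / ‖z 0‖ ^ 2) (1 / ‖z 1‖ ^ 2) ⊆ g '' Set.Icc 0 1 := by
    have := intermediate_value_Icc zero_le_one (hgc.continuousOn (s := Set.Icc 0 1))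
    simpa [hg] using this
  obtain ⟨t, -, ht⟩ := hsub (a := s) ⟨by simpa using hs.1, by
    rw [hz1, hy, one_pow, div_one]; exact hs.2⟩
  have ht := (div_eq_iff (pow_ne_zero 2 (norm_ne_zero_iff.2 (hz0 t)))).1 ht
  refine ⟨((‖z t‖⁻¹ : ℝ) : ℂ) • z t, ?_, ?_⟩
  · rw [norm_smul, Complex.norm_real, norm_inv, norm_norm,
      inv_mul_cancel₀ (norm_ne_zero_iff.2 (hz0 t))]
  · have := norm_ne_zero_iff.2 (hz0 t)
    rw [map_smul, inner_smul_left, inner_smul_right, hzS, ht, Complex.conj_ofReal,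
      ← Complex.ofReal_mul, ← Complex.ofReal_mul]
    congr 1
    field_simp

/-- The Toeplitz–Hausdorff theorem. -/
theorem convex_image_inner (T : H →L[ℂ] H) :
    Convex ℝ ((fun v => ⟪v, T v⟫_ℂ) '' Metric.sphere 0 1) := by
  rintro _ ⟨x, hx, rfl⟩ _ ⟨y, hy, rfl⟩ α β hα hβ hαβ
  rw [mem_sphere_zero_iff_norm] at hx hy
  obtain rfl : α = 1 - β := by linarith
  dsimp only
  by_cases hab : ⟪y, T y⟫_ℂ - ⟪x, T x⟫_ℂ = 0
  · exact ⟨x, by simpa using hx, by simp [sub_eq_zero.1 hab]; ring⟩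
  set a := ⟪x, T x⟫_ℂ
  set b := ⟪y, T y⟫_ℂ
  have hS : ∀ v : H, ‖v‖ = 1 → ⟪v, ((b - a)⁻¹ • (T - a • 1)) v⟫_ℂ = (b - a)⁻¹ * (⟪v, T v⟫_ℂ - a) := by
    intro v hv
    simp [inner_self_eq_norm_sq_to_K, hv]
  -- An affine change of the operator moves the two given values to 0 and 1.
  obtain ⟨z, hz, hz'⟩ := exists_inner_eq_of_inner_eq_zero_one ((b - a)⁻¹ • (T - a • 1)) hx hy
    (by rw [hS x hx, sub_self, mul_zero]) (by rw [hS y hy, inv_mul_cancel₀ hab])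
    (s := β) ⟨hβ, by linarith⟩
  refine ⟨z, by simpa using hz, ?_⟩
  rw [hS z hz, inv_mul_eq_iff_eq_mul₀ hab, sub_eq_iff_eq_add] at hz'
  dsimp only
  rw [hz', Complex.real_smul, Complex.real_smul]
  push_cast
  ring

end numericalRange

variable {n : ℕ} (A : Matrix (Fin n) (Fin n) ℂ)

lemma numericalRange_eq : numericalRange A =
    (fun v => ⟪v, toEuclideanCLM (𝕜 := ℂ) A v⟫_ℂ) '' Metric.sphere 0 1 := by
  ext z
  simp only [numericalRange, Set.mem_ofPred_eq, Set.mem_image, mem_sphere_zero_iff_norm]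
  refine exists_congr fun v => and_congr_right fun _ => ?_
  rw [eq_comm, ← WithLp.toLp_ofLp 2 v, toEuclideanCLM_toLp, EuclideanSpace.inner_toLp_toLp,
    dotProduct_comm]

lemma convex_numericalRange : Convex ℝ (numericalRange A) := by
  rw [numericalRange_eq]
  exact convex_image_inner _

lemma isCompact_numericalRange : IsCompact (numericalRange A) := by
  rw [numericalRange_eq]
  exact (isCompact_sphere _ _).image (by fun_prop)

lemma numericalRange_nonempty (hn : 1 ≤ n) : (numericalRange A).Nonempty := by
  rw [numericalRange_eq]
  exact Set.Nonempty.image _ ⟨EuclideanSpace.single ⟨0, hn⟩ 1, by simp⟩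

variable {A}

lemma encloses_of_numericalRange {c : SupportCurve} {ε : ℝ}
    (h : ∀ w ∈ numericalRange A, ∀ t, (expI (-t) * w).re ≤ c.p t - ε) :
    Encloses c (toEuclideanCLM (𝕜 := ℂ) A) ε := by
  intro t x
  rcases eq_or_ne x 0 with rfl | hx
  · simp
  have hx' := norm_ne_zero_iff.2 hx
  have h1 := h _ (by
    rw [numericalRange_eq]
    exact ⟨((‖x‖⁻¹ : ℝ) : ℂ) • x, by simp [norm_smul, hx'], rfl⟩) t
  dsimp only at h1
  rw [map_smul, inner_smul_left, inner_smul_right, Complex.conj_ofReal, mul_left_comm,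
    Complex.re_ofReal_mul, mul_left_comm, Complex.re_ofReal_mul, ← mul_assoc, ← mul_inv, ← sq,
    inv_mul_le_iff₀ (by positivity)] at h1
  linarith

end MatFun

/-! ### Outer approximation of convex sets by smooth curves. -/

namespace MatFun

open SupportCurve

section support

/-- The support function of a set in the plane. -/
noncomputable def supportFun (K : Set ℂ) (t : ℝ) : ℝ := sSup ((fun z => (expI (-t) * z).re) '' K)

variable {K : Set ℂ} {R : ℝ}

lemma le_supportFun (hK : IsCompact K) {z : ℂ} (hz : z ∈ K) (t : ℝ) :
    (expI (-t) * z).re ≤ supportFun K t :=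
  le_csSup (hK.image (by fun_prop)).bddAbove ⟨z, hz, rfl⟩

lemma exists_supportFun_eq (hK : IsCompact K) (hne : K.Nonempty) (t : ℝ) :
    ∃ z ∈ K, supportFun K t = (expI (-t) * z).re :=
  hK.exists_sSup_image_eq hne (by fun_prop)

lemma supportFun_periodic (K : Set ℂ) : Function.Periodic (supportFun K) (2 * Real.pi) := by
  intro t
  have : expI (-(t + 2 * Real.pi)) = expI (-t) := by
    rw [expI_neg, expI_periodic, expI_neg]
  rw [supportFun, this, supportFun]

lemma abs_supportFun_le (hK : IsCompact K) (hne : K.Nonempty) (hR : ∀ z ∈ K, ‖z‖ ≤ R) (t : ℝ) :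
    |supportFun K t| ≤ R := by
  obtain ⟨z, hz, h⟩ := exists_supportFun_eq hK hne t
  rw [h]
  refine (Complex.abs_re_le_norm _).trans ?_
  rw [norm_mul, norm_expI, one_mul]
  exact hR z hz

lemma norm_expI_sub_le (s t : ℝ) : ‖expI s - expI t‖ ≤ |s - t| := by
  have := convex_univ.norm_image_sub_le_of_norm_hasDerivWithin_le (𝕜 := ℝ) (f := expI) (C := 1)
    (fun x _ => (hasDerivAt_expI x).hasDerivWithinAt) (fun x _ => by simp [norm_expI])
    (Set.mem_univ t) (Set.mem_univ s)
  simpa using this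

lemma supportFun_sub_le (hK : IsCompact K) (hne : K.Nonempty) (hR : ∀ z ∈ K, ‖z‖ ≤ R) (s t : ℝ) :
    supportFun K s - supportFun K t ≤ R * |s - t| := by
  obtain ⟨z, hz, h⟩ := exists_supportFun_eq hK hne s
  have h1 := le_supportFun hK hz t
  have h2 : ((expI (-s) - expI (-t)) * z).re ≤ R * |s - t| := by
    refine (Complex.re_le_norm _).trans ?_
    rw [norm_mul, mul_comm R]
    have := norm_expI_sub_le (-s) (-t)
    rw [neg_sub_neg, abs_sub_comm] at this
    exact mul_le_mul this (hR z hz) (norm_nonneg _) (abs_nonneg _)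
  rw [sub_mul, Complex.sub_re] at h2
  linarith

lemma abs_supportFun_sub_le (hK : IsCompact K) (hne : K.Nonempty) (hR : ∀ z ∈ K, ‖z‖ ≤ R)
    (s t : ℝ) : |supportFun K s - supportFun K t| ≤ R * |s - t| := by
  rw [abs_le']
  refine ⟨supportFun_sub_le hK hne hR s t, ?_⟩
  rw [neg_sub, abs_sub_comm]
  exact supportFun_sub_le hK hne hR t s

lemma continuous_supportFun (hK : IsCompact K) (hne : K.Nonempty) : Continuous (supportFun K) := by
  obtain ⟨R, hR⟩ := hK.isBounded.exists_norm_le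
  refine (LipschitzWith.of_dist_le_mul (K := R.toNNReal) fun s t => ?_).continuous
  rw [Real.dist_eq, Real.dist_eq]
  exact (abs_supportFun_sub_le hK hne hR s t).trans
    (mul_le_mul_of_nonneg_right (Real.le_coe_toNNReal R) (abs_nonneg _))

/-- This is the discrete form of `h + h'' ≥ 0`: the point extremal at `t` competes at `t ± η`, and
the two rotated directions sum to `2 cos η` times the middle one. -/
lemma two_mul_cos_mul_supportFun_le (hK : IsCompact K) (hne : K.Nonempty) (η t : ℝ) :
    2 * Real.cos η * supportFun K t ≤ supportFun K (t + η) + supportFun K (t - η) := by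
  obtain ⟨z, hz, h⟩ := exists_supportFun_eq hK hne t
  have h1 := le_supportFun hK hz (t + η)
  have h2 := le_supportFun hK hz (t - η)
  have h3 : expI (-(t + η)) + expI (-(t - η)) = ((2 * Real.cos η : ℝ) : ℂ) * expI (-t) := by
    rw [show -(t + η) = -η + -t by ring, show -(t - η) = η + -t by ring, expI_add, expI_add,
      expI_eq η, expI_eq (-η), Real.cos_neg, Real.sin_neg]
    push_cast; ring
  have h4 := congrArg (fun a : ℂ => (a * z).re) h3
  simp only [add_mul, Complex.add_re, mul_assoc, Complex.re_ofReal_mul] at h4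
  rw [h]
  linarith

/-- A point that violates no support inequality by more than `δ` has distance at most `δ` from
the convex set. -/
lemma mem_cthickening_of_le_supportFun (hK : IsCompact K) (hne : K.Nonempty) (hc : Convex ℝ K)
    {δ : ℝ} (hδ : 0 ≤ δ) {w : ℂ} (hw : ∀ t, (expI (-t) * w).re ≤ supportFun K t + δ) :
    w ∈ Metric.cthickening δ K := by
  -- The nearest point `v` maximizes the direction `w - v` over the set, so the inequality for that
  -- one direction bounds the distance.
  obtain ⟨v, hv, hmin⟩ := exists_norm_eq_iInf_of_complete_convex hne hK.isComplete hc w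
  rw [norm_eq_iInf_iff_real_inner_le_zero hc hv] at hmin
  refine Metric.mem_cthickening_of_dist_le w v δ K hv ?_
  obtain ⟨z, hz, h⟩ := exists_supportFun_eq hK hne (w - v).arg
  have h0 : ∀ u : ℂ, (‖w - v‖ * (expI (-(w - v).arg) * u).re) = inner ℝ (w - v) u := by
    intro u
    rw [Complex.inner, mul_comm u, ← Complex.re_ofReal_mul, ← mul_assoc, ← star_expI]
    congr 2
    conv_rhs => rw [← Complex.norm_mul_exp_arg_mul_I (w - v)]
    rw [map_mul, Complex.conj_ofReal]
    rfl
  have h1 := hmin z hz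
  rw [← h0] at h1
  have h2 := hw (w - v).arg
  have h3 := h0 (w - v)
  rw [real_inner_self_eq_norm_sq] at h3
  rcases (norm_nonneg (w - v)).eq_or_lt with hd | hd
  · rw [dist_eq_norm, ← hd]
    exact hδ
  · have h4 : (expI (-(w - v).arg) * (z - v)).re ≤ 0 := nonpos_of_mul_nonpos_right h1 hd
    have h5 : ‖w - v‖ = (expI (-(w - v).arg) * (w - v)).re :=
      mul_left_cancel₀ hd.ne' (by rw [h3, sq])
    rw [dist_eq_norm, h5]
    rw [mul_sub, Complex.sub_re] at h4 ⊢
    linarith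

end support

section average

/-- The average of `h` over the interval from `t` to `t + a`. -/
noncomputable def average (a : ℝ) (h : ℝ → ℝ) (t : ℝ) : ℝ := a⁻¹ * ∫ u in t..(t + a), h u

variable {h : ℝ → ℝ}

lemma hasDerivAt_average (hh : Continuous h) (a t : ℝ) :
    HasDerivAt (average a h) (a⁻¹ * (h (t + a) - h t)) t := by
  have hi : ∀ x y, IntervalIntegrable h MeasureTheory.volume x y := fun x y =>
    hh.intervalIntegrable x y
  have h1 : ∀ x, HasDerivAt (fun x => ∫ u in (0 : ℝ)..x, h u) (h x) x := fun x =>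
    intervalIntegral.integral_hasDerivAt_right (hi 0 x)
      hh.stronglyMeasurable.stronglyMeasurableAtFilter hh.continuousAt
  have h2 := (((h1 (t + a)).comp_add_const t a).fun_sub (h1 t)).const_mul a⁻¹
  refine h2.congr_of_eventuallyEq (Eventually.of_forall fun x => ?_)
  simp only [average]
  rw [intervalIntegral.integral_interval_sub_left (hi _ _) (hi _ _)]

lemma continuous_average (hh : Continuous h) (a : ℝ) : Continuous (average a h) :=
  continuous_iff_continuousAt.2 fun t => (hasDerivAt_average hh a t).continuousAt

lemma average_periodic {T : ℝ} (hh : Function.Periodic h T) (a : ℝ) :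
    Function.Periodic (average a h) T := by
  intro t
  have := intervalIntegral.integral_comp_add_right h T (a := t) (b := t + a)
  rw [average, average, add_right_comm, ← this]
  simp only [hh _]

lemma abs_average_sub_le (hh : Continuous h) {a t C B : ℝ} (ha : a ≠ 0)
    (hB : ∀ x, |x - t| ≤ |a| → |h x - C| ≤ B) : |average a h t - C| ≤ B := by
  have h1 : average a h t - C = a⁻¹ * ∫ u in t..(t + a), (h u - C) := by
    rw [intervalIntegral.integral_sub (hh.intervalIntegrable _ _)
      (continuous_const.intervalIntegrable _ _), intervalIntegral.integral_const, average]
    field_simp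
    simp
  have h2 : ‖∫ u in t..(t + a), (h u - C)‖ ≤ B * |t + a - t| := by
    refine intervalIntegral.norm_integral_le_of_norm_le_const fun x hx => hB x ?_
    have := Set.abs_sub_left_of_mem_uIcc (Set.uIoc_subset_uIcc hx)
    simpa using this
  rw [add_sub_cancel_left] at h2
  rw [h1, abs_mul, abs_inv, inv_mul_le_iff₀ (abs_pos.2 ha), mul_comm]
  exact h2

end average

/-- A compact convex set is approximated from outside by the regions of smooth curves. -/
theorem exists_supportCurve {K : Set ℂ} (hK : IsCompact K) (hne : K.Nonempty) (hc : Convex ℝ K)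
    {δ : ℝ} (hδ : 0 < δ) :
    ∃ (c : SupportCurve) (ε s : ℝ) (_ : 0 < ε) (hs : 0 < s),
      (∀ w ∈ K, ∀ t, (expI (-t) * w).re ≤ c.p t - ε) ∧
      (c.shift s hs.le).region ⊆ Metric.cthickening δ K := by
  obtain ⟨R, hR0, hR⟩ := hK.isBounded.exists_pos_norm_le
  set κ := δ / 4 with hκ
  have hκ0 : 0 < κ := by positivity
  -- Two averages move the argument by at most `2 η` and `h` is `R`-Lipschitz, hence the last
  -- condition; `η ≤ 1` is for the Taylor bound of the cosine.
  obtain ⟨η, hη0, hη1, hηR⟩ : ∃ η : ℝ, 0 < η ∧ η ≤ 1 ∧ R * (2 * η) ≤ κ := by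
    refine ⟨min 1 (κ / (2 * R)), by positivity, min_le_left _ _, ?_⟩
    calc R * (2 * min 1 (κ / (2 * R))) ≤ R * (2 * (κ / (2 * R))) := by
          gcongr; exact min_le_right _ _
      _ = κ := by field_simp
  set h := supportFun K
  have hh : Continuous h := continuous_supportFun hK hne
  have hp : Function.Periodic h (2 * Real.pi) := supportFun_periodic K
  have hh1 := continuous_average hh η
  -- Averaging forward and then backward makes the second derivative the centred second difference
  -- of `h`.
  set h₂ := average (-η) (average η h) with hh2
  have hclose : ∀ t, |h₂ t - h t| ≤ κ := by
    intro t
    refine abs_average_sub_le hh1 (neg_ne_zero.2 hη0.ne') fun x hx => ?_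
    refine abs_average_sub_le hh hη0.ne' fun y hy => ?_
    rw [abs_neg, abs_of_pos hη0] at hx
    rw [abs_of_pos hη0] at hy
    refine (abs_supportFun_sub_le hK hne hR y t).trans (le_trans ?_ hηR)
    gcongr
    linarith [abs_sub_le y x t]
  have hpos : ∀ t, 0 ≤ h₂ t + 2 * κ + (-η)⁻¹ * (η⁻¹ * (h (t + -η + η) - h (t + -η)) -
      η⁻¹ * (h (t + η) - h t)) := by
    intro t
    have e : (-η)⁻¹ * (η⁻¹ * (h (t + -η + η) - h (t + -η)) - η⁻¹ * (h (t + η) - h t)) =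
        (h (t + η) + h (t - η) - 2 * h t) / η ^ 2 := by
      rw [neg_add_cancel_right, ← sub_eq_add_neg]
      field_simp
      ring
    rw [e]
    have h1 := abs_le.1 (hclose t)
    have h2 := two_mul_cos_mul_supportFun_le hK hne η t
    have h3 := Real.cos_bound (x := η) (by rwa [abs_of_pos hη0])
    have h4 : |h t| ≤ R := abs_supportFun_le hK hne hR t
    rw [abs_of_pos hη0] at h3
    -- Since `2 cos η - 2` is `-η²` up to a fourth order term, the discrete convexity costs only
    -- `κ`. Together with the `κ` lost in `hclose`, this explains the offset `2 κ` in `p`.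
    have h5 : -(h t + κ) ≤ (h (t + η) + h (t - η) - 2 * h t) / η ^ 2 := by
      rw [le_div_iff₀ (by positivity)]
      have h6 : |h t * (2 * (Real.cos η - (1 - η ^ 2 / 2)))| ≤ κ * η ^ 2 := by
        rw [abs_mul, abs_mul, abs_two]
        calc |h t| * (2 * |Real.cos η - (1 - η ^ 2 / 2)|) ≤ R * (2 * (η ^ 4 * (5 / 96))) := by
              gcongr
          _ = (R * (2 * η)) * (η ^ 2 * (η * (5 / 96))) := by ring
          _ ≤ κ * (η ^ 2 * 1) := by gcongr; linarith
          _ = κ * η ^ 2 := by ring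
      have h7 := (abs_le.1 h6).1
      change 2 * Real.cos η * h t ≤ h (t + η) + h (t - η) at h2
      nlinarith
    linarith
  let c : SupportCurve :=
    { p := fun t => h₂ t + 2 * κ
      p' := fun t => (-η)⁻¹ * (average η h (t + -η) - average η h t)
      p'' := fun t => (-η)⁻¹ * (η⁻¹ * (h (t + -η + η) - h (t + -η)) - η⁻¹ * (h (t + η) - h t))
      hasDerivAt_p := fun t => (hasDerivAt_average hh1 (-η) t).add_const _
      hasDerivAt_p' := fun t =>
        (((hasDerivAt_average hh η (t + -η)).comp_add_const t (-η)).fun_sub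
          (hasDerivAt_average hh η t)).const_mul _
      continuous_p'' := by fun_prop
      periodic_p := fun t => by
        dsimp only
        rw [hh2, average_periodic (average_periodic hp η) (-η) t]
      periodic_p' := fun t => by
        dsimp only
        rw [average_periodic hp η t, add_right_comm, average_periodic hp η]
      nonneg := hpos }
  -- The margins add up: `p - κ ≥ h` inside, and `p + κ ≤ h + 4 κ = h + δ` outside.
  refine ⟨c, κ, κ, hκ0, hκ0, fun w hw t => ?_, fun w hw => ?_⟩
  · have h1 := le_supportFun hK hw t
    have h2 := abs_le.1 (hclose t)
    change _ ≤ h₂ t + 2 * κ - κ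
    change _ ≤ h t at h1
    linarith
  · refine mem_cthickening_of_le_supportFun hK hne hc hδ.le fun t => ?_
    have h1 : (expI (-t) * w).re < h₂ t + 2 * κ + κ := hw t
    have h2 := abs_le.1 (hclose t)
    change _ ≤ h t + δ
    linarith

end MatFun

/-! ### Assembly of the theorem. -/

namespace MatFun

open SupportCurve Matrix

variable {n : ℕ} {A : Matrix (Fin n) (Fin n) ℂ} {f : ℂ → ℂ}

/-- If `f` is analytic and `‖f'‖ ≤ m` on an open set containing the numerical range, then the
Fréchet derivative exists and is bounded by `(1 + √2)² m`. -/
theorem exists_isFrechetDerivative (hn : 1 ≤ n) {U : Set ℂ} (hU : IsOpen U)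
    (hf : AnalyticOnNhd ℂ f U) (hA : numericalRange A ⊆ U) {m : ℝ} (hm : 0 < m)
    (hb : ∀ z ∈ U, ‖deriv f z‖ ≤ m) :
    ∃ L : Matrix (Fin n) (Fin n) ℂ →ₗ[ℂ] Matrix (Fin n) (Fin n) ℂ, IsFrechetDerivative f A L ∧
      ∀ X, frobeniusNorm (L X) ≤ (1 + √2) ^ 2 * m * frobeniusNorm X := by
  have hK := isCompact_numericalRange A
  have hne := numericalRange_nonempty A hn
  obtain ⟨δ, hδ, hδU⟩ := hK.exists_cthickening_subset_open hU hA
  obtain ⟨c, ε, s, hε, hs, hcA, hcU⟩ := exists_supportCurve hK hne (convex_numericalRange A) hδ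
  have hreg := hcU.trans hδU
  have hEnc := encloses_of_numericalRange hcA
  obtain ⟨w, hw⟩ := hne
  have hwc : w ∈ c.region := fun t => by linarith [hcA w hw t]
  set c₂ := c.shift (s / 2 / 2) (half_pos (half_pos hs)).le with hc₂
  have hlt : ∀ t, c₂.p t < (c.shift s hs.le).p t := fun t => by
    simp only [hc₂, shift_p]; linarith
  have hEnc₂ : Encloses c₂ (toEuclideanCLM (𝕜 := ℂ) A) ε :=
    hEnc.mono fun t => by simp only [hc₂, shift_p]; linarith
  have hf' := hf.mono hreg
  obtain ⟨L, hL⟩ := exists_frechet hEnc₂ hε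
    (hf'.continuousOn.comp_continuous c₂.continuous_path (path_mem_region hlt))
  exact ⟨L, isFrechetDerivative_of_eq_cint hlt hf' hEnc₂ hε hL, fun X =>
    frobeniusNorm_frechet_le hEnc hε hwc hs hf'.differentiableOn hm
      (fun z hz => hb z (hreg hz)) hL X⟩

end MatFun

theorem corollary5p1 {n : ℕ} (hn : 1 ≤ n) (A : Matrix (Fin n) (Fin n) ℂ) (Ω : Set ℂ)
    (hΩ : IsOpen Ω) (f : ℂ → ℂ) (hf : AnalyticOnNhd ℂ f Ω)
    (hA : MatFun.numericalRange A ⊆ Ω) :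
    (∃! L : Matrix (Fin n) (Fin n) ℂ →ₗ[ℂ] Matrix (Fin n) (Fin n) ℂ,
      MatFun.IsFrechetDerivative f A L) ∧
    ∃ M : ℝ, IsGreatest ((fun z => ‖deriv f z‖) '' MatFun.numericalRange A) M ∧
      ∀ L : Matrix (Fin n) (Fin n) ℂ →ₗ[ℂ] Matrix (Fin n) (Fin n) ℂ,
        MatFun.IsFrechetDerivative f A L → MatFun.inducedNorm L ≤ (1 + √2) ^ 2 * M := by
  have hcont : ContinuousOn (fun z => ‖deriv f z‖) Ω := hf.deriv.continuousOn.norm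
  obtain ⟨M, hM⟩ := ((MatFun.isCompact_numericalRange A).image_of_continuousOn
    (hcont.mono hA)).exists_isGreatest ((MatFun.numericalRange_nonempty A hn).image _)
  have hM0 : 0 ≤ M := by
    obtain ⟨z, -, rfl⟩ := hM.1
    exact norm_nonneg _
  have key : ∀ δ > 0, ∃ L : Matrix (Fin n) (Fin n) ℂ →ₗ[ℂ] Matrix (Fin n) (Fin n) ℂ,
      MatFun.IsFrechetDerivative f A L ∧ ∀ X, MatFun.frobeniusNorm (L X) ≤
        (1 + √2) ^ 2 * (M + δ) * MatFun.frobeniusNorm X := by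
    intro δ hδ
    -- The open set consists of the points of `Ω` where `‖f'‖ < M + δ`; it contains the numerical
    -- range.
    refine MatFun.exists_isFrechetDerivative hn
      (hcont.isOpen_inter_preimage hΩ (isOpen_Iio (a := M + δ))) (hf.mono Set.inter_subset_left)
      (fun z hz => ⟨hA hz, ?_⟩) (by positivity) fun z hz => le_of_lt hz.2
    exact (hM.2 ⟨z, hz, rfl⟩).trans_lt (lt_add_of_pos_right M hδ)
  refine ⟨?_, M, hM, fun L hL => ?_⟩
  · obtain ⟨L, hL, -⟩ := key 1 one_pos
    exact ⟨L, hL, fun L' hL' => hL'.eq hL⟩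
  · refine csSup_le ⟨_, 0, by simp [MatFun.frobeniusNorm], rfl⟩ ?_
    rintro _ ⟨X, hX, rfl⟩
    refine le_of_forall_pos_le_add fun δ hδ => ?_
    -- The derivative obtained for each `δ` is the same operator by uniqueness, so the excess can be
    -- made arbitrarily small; the scaling makes it exactly `δ`.
    obtain ⟨L', hL', hb⟩ := key (δ / (1 + √2) ^ 2) (by positivity)
    rw [hL.eq hL']
    refine (hb X).trans ((mul_le_of_le_one_right (by positivity) hX).trans_eq ?_)
    field_simp
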